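/- Setting. Let $\Omega\subset\mathbb R^2$ be a non-empty bounded open convex set, $V$ its open $1$-neighbourhood, and $\gamma:[0,L)\to\partial\Omega$ a counterclockwise parametrization of $\partial\Omega$ by arclength. Let $\tau:[0,\infty)\to[0,\infty)$ be non-decreasing, concave and lower semi-continuous with $\tau(0)=0$, and let $\tau'(0)\in[0,\infty]$ be its right derivative at $0$. Let $\mu_+,\mu_-$ be finite Borel measures supported on $\partial\Omega$ with equal mass. For $x\in V\setminus\Omega$ let $\pi(x)$ be the point of $\partial\Omega$ nearest to $x$ and put $$u_0(x)=(\mu_+-\mu_-)\big(\gamma([0,\gamma^{-1}(\pi(x))))\big)-k,$$ where the constant $k$ is chosen such that $\inf u_0=0$; let $M=\sup u_0$. For a function $u$ let $1_u(x,s)=1$ if $u(x)>s$ and $1_u(x,s)=0$ otherwise; extend $1_{u_0}$ by $1$ to $V\times(-\infty,0)$ and by $0$ to $V\times(M,\infty)$. Let $$\mathcal C=\{v:V\times\mathbb R\to[0,1]\ \text{of bounded variation}\;:\; v=1_{u_0}\text{ a.e. on }(V\times\mathbb R)\setminus(\overline\Omega\times[0,M])\},$$ where bounded variation means that the distributional derivative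 $Dv$ is a vector measure of finite total variation. Let $\tilde{\mathcal K}$ be the set of continuous fields $\phi=(\phi^x,\phi^s):\overline\Omega\times[0,M]\to\mathbb R^2\times[0,\infty)$ with $|\phi^x|\le\tau'(0)$ and $\big|\int_{s_1}^{s_2}\phi^x(x,s)\,ds\big|\le\tau(s_2-s_1)$ for all $x\in\overline\Omega$, $0\le s_1<s_2\le M$. For $v$ of bounded variation let $$\tilde{\mathcal G}(v)=\sup_{\phi\in\tilde{\mathcal K}}\int_{\overline\Omega\times[0,M]}\phi\cdot dDv\in[0,\infty],$$ and let $\tilde{\mathcal G}(v)=\infty$ otherwise. Let $\chi_{\{v>t\}}$ be the characteristic function of the superlevel set $\{v>t\}$. Proposition (Convex cost of superlevel sets). 1. For every $v\in\mathcal C$: $\chi_{\{v>t\}}\in\mathcal C$ for almost every $t\in(0,1)$, the function $t\mapsto\tilde{\mathcal G}(\chi_{\{v>t\}})$ is Lebesgue measurable on $(0,1)$, and $$\tilde{\mathcal G}(v)\le\int_0^1\tilde{\mathcal G}(\chi_{\{v>t\}})\,dt.$$ 2. If $\tau$ is one-homogeneous, $\tau(s)=\alpha s$ for all $s\ge0$,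 then equality holds for every $v\in\mathcal C$. 3. In general the inequality can be strict. Let $m,c>0$ and $b\in\mathbb R$ be such that $u(x)=mx_1+b$ satisfies $0\le u$ and $u+c\le M$ on $\Omega$, and let $\tau(c)<\tau'(0)\,c$. Then the function $$v(x,s)=\int_0^1 1_{u+tc}(x,s)\,dt\ \text{ for }x\in\Omega,\qquad v(x,s)=1_{u_0}(x,s)\ \text{ for }x\in V\setminus\Omega$$ belongs to $\mathcal C$ and satisfies $\tilde{\mathcal G}(v)<\int_0^1\tilde{\mathcal G}(\chi_{\{v>t\}})\,dt$. 4. Consequently, if $\tau$ is not linear on $[0,M]$, then $\tilde{\mathcal G}(v)<\int_0^1\tilde{\mathcal G}(\chi_{\{v>t\}})\,dt$ for some $v\in\mathcal C$; and for given $\Omega$, $\gamma$ and $\tau$ not linear on $[0,\infty)$ there exist $\mu_+,\mu_-$ for which such a $v$ exists. -/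

import Mathlib

open MeasureTheory Set Filter Topology
open scoped ENNReal ContDiff

noncomputable section

namespace BranchedTransport

/-- The Euclidean plane. -/
abbrev Plane : Type := EuclideanSpace ℝ (Fin 2)

/-- The lifted space `ℝ² × ℝ`; its points are written `(x, s)`. -/
abbrev Lifted : Type := Plane × ℝ

/-- A transportation cost: a non-decreasing, concave, lower semi-continuous function
`τ : [0, ∞) → [0, ∞)` with `τ 0 = 0`. The values of `τ` at negative numbers are never used. -/
structure IsTransportationCost (τ : ℝ → ℝ) : Prop where
  nonneg : ∀ m, 0 ≤ m → 0 ≤ τ m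
  zero : τ 0 = 0
  mono : MonotoneOn τ (Ici 0)
  concave : ConcaveOn ℝ (Ici 0) τ
  lsc : LowerSemicontinuousOn τ (Ici 0)

/-- The right derivative `τ'(0) ∈ [0, ∞]`. For a transportation cost the difference quotients
`τ h / h = (τ h - τ 0) / (h - 0)` increase as `h` decreases to `0`, so the upper limit is a
limit. -/
def rightDerivZero (τ : ℝ → ℝ) : ℝ≥0∞ :=
  limsup (fun h : ℝ => ENNReal.ofReal (τ h / h)) (𝓝[>] 0)

/-- `γ`, restricted to `[0, L)`, is a counterclockwise parametrization by arclength of the closed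
curve `∂Ω` (hence `L` is the length of `∂Ω`). Counterclockwise means that `Ω` lies to the left of
the tangent wherever `γ` is differentiable. -/
structure IsArclengthParam (Ω : Set Plane) (γ : ℝ → Plane) (L : ℝ) : Prop where
  pos : 0 < L
  closed : γ L = γ 0
  bijOn : BijOn γ (Ico 0 L) (frontier Ω)
  unitSpeed : HasUnitSpeedOn γ (Icc 0 L)
  counterclockwise : ∀ t ∈ Ioo 0 L, ∀ w : Plane, HasDerivAt γ w t →
    ∀ x ∈ Ω, 0 < w 0 * (x 1 - γ t 1) - w 1 * (x 0 - γ t 0)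

/-- A material source `μp` and a material sink `μm`: finite Borel measures of equal mass that are
supported on `∂Ω`. -/
structure IsSourceSink (Ω : Set Plane) (μp μm : Measure Plane) : Prop where
  finite_source : IsFiniteMeasure μp
  finite_sink : IsFiniteMeasure μm
  source_boundary : μp (frontier Ω)ᶜ = 0
  sink_boundary : μm (frontier Ω)ᶜ = 0
  equal_mass : μp univ = μm univ

/-- `(μ₊ - μ₋)(γ([0, t)))`. -/
def netMass (γ : ℝ → Plane) (μp μm : Measure Plane) (t : ℝ) : ℝ :=
  μp.real (γ '' Ico 0 t) - μm.real (γ '' Ico 0 t)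

/-- `γ⁻¹(π(x))`, with `π(x)` the point of `∂Ω` nearest to `x`. (For convex `Ω` and `x ∉ Ω` the
nearest point is unique, so the set below has exactly one element.) -/
def boundaryParam (Ω : Set Plane) (γ : ℝ → Plane) (L : ℝ) (x : Plane) : ℝ :=
  sInf {t | t ∈ Ico 0 L ∧ dist x (γ t) = Metric.infDist x (frontier Ω)}

/-- The boundary image `u(μ₊, μ₋)` on `V ∖ Ω`, normalized by an additive constant so that its
infimum is `0`. -/
def boundaryImage (Ω : Set Plane) (γ : ℝ → Plane) (L : ℝ) (μp μm : Measure Plane)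
    (x : Plane) : ℝ :=
  netMass γ μp μm (boundaryParam Ω γ L x) - sInf (netMass γ μp μm '' Ico 0 L)

/-- The supremum `M` of the normalized boundary image. -/
def maxValue (γ : ℝ → Plane) (L : ℝ) (μp μm : Measure Plane) : ℝ :=
  sSup (netMass γ μp μm '' Ico 0 L) - sInf (netMass γ μp μm '' Ico 0 L)

/-- The characteristic function `1_u` of the subgraph of an image `u`. -/
def subgraph (u : Plane → ℝ) (p : Lifted) : ℝ := if p.2 < u p.1 then 1 else 0

/-- `V × ℝ`, where `V` is the open `1`-neighbourhood of `Ω`. -/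
def liftedDomain (Ω : Set Plane) : Set Lifted := Metric.thickening 1 Ω ×ˢ (univ : Set ℝ)

/-- The closed cylinder `closure Ω × [0, M]`. -/
def cylinder (Ω : Set Plane) (M : ℝ) : Set Lifted := closure Ω ×ˢ Icc 0 M

/-- The prescribed values outside the cylinder: `1_{u(μ₊, μ₋)}`, extended by `1` to
`V × (-∞, 0)` and by `0` to `V × (M, ∞)`. -/
def boundaryLift (Ω : Set Plane) (γ : ℝ → Plane) (L : ℝ) (μp μm : Measure Plane)
    (p : Lifted) : ℝ :=
  if p.2 < 0 then 1
  else if maxValue γ L μp μm < p.2 then 0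
  else subgraph (boundaryImage Ω γ L μp μm) p

/-- On the open set `U`, the distributional derivative of the locally integrable function `v` is
the vector measure `(Dx, Ds)`, which has finite total variation. Only the restriction of
`(Dx, Ds)` to `U` matters, and this restriction is uniquely determined by `v`. -/
structure IsGradientMeasure (U : Set Lifted) (v : Lifted → ℝ) (Dx : VectorMeasure Lifted Plane)
    (Ds : SignedMeasure Lifted) : Prop where
  locallyIntegrable : LocallyIntegrableOn v U
  finite_x : Dx.variation univ < ⊤
  finite_s : Ds.variation univ < ⊤
  deriv_x : ∀ ψ : Lifted → ℝ, ContDiff ℝ ∞ ψ → HasCompactSupport ψ → tsupport ψ ⊆ U →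
    ∀ w : Plane,
      ∫ p in U, v p * fderiv ℝ ψ p (w, 0) = -inner ℝ w (∫ᵛ p in U, ψ p ∂•Dx)
  deriv_s : ∀ ψ : Lifted → ℝ, ContDiff ℝ ∞ ψ → HasCompactSupport ψ → tsupport ψ ⊆ U →
    ∫ p in U, v p * fderiv ℝ ψ p (0, 1) = -∫ᵛ p in U, ψ p ∂•Ds

/-- The set `𝒞` of functions `v : V × ℝ → [0, 1]` of bounded variation that equal the prescribed
values on `(V × ℝ) ∖ (closure Ω × [0, M])`. As these functions equal `1` on `V × (-∞, 0)`,
bounded variation means locally integrable with a derivative of finite total variation. -/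
structure MemC (Ω : Set Plane) (γ : ℝ → Plane) (L : ℝ) (μp μm : Measure Plane)
    (v : Lifted → ℝ) : Prop where
  range : ∀ᵐ p ∂(volume.restrict (liftedDomain Ω)), v p ∈ Icc (0 : ℝ) 1
  boundedVariation : ∃ Dx Ds, IsGradientMeasure (liftedDomain Ω) v Dx Ds
  boundary : ∀ᵐ p ∂(volume.restrict (liftedDomain Ω \ cylinder Ω (maxValue γ L μp μm))),
    v p = boundaryLift Ω γ L μp μm p

/-- The set `𝒦̃` of continuous fields `φ = (φx, φs)` on `closure Ω × [0, M]` with `φs ≥ 0`,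
`|φx| ≤ τ'(0)` and `|∫_{s₁}^{s₂} φx(x, s) ds| ≤ τ(s₂ - s₁)`. -/
structure MemK (Ω : Set Plane) (M : ℝ) (τ : ℝ → ℝ) (φx : Lifted → Plane) (φs : Lifted → ℝ) :
    Prop where
  continuous_x : ContinuousOn φx (cylinder Ω M)
  continuous_s : ContinuousOn φs (cylinder Ω M)
  bound : ∀ p ∈ cylinder Ω M, ‖φx p‖ₑ ≤ rightDerivZero τ
  nonneg : ∀ p ∈ cylinder Ω M, 0 ≤ φs p
  integral_bound : ∀ x ∈ closure Ω, ∀ s₁ s₂ : ℝ, 0 ≤ s₁ → s₁ < s₂ → s₂ ≤ M →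
    ‖∫ s in s₁..s₂, φx (x, s)‖ ≤ τ (s₂ - s₁)

/-- The convex generalized branched transport cost
`G̃(v) = sup_{φ ∈ 𝒦̃} ∫_{closure Ω × [0, M]} φ · dDv ∈ [0, ∞]`. The supremum is not affected by
replacing the integrals by their positive parts, since `φ = 0` is admissible. The infimum is over
a single derivative `Dv = (Dx, Ds)` (up to its irrelevant values outside `V × ℝ`) if `v` has
bounded variation, and it gives the value `∞` otherwise. -/
def convexCost (Ω : Set Plane) (M : ℝ) (τ : ℝ → ℝ) (v : Lifted → ℝ) : ℝ≥0∞ :=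
  ⨅ (Dx : VectorMeasure Lifted Plane) (Ds : SignedMeasure Lifted)
    (_ : IsGradientMeasure (liftedDomain Ω) v Dx Ds),
    ⨆ (φx : Lifted → Plane) (φs : Lifted → ℝ) (_ : MemK Ω M τ φx φs),
      ENNReal.ofReal ((∫ᵛ p in cylinder Ω M, φx p ∂[innerSL ℝ; Dx])
        + ∫ᵛ p in cylinder Ω M, φs p ∂•Ds)

/-- The characteristic function `χ_{v > t}` of the `t`-superlevel set of `v`. -/
def superlevel (v : Lifted → ℝ) (t : ℝ) : Lifted → ℝ := indicator {p | t < v p} fun _ => 1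

/-- The function equal to the average `∫₀¹ 1_{u + t c} dt` on `Ω × ℝ`, where `u(x) = m x₁ + b`,
and equal to the prescribed values on `(V ∖ Ω) × ℝ`. -/
def averagedLift (Ω : Set Plane) (γ : ℝ → Plane) (L : ℝ) (μp μm : Measure Plane) (m b c : ℝ)
    (p : Lifted) : ℝ :=
  open Classical in
  if p.1 ∈ Ω then ∫ t in (0 : ℝ)..1, subgraph (fun x => m * x 0 + b + t * c) p
  else boundaryLift Ω γ L μp μm p

end BranchedTransport

end

open BranchedTransport

/-! A function with values in `[0, 1]` is the average of the characteristic functions of its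
superlevel sets, and the flux of a fixed field through `Dv` is linear in `v`. Hence the flux for `v`
is the average over `t` of the fluxes for `χ_{v>t}`. Bounding each of these by the cost of the level
and then taking the supremum over fields gives the inequality
(`convexCost_le_lintegral_superlevel`). A supremum of averages is at most the average of suprema;
the gap is that the best field may depend on `t`.

What needs work is that almost every level has bounded variation. This rests on difference
quotients: `|a - b|` is the integral over `t` of the difference of the indicators of `t < a` and `t
< b`, so the `L¹` norm of a difference quotient of `v` is the integral over `t` of those of the
levels. Fatou's lemma bounds the levels for almost every `t`, and weak compactness of measures
produces their gradients (`exists_hasGrad_of_liminf`, `IsNormalized.exists_hasLevelGrads`).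
Measurability in `t` holds because the admissible fields are separable in the uniform norm
(`exists_countable_fields`).

For `τ s = α s` the constraint on fields is pointwise, so the cost is `α` times the total variation
of the horizontal gradient on the cylinder if the vertical derivative is nonpositive there, and
infinite otherwise. Equality then follows from a coarea inequality (`HasLevelGrads.exists_coarea`).
It is applied to the vertical direction, where it forces the sign on almost every level, and to the
horizontal directions averaged over a disc, which recovers the Euclidean norm.

For strictness, the levels of the averaged function are, over `Ω`, subgraphs of parallel affine
functions. A field common to all levels has mean at most `τ(c) / c` along each vertical segment
between the lowest and the highest graph. A field adapted to a single graph may instead equal any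
`a` below `τ'(0)` on it, with a narrow tent as vertical profile. Choosing `a` above `τ(c) / c` gains
a fixed positive amount (`RampSetting.convexCost_lt`). The conclusion also needs the averaged
function to have finite cost, even if `τ'(0) = ∞`. This holds because the fields enter only through
their integrals along vertical lines, which are at most `τ(M)` (`RampSetting.exists_flux_le`).

That the averaged function has bounded variation together with its outer values uses that the
boundary image is constant on the fibers of the nearest point projection. These fibers are convex,
and the starting points in a ball of segments of length at most `h` that meet a convex set without
having both ends in it have volume `O(h)` (`volume_crossing_le`). -/

namespace BranchedTransport

/-! ### Integration against vector measures with a density -/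

section WithDensity

variable {X E F G : Type*} [MeasurableSpace X]
  [NormedAddCommGroup E] [NormedSpace ℝ E]
  [NormedAddCommGroup F] [NormedSpace ℝ F] [CompleteSpace F]
  [NormedAddCommGroup G] [NormedSpace ℝ G] [CompleteSpace G]

-- The variation of `lam.withDensityᵥ f` has density `‖f‖` with respect to `lam`, so integrability
-- of `g` for it means integrability of `‖f‖ • g`.
omit [CompleteSpace G] in
theorem integrable_bilin_of_integrable_variation {lam : Measure X} {f : X → F}
    (hf : Integrable f lam) (B : E →L[ℝ] F →L[ℝ] G) {g : X → E}
    (hg : Integrable g (lam.withDensityᵥ f).variation) :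
    Integrable (fun x => B (g x) (f x)) lam ∧
      ∫⁻ x, ‖B (g x) (f x)‖ₑ ∂lam ≤ ‖B‖ₑ * ∫⁻ x, ‖g x‖ₑ ∂(lam.withDensityᵥ f).variation := by
  rw [Measure.variation_withDensityᵥ hf] at hg ⊢
  have h1 : Integrable (fun x => ‖f x‖ • g x) lam := by
    have := (integrable_withDensity_iff_integrable_smul₀' (f := fun x => ‖f x‖ₑ)
      hf.aestronglyMeasurable.enorm (by simp)).1 hg
    simpa using this
  have hm : AEStronglyMeasurable (fun x => B (g x) (f x)) lam := by
    -- Only `‖f‖ • g` is known to be measurable for `lam`. The factor `‖f‖` is moved from the second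
    -- argument of `B` to the first; where `f` vanishes both expressions are zero.
    have h2 := B.aestronglyMeasurable_comp₂ h1.aestronglyMeasurable
      (hf.aestronglyMeasurable.norm.inv₀.smul hf.aestronglyMeasurable)
    refine h2.congr (Eventually.of_forall fun x => ?_)
    rcases eq_or_ne (f x) 0 with h | h
    · simp [h]
    · simp [h, smul_smul]
  have hle : ∫⁻ x, ‖B (g x) (f x)‖ₑ ∂lam
      ≤ ‖B‖ₑ * ∫⁻ x, ‖g x‖ₑ ∂(lam.withDensity fun x => ‖f x‖ₑ) := by
    rw [lintegral_withDensity_eq_lintegral_mul₀' hf.aestronglyMeasurable.enorm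
      hg.aestronglyMeasurable.enorm, ← lintegral_const_mul' _ _ (by simp)]
    refine lintegral_mono fun x => ?_
    simp only [Pi.mul_apply]
    calc ‖B (g x) (f x)‖ₑ ≤ ‖B‖ₑ * ‖g x‖ₑ * ‖f x‖ₑ := by
          simp only [← ofReal_norm]
          rw [← ENNReal.ofReal_mul (by positivity), ← ENNReal.ofReal_mul (by positivity)]
          exact ENNReal.ofReal_le_ofReal (B.le_opNorm₂ (g x) (f x))
      _ = _ := by ring
  exact ⟨⟨hm, hle.trans_lt (ENNReal.mul_lt_top (by simp) hg.2)⟩, hle⟩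

/-- Both sides are additive and `L¹`-continuous in `g` and agree on indicators, so approximation by
simple functions applies. The right side depends only on the class of `g` for the variation, since
`f` vanishes almost everywhere on a null set of the variation. -/
theorem integral_withDensityᵥ {lam : Measure X} {f : X → F}
    (hf : Integrable f lam) (B : E →L[ℝ] F →L[ℝ] G) {g : X → E}
    (hg : Integrable g (lam.withDensityᵥ f).variation) :
    (lam.withDensityᵥ f).integral g B = ∫ x, B (g x) (f x) ∂lam := by
  have hac : ∀ {g g' : X → E}, g =ᵐ[(lam.withDensityᵥ f).variation] g' →
      (fun x => B (g x) (f x)) =ᵐ[lam] fun x => B (g' x) (f x) := by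
    intro g g' h
    rw [Measure.variation_withDensityᵥ hf] at h
    have := (ae_withDensity_iff' hf.aestronglyMeasurable.enorm).1 h
    filter_upwards [this] with x hx
    by_cases h0 : f x = 0
    · simp [h0]
    · rw [hx (by simpa using h0)]
  refine Integrable.induction (P := fun g => (lam.withDensityᵥ f).integral g B
    = ∫ x, B (g x) (f x) ∂lam) ?_ ?_ ?_ ?_ hg
  · intro c s hs hfin
    have : IsFiniteMeasure ((lam.withDensityᵥ f).variation.restrict s) := ⟨by simpa using hfin⟩
    rw [VectorMeasure.integral_indicator_const c hs, withDensityᵥ_apply hf hs,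
      ← ContinuousLinearMap.integral_comp_comm _ hf.integrableOn, ← integral_indicator hs]
    congr 1 with x
    by_cases hx : x ∈ s <;> simp [hx]
  · intro g g' _ hg hg' h h'
    rw [VectorMeasure.integral_add hg hg', h, h', ← integral_add
      (integrable_bilin_of_integrable_variation hf B hg).1
      (integrable_bilin_of_integrable_variation hf B hg').1]
    simp
  · refine isClosed_eq (continuous_setToFun _) ?_
    refine LipschitzWith.continuous (K := ‖B‖₊) fun g g' => ?_
    have hsub := ((L1.integrable_coeFn g).sub (L1.integrable_coeFn g'))
    have key := (integrable_bilin_of_integrable_variation hf B hsub).2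
    rw [edist_eq_enorm_sub, ← integral_sub
      (integrable_bilin_of_integrable_variation hf B (L1.integrable_coeFn g)).1
      (integrable_bilin_of_integrable_variation hf B (L1.integrable_coeFn g')).1]
    refine (enorm_integral_le_lintegral_enorm _).trans ?_
    refine le_trans (le_of_eq ?_) (key.trans (le_of_eq ?_))
    · simp
    · rw [L1.edist_def]
      simp only [edist_eq_enorm_sub]
      rfl
  · intro g g' h _ hg
    rw [← VectorMeasure.integral_congr_ae h, hg, integral_congr_ae (hac h)]

theorem setIntegral_withDensityᵥ {lam : Measure X} {f : X → F}
    (hf : Integrable f lam) (B : E →L[ℝ] F →L[ℝ] G) {g : X → E} {s : Set X}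
    (hs : MeasurableSet s)
    (hg : IntegrableOn g s (lam.withDensityᵥ f).variation) :
    ((lam.withDensityᵥ f).restrict s).integral g B = ∫ x in s, B (g x) (f x) ∂lam := by
  have h : (lam.withDensityᵥ f).restrict s = (lam.restrict s).withDensityᵥ f := by
    ext t ht
    rw [VectorMeasure.restrict_apply _ hs ht, withDensityᵥ_apply hf (ht.inter hs),
      withDensityᵥ_apply hf.integrableOn ht, Measure.restrict_restrict ht]
  rw [h]
  refine integral_withDensityᵥ hf.integrableOn B ?_
  rw [← h, VectorMeasure.variation_restrict hs]
  exact hg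

end WithDensity

/-! ### Distributional gradients as a finite measure with a vector density -/

/-- A test function on `U`. -/
structure IsTest (U : Set Lifted) (ψ : Lifted → ℝ) : Prop where
  smooth : ContDiff ℝ ∞ ψ
  compact : HasCompactSupport ψ
  supp : tsupport ψ ⊆ U

/-- The Euclidean pairing of vectors in the lifted space. -/
noncomputable def pair (e F : Lifted) : ℝ := inner ℝ e.1 F.1 + e.2 * F.2

/-- The distributional gradient of `w` on `U` is represented by the finite measure `lam` with
density `F`. -/
structure HasGrad (U : Set Lifted) (w : Lifted → ℝ) (lam : Measure Lifted) (F : Lifted → Lifted) :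
    Prop where
  finite : IsFiniteMeasure lam
  integrable : Integrable F lam
  deriv : ∀ ψ, IsTest U ψ → ∀ e : Lifted,
    ∫ p in U, w p * fderiv ℝ ψ p e = -∫ p, ψ p * pair e (F p) ∂lam

theorem abs_pair_le (e F : Lifted) : |pair e F| ≤ 2 * ‖e‖ * ‖F‖ := by
  have h1 := abs_real_inner_le_norm e.1 F.1
  have h2 : |e.2 * F.2| ≤ ‖e‖ * ‖F‖ := by
    rw [abs_mul]
    exact mul_le_mul (norm_snd_le e) (norm_snd_le F) (abs_nonneg _) (norm_nonneg _)
  have h3 : ‖e.1‖ * ‖F.1‖ ≤ ‖e‖ * ‖F‖ :=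
    mul_le_mul (norm_fst_le e) (norm_fst_le F) (norm_nonneg _) (norm_nonneg _)
  unfold pair
  have := abs_add_le (inner ℝ e.1 F.1) (e.2 * F.2)
  linarith

theorem continuous_pair : Continuous fun q : Lifted × Lifted => pair q.1 q.2 := by
  unfold pair
  fun_prop

theorem pair_sub_left (a b F : Lifted) : pair (a - b) F = pair a F - pair b F := by
  simp [pair, inner_sub_left]; ring

theorem integrable_pair_const {lam : Measure Lifted} {F : Lifted → Lifted} (hF : Integrable F lam)
    (e : Lifted) : Integrable (fun p => pair e (F p)) lam :=
  (hF.fst.const_inner e.1).add (hF.snd.const_mul e.2)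

theorem HasGrad.isGradientMeasure {U : Set Lifted} (hU : IsOpen U) {w : Lifted → ℝ}
    {lam : Measure Lifted} {F : Lifted → Lifted}
    (h : HasGrad U w lam F) (hw : LocallyIntegrableOn w U) :
    IsGradientMeasure U w (lam.withDensityᵥ fun p => (F p).1) (lam.withDensityᵥ fun p => (F p).2)
    where
  locallyIntegrable := hw
  finite_x := by
    rw [Measure.variation_withDensityᵥ h.integrable.fst, withDensity_apply _ MeasurableSet.univ]
    simpa using! h.integrable.fst.2
  finite_s := by
    rw [Measure.variation_withDensityᵥ h.integrable.snd, withDensity_apply _ MeasurableSet.univ]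
    simpa using! h.integrable.snd.2
  deriv_x ψ h1 h2 h3 e := by
    have hfin : IsFiniteMeasure (lam.withDensityᵥ fun p => (F p).1).variation := ⟨by
      rw [Measure.variation_withDensityᵥ h.integrable.fst, withDensity_apply _ MeasurableSet.univ]
      simpa using! h.integrable.fst.2⟩
    have hψ : Integrable ψ (lam.withDensityᵥ fun p => (F p).1).variation :=
      h1.continuous.integrable_of_hasCompactSupport h2
    rw [h.deriv ψ ⟨h1, h2, h3⟩ (e, 0),
      setIntegral_withDensityᵥ h.integrable.fst _ hU.measurableSet hψ.integrableOn,
      setIntegral_eq_integral_of_forall_compl_eq_zero (fun p hp => by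
        simp [image_eq_zero_of_notMem_tsupport (fun hh => hp (h3 hh))])]
    rw [← innerSL_apply_apply, ← ContinuousLinearMap.integral_comp_comm]
    · simp [pair]
    · exact (integrable_bilin_of_integrable_variation h.integrable.fst _ hψ).1
  deriv_s ψ h1 h2 h3 := by
    have hfin : IsFiniteMeasure (lam.withDensityᵥ fun p => (F p).2).variation := ⟨by
      rw [Measure.variation_withDensityᵥ h.integrable.snd, withDensity_apply _ MeasurableSet.univ]
      simpa using! h.integrable.snd.2⟩
    have hψ : Integrable ψ (lam.withDensityᵥ fun p => (F p).2).variation :=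
      h1.continuous.integrable_of_hasCompactSupport h2
    rw [h.deriv ψ ⟨h1, h2, h3⟩ (0, 1),
      setIntegral_withDensityᵥ h.integrable.snd _ hU.measurableSet hψ.integrableOn,
      setIntegral_eq_integral_of_forall_compl_eq_zero (fun p hp => by
        simp [image_eq_zero_of_notMem_tsupport (fun hh => hp (h3 hh))])]
    simp [pair]

theorem SignedMeasure.exists_density {lam : Measure Lifted} [IsFiniteMeasure lam]
    (D : SignedMeasure Lifted) (hD : ∀ s, MeasurableSet s → lam s = 0 → D s = 0) :
    ∃ f : Lifted → ℝ, Integrable f lam ∧ D = lam.withDensityᵥ f :=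
  ⟨D.rnDeriv lam, SignedMeasure.integrable_rnDeriv _ _,
    (D.withDensityᵥ_rnDeriv_eq lam (VectorMeasure.AbsolutelyContinuous.mk fun s hs h0 =>
      hD s hs (by rwa [Measure.toENNRealVectorMeasure_apply_measurable hs] at h0))).symm⟩

theorem VectorMeasure.exists_density {lam : Measure Lifted} [IsFiniteMeasure lam]
    (D : VectorMeasure Lifted Plane) (hD : ∀ s, MeasurableSet s → lam s = 0 → D s = 0) :
    ∃ f : Lifted → Plane, Integrable f lam ∧ D = lam.withDensityᵥ f := by
  let c : Fin 2 → Plane →+ ℝ := fun i => ⟨⟨fun x => x i, rfl⟩, fun _ _ => rfl⟩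
  have hcc : ∀ i, Continuous (c i) := fun i => by
    change Continuous fun x : Plane => x i
    fun_prop
  have hca : ∀ i s, D.mapRange (c i) (hcc i) s = D s i := fun i s => rfl
  have hc : ∀ i : Fin 2, ∃ f : Lifted → ℝ, Integrable f lam ∧
      D.mapRange (c i) (hcc i) = lam.withDensityᵥ f :=
    fun i => SignedMeasure.exists_density _ fun s hs h0 => by rw [hca, hD s hs h0]; simp
  choose f hf hDf using hc
  have hint : Integrable (fun p => (WithLp.toLp 2 fun i => f i p : Plane)) lam := by
    have : (fun p => (WithLp.toLp 2 fun i => f i p : Plane))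
        = fun p => ∑ i, f i p • EuclideanSpace.single i (1 : ℝ) := by
      ext p i
      fin_cases i <;> simp
    rw [this]
    exact integrable_finsetSum _ fun i _ => (hf i).smul_const _
  refine ⟨_, hint, ?_⟩
  ext s hs i
  rw [withDensityᵥ_apply hint hs]
  have h1 := congrArg (fun ν : SignedMeasure Lifted => ν s) (hDf i)
  simp only [hca, withDensityᵥ_apply (hf i) hs] at h1
  have h2 := ContinuousLinearMap.integral_comp_comm
    (EuclideanSpace.proj (𝕜 := ℝ) i : Plane →L[ℝ] ℝ) hint.integrableOn (μ := lam.restrict s)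
  exact h1.trans h2

/-- Both components of the derivative are absolutely continuous with respect to the sum of their
variations, and Radon–Nikodym gives the density. From here on all integrals against derivatives are
ordinary integrals. -/
theorem IsGradientMeasure.exists_hasGrad {U : Set Lifted} (hU : IsOpen U) {w : Lifted → ℝ}
    {Dx : VectorMeasure Lifted Plane} {Ds : SignedMeasure Lifted}
    (h : IsGradientMeasure U w Dx Ds) :
    ∃ lam F, HasGrad U w lam F ∧ Dx = lam.withDensityᵥ (fun p => (F p).1) ∧
      Ds = lam.withDensityᵥ (fun p => (F p).2) := by
  have hfx := h.finite_x
  have hfs := h.finite_s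
  have : IsFiniteMeasure Dx.variation := ⟨hfx⟩
  have : IsFiniteMeasure Ds.variation := ⟨hfs⟩
  obtain ⟨f, hf, hDf⟩ := VectorMeasure.exists_density (lam := Dx.variation + Ds.variation) Dx
    fun s hs h0 => by
      have := Dx.enorm_measure_le_variation s
      simp only [Measure.coe_add, Pi.add_apply, add_eq_zero] at h0
      simpa [h0.1] using this
  obtain ⟨g, hg, hDg⟩ := SignedMeasure.exists_density (lam := Dx.variation + Ds.variation) Ds
    fun s hs h0 => by
      have := Ds.enorm_measure_le_variation s
      simp only [Measure.coe_add, Pi.add_apply, add_eq_zero] at h0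
      simpa [h0.2] using this
  generalize hlam : Dx.variation + Ds.variation = lam at *
  have : IsFiniteMeasure lam := by rw [← hlam]; infer_instance
  refine ⟨lam, fun p => (f p, g p), ⟨inferInstance, hf.prodMk hg, fun ψ hψ e => ?_⟩, hDf, hDg⟩
  have hψx : Integrable ψ Dx.variation := hψ.smooth.continuous.integrable_of_hasCompactSupport hψ.compact
  have hψs : Integrable ψ Ds.variation := hψ.smooth.continuous.integrable_of_hasCompactSupport hψ.compact
  have h1 := h.deriv_x ψ hψ.smooth hψ.compact hψ.supp e.1
  have h2 := h.deriv_s ψ hψ.smooth hψ.compact hψ.supp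
  rw [hDf] at h1 hψx
  rw [hDg] at h2 hψs
  have hUx : ∫ x in U, ContinuousLinearMap.lsmul ℝ ℝ (ψ x) (f x) ∂lam
      = ∫ x, ContinuousLinearMap.lsmul ℝ ℝ (ψ x) (f x) ∂lam :=
    setIntegral_eq_integral_of_forall_compl_eq_zero (fun p hp => by
      simp [image_eq_zero_of_notMem_tsupport (fun hh => hp (hψ.supp hh))])
  have hUs : ∫ x in U, ContinuousLinearMap.lsmul ℝ ℝ (ψ x) (g x) ∂lam
      = ∫ x, ContinuousLinearMap.lsmul ℝ ℝ (ψ x) (g x) ∂lam :=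
    setIntegral_eq_integral_of_forall_compl_eq_zero (fun p hp => by
      simp [image_eq_zero_of_notMem_tsupport (fun hh => hp (hψ.supp hh))])
  rw [setIntegral_withDensityᵥ hf _ hU.measurableSet hψx.integrableOn, hUx,
    ← innerSL_apply_apply ℝ, ← ContinuousLinearMap.integral_comp_comm _
      (integrable_bilin_of_integrable_variation hf _ hψx).1] at h1
  rw [setIntegral_withDensityᵥ hg _ hU.measurableSet hψs.integrableOn, hUs] at h2
  have hwi : ∀ e, IntegrableOn (fun p => w p * fderiv ℝ ψ p e) U := fun e => by
    have hK := h.locallyIntegrable.integrableOn_compact_subset hψ.supp hψ.compact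
    have hd : Continuous fun p => fderiv ℝ ψ p e :=
      (hψ.smooth.continuous_fderiv (by simp)).clm_apply continuous_const
    have h3 := hK.mul_continuousOn hd.continuousOn hψ.compact
    refine h3.of_forall_sdiff_eq_zero hU.measurableSet fun p hp => ?_
    have : fderiv ℝ ψ p = 0 := by
      by_contra h0
      exact hp.2 (support_fderiv_subset ℝ h0)
    simp [this]
  have h4 : ∀ p, w p * fderiv ℝ ψ p e
      = w p * fderiv ℝ ψ p (e.1, 0) + e.2 * (w p * fderiv ℝ ψ p (0, 1)) := fun p => by
    have : e = (e.1, (0 : ℝ)) + e.2 • ((0 : Plane), (1 : ℝ)) := by ext <;> simp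
    conv_lhs => rw [this, map_add, map_smul]
    simp only [smul_eq_mul]; ring
  simp_rw [h4]
  rw [integral_add (hwi _) ((hwi _).const_mul _), integral_const_mul, h1, h2]
  have h5 := (integrable_bilin_of_integrable_variation hf (ContinuousLinearMap.lsmul ℝ ℝ) hψx).1
  have h6 := (integrable_bilin_of_integrable_variation hg (ContinuousLinearMap.lsmul ℝ ℝ) hψs).1
  have h7 : ∀ p, ψ p * pair e (f p, g p)
      = innerSL ℝ e.1 (ContinuousLinearMap.lsmul ℝ ℝ (ψ p) (f p))
        + e.2 * ContinuousLinearMap.lsmul ℝ ℝ (ψ p) (g p) := fun p => by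
    simp [pair]; ring
  simp_rw [h7]
  rw [integral_add ((innerSL ℝ e.1).integrable_comp h5) (h6.const_mul _), integral_const_mul]
  ring

/-! ### Approximation by test functions -/

section Approximation

theorem exists_contDiff_cutoff {E : Type*} [NormedAddCommGroup E] [NormedSpace ℝ E]
    [FiniteDimensional ℝ E] {K W : Set E} (hK : IsCompact K) (hW : IsOpen W) (hKW : K ⊆ W) :
    ∃ χ : E → ℝ, ContDiff ℝ ∞ χ ∧ HasCompactSupport χ ∧ tsupport χ ⊆ W ∧
      (∀ x, χ x ∈ Icc (0 : ℝ) 1) ∧ ∀ x ∈ K, χ x = 1 := by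
  obtain ⟨L, hL, hKL, hLW⟩ := exists_compact_between hK hW hKW
  obtain ⟨f, hf0, hf1, hf⟩ := exists_contMDiffMap_zero_one_nhds_of_isClosed (n := ⊤)
    (modelWithCornersSelf ℝ E)
    (isOpen_interior (s := L)).isClosed_compl hK.isClosed
    (disjoint_compl_left_iff_subset.2 hKL)
  have hts : tsupport f ⊆ L := by
    refine closure_minimal (fun x hx => ?_) hL.isClosed
    by_contra hxL
    exact hx (hf0.self_of_nhdsSet x fun h => hxL (interior_subset h))
  exact ⟨f, f.contMDiff.contDiff, hL.of_isClosed_subset (isClosed_tsupport _) hts, hts.trans hLW,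
    hf, fun x hx => hf1.self_of_nhdsSet x hx⟩

/-- Points of `W` at distance more than `1 / (n + 1)` from the complement of `W`. -/
def innerPart {X : Type*} [PseudoEMetricSpace X] (W : Set X) (n : ℕ) : Set X :=
  {p | ((n : ℝ≥0∞) + 1)⁻¹ < Metric.infEDist p Wᶜ}

theorem isOpen_innerPart {X : Type*} [PseudoEMetricSpace X] (W : Set X) (n : ℕ) :
    IsOpen (innerPart W n) :=
  isOpen_lt continuous_const Metric.continuous_infEDist

theorem innerPart_subset {X : Type*} [PseudoEMetricSpace X] (W : Set X) (n : ℕ) :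
    innerPart W n ⊆ W := fun p hp => by
  by_contra h
  have : Metric.infEDist p Wᶜ = 0 := Metric.infEDist_zero_of_mem h
  simp [innerPart, this] at hp

theorem tendsto_inv_natCast_add_one : Tendsto (fun n : ℕ => ((n : ℝ≥0∞) + 1)⁻¹) atTop (𝓝 0) := by
  have := (tendsto_add_atTop_iff_nat 1).2 ENNReal.tendsto_inv_nat_nhds_zero
  simpa using this

theorem innerPart_mono {X : Type*} [PseudoEMetricSpace X] (W : Set X) {m n : ℕ} (h : m ≤ n) :
    innerPart W m ⊆ innerPart W n := fun p hp => by
  simp only [innerPart, mem_ofPred_eq] at hp ⊢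
  refine lt_of_le_of_lt ?_ hp
  gcongr

theorem eventually_subset_innerPart {X : Type*} [PseudoEMetricSpace X] {W K : Set X}
    (hW : IsOpen W) (hK : IsCompact K) (hKW : K ⊆ W) : ∀ᶠ n in atTop, K ⊆ innerPart W n := by
  obtain ⟨n, hn⟩ := hK.elim_directed_cover (innerPart W) (isOpen_innerPart W) (fun p hp => by
    have h0 : 0 < Metric.infEDist p Wᶜ := by
      rw [Metric.infEDist_pos_iff_notMem_closure, hW.isClosed_compl.closure_eq]
      exact fun h => h (hKW hp)
    obtain ⟨n, hn⟩ := (tendsto_inv_natCast_add_one.eventually (gt_mem_nhds h0)).exists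
    exact mem_iUnion.2 ⟨n, hn⟩) (directed_of_isDirected_le fun m n h => innerPart_mono W h)
  exact eventually_atTop.2 ⟨n, fun m hm => hn.trans (innerPart_mono W hm)⟩

/-- Identities for test functions on the open set pass, by dominated convergence, to continuous
fields on the closed cylinder, including what the gradient carries on the lateral boundary. The sign
is kept for the vertical components. -/
theorem exists_test_tendsto_indicator {U K : Set Lifted} (hU : IsOpen U) (hK : IsCompact K)
    (hKU : K ⊆ U) {φ : Lifted → ℝ} (hφ : ContinuousOn φ K) :
    ∃ ψ : ℕ → Lifted → ℝ, (∀ n, IsTest U (ψ n)) ∧ (∃ C, ∀ n p, |ψ n p| ≤ C) ∧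
      (∀ p, Tendsto (fun n => ψ n p) atTop (𝓝 (K.indicator φ p))) ∧
      ((∀ p ∈ K, 0 ≤ φ p) → ∀ n p, 0 ≤ ψ n p) := by
  obtain ⟨C, hC⟩ := hK.exists_bound_of_continuousOn hφ
  have hC0 : 0 ≤ |C| := abs_nonneg C
  -- Tietze extension into `[a, |C|]`, with `a = 0` for nonnegative `φ`, so that the extension keeps
  -- the sign.
  obtain ⟨a, ha0, haC, haφ, haφ'⟩ : ∃ a : ℝ, a ≤ 0 ∧ -|C| ≤ a ∧ (∀ p ∈ K, a ≤ φ p) ∧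
      ((∀ p ∈ K, 0 ≤ φ p) → a = 0) := by
    by_cases h : ∀ p ∈ K, 0 ≤ φ p
    · exact ⟨0, le_rfl, by simp, h, fun _ => rfl⟩
    · exact ⟨-|C|, by simp, le_rfl, fun p hp => by
        have := (abs_le.1 (hC p hp)).1; have := le_abs_self C; linarith, fun h' => (h h').elim⟩
  obtain ⟨g, hg, hgφ⟩ := ContinuousMap.exists_restrict_eq_forall_mem_of_closed
    (⟨K.domRestrict φ, hφ.domRestrict⟩ : C(K, ℝ)) (t := Icc a |C|)
    (fun p => ⟨haφ p p.2, (le_abs_self _).trans ((hC p p.2).trans (le_abs_self C))⟩)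
    ⟨0, ha0, hC0⟩ hK.isClosed
  have hgφ' : ∀ p ∈ K, g p = φ p := fun p hp =>
    congrArg (fun f : C(K, ℝ) => f ⟨p, hp⟩) hgφ
  have hδ : ∀ n : ℕ, (0 : ℝ) < 1 / (n + 1) := fun n => Nat.one_div_pos_of_nat
  choose f hfs hfd _ using fun n : ℕ => g.continuous.exists_contDiff_approx (ε := fun _ => 1 / (n + 1 : ℝ)) ⊤
    continuous_const fun _ => hδ n
  choose χ hχs hχc hχW hχ hχK using fun n : ℕ => exists_contDiff_cutoff hK
    (hU.inter (Metric.isOpen_thickening (E := K) (δ := 1 / (n + 1 : ℝ))))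
    (subset_inter hKU (Metric.self_subset_thickening (hδ n) K))
  have hδ1 : ∀ n : ℕ, (1 : ℝ) / (n + 1) ≤ 1 := fun n => by
    rw [div_le_one (by positivity)]; linarith [(Nat.cast_nonneg n : (0 : ℝ) ≤ n)]
  -- The summand `1 / (n + 1)` makes up for the smoothing error, which could spoil nonnegativity.
  refine ⟨fun n p => χ n p * (f n p + 1 / (n + 1)), fun n => ⟨(hχs n).mul ((hfs n).add contDiff_const),
    (hχc n).mul_right, (closure_mono (Function.support_mul_subset_left _ _)).trans
      ((hχW n).trans inter_subset_left)⟩, ⟨|C| + 2, fun n p => ?_⟩, fun p => ?_, fun h n p => ?_⟩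
  · have h1 := hfd n p
    rw [Real.dist_eq] at h1
    have h2 : |g p| ≤ |C| := abs_le.2 ⟨haC.trans (hg p).1, (hg p).2⟩
    have h3 : |f n p + 1 / (n + 1)| ≤ |C| + 2 := by
      have e : f n p + 1 / (n + 1 : ℝ) = (f n p - g p) + g p + 1 / (n + 1) := by ring
      rw [e]
      refine (abs_add_three _ _ _).trans ?_
      rw [abs_of_pos (hδ n)]
      linarith [hδ1 n]
    rw [abs_mul, abs_of_nonneg (hχ n p).1]
    calc χ n p * |f n p + 1 / (n + 1)| ≤ 1 * |f n p + 1 / (n + 1)| :=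
          mul_le_mul_of_nonneg_right (hχ n p).2 (abs_nonneg _)
      _ ≤ _ := by linarith
  · by_cases hp : p ∈ K
    · simp only [indicator_of_mem hp, hχK _ p hp, one_mul]
      rw [← hgφ' p hp]
      have h0 := tendsto_one_div_add_atTop_nhds_zero_nat (𝕜 := ℝ)
      have h1 : Tendsto (fun n => f n p) atTop (𝓝 (g p)) :=
        tendsto_iff_dist_tendsto_zero.2 (squeeze_zero (fun _ => dist_nonneg)
          (fun n => (hfd n p).le) h0)
      simpa using h1.add h0
    · rw [indicator_of_notMem hp]
      refine tendsto_const_nhds.congr' ?_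
      rcases K.eq_empty_or_nonempty with hKe | hKn
      · refine Eventually.of_forall fun n => ?_
        have : p ∉ tsupport (χ n) := fun h => by
          have := (hχW n h).2
          simp [hKe] at this
        simp [image_eq_zero_of_notMem_tsupport this]
      have hpos : 0 < Metric.infDist p K := (hK.isClosed.notMem_iff_infDist_pos hKn).1 hp
      filter_upwards [(tendsto_one_div_add_atTop_nhds_zero_nat (𝕜 := ℝ)).eventually
        (gt_mem_nhds hpos)] with n hn
      have : p ∉ tsupport (χ n) := fun h => by
        have := (Metric.mem_thickening_iff_infDist_lt hKn).1 (hχW n h).2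
        linarith
      simp [image_eq_zero_of_notMem_tsupport this]
  · have h1 := hfd n p
    rw [Real.dist_eq, abs_lt] at h1
    have := (hg p).1
    rw [haφ' h] at this
    exact mul_nonneg (hχ n p).1 (by linarith [h1.1])

/-- Density of continuous functions in `L¹` gives convergence in measure, and a subsequence
converges almost everywhere. The retraction `y ↦ y / max 1 ‖y‖` then enforces the bound without
changing the limit. -/
theorem exists_continuous_tendsto_ae {E : Type*} [NormedAddCommGroup E] [NormedSpace ℝ E]
    (σ : Measure Lifted) [IsFiniteMeasure σ] {s : Lifted → E}
    (hs : AEStronglyMeasurable s σ) (hs1 : ∀ p, ‖s p‖ ≤ 1) :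
    ∃ c : ℕ → Lifted → E, (∀ n, Continuous (c n)) ∧ (∀ n p, ‖c n p‖ ≤ 1) ∧
      ∀ᵐ p ∂σ, Tendsto (fun n => c n p) atTop (𝓝 (s p)) := by
  have hLp : MemLp s 1 σ := memLp_one_iff_integrable.2
    (Integrable.of_bound hs 1 (Eventually.of_forall hs1))
  choose g _ hg hgc hgL using fun n : ℕ =>
    hLp.exists_hasCompactSupport_eLpNorm_sub_le (by simp) (ε := ((n : ℝ≥0∞) + 1)⁻¹) (by simp)
  have hm : TendstoInMeasure σ g atTop s :=
    tendstoInMeasure_of_tendsto_eLpNorm one_ne_zero (fun n => (hgc n).aestronglyMeasurable) hs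
      (tendsto_of_tendsto_of_tendsto_of_le_of_le tendsto_const_nhds tendsto_inv_natCast_add_one
        (fun _ => zero_le) (fun n => by rw [eLpNorm_sub_comm]; exact hg n))
  obtain ⟨ns, -, hns⟩ := hm.exists_seq_tendsto_ae
  have hrc : Continuous fun y : E => (max 1 ‖y‖)⁻¹ • y :=
    ((continuous_const.max continuous_norm).inv₀ fun y => by positivity).smul continuous_id
  refine ⟨fun n p => (max 1 ‖g (ns n) p‖)⁻¹ • g (ns n) p, fun n => hrc.comp (hgc _), fun n p => ?_, ?_⟩
  · rw [norm_smul, norm_inv, Real.norm_of_nonneg (by positivity)]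
    exact inv_mul_le_one_of_le₀ (le_max_right _ _) (by positivity)
  · filter_upwards [hns] with p hp
    have := (hrc.tendsto (s p)).comp hp
    simpa [Function.comp_def, max_eq_left (hs1 p)] using this

/-- Meant for `s` the sign of a density: it turns bounds on integrals against test functions into
bounds on the total variation. -/
theorem exists_test_tendsto_ae (σ : Measure Lifted) [IsFiniteMeasure σ] {W : Set Lifted}
    (hW : IsOpen W) {s : Lifted → ℝ} (hs : AEStronglyMeasurable s σ) (hs1 : ∀ p, |s p| ≤ 1) :
    ∃ ψ : ℕ → Lifted → ℝ, (∀ n, IsTest W (ψ n)) ∧ (∀ n p, |ψ n p| ≤ 1) ∧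
      ∀ᵐ p ∂σ, p ∈ W → Tendsto (fun n => ψ n p) atTop (𝓝 (s p)) := by
  obtain ⟨c, hc, hc1, hcs⟩ := exists_continuous_tendsto_ae σ hs hs1
  have hδ : ∀ n : ℕ, (0 : ℝ) < 1 / (n + 1) := fun n => Nat.one_div_pos_of_nat
  choose f hfs hfd _ using fun n : ℕ => (hc n).exists_contDiff_approx (ε := fun _ => 1 / (n + 1 : ℝ)) ⊤
    continuous_const fun _ => hδ n
  have hK : ∀ n : ℕ, IsCompact (Metric.closedBall (0 : Lifted) n ∩
      {p | ((n : ℝ≥0∞) + 1)⁻¹ ≤ Metric.infEDist p Wᶜ}) := fun n =>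
    (isCompact_closedBall _ _).inter_right (isClosed_le continuous_const Metric.continuous_infEDist)
  have hKW : ∀ n : ℕ, Metric.closedBall (0 : Lifted) n ∩
      {p | ((n : ℝ≥0∞) + 1)⁻¹ ≤ Metric.infEDist p Wᶜ} ⊆ W := fun n p hp => by
    by_contra h
    have h0 : Metric.infEDist p Wᶜ = 0 := Metric.infEDist_zero_of_mem h
    have := hp.2
    simp [h0] at this
  choose χ hχs hχc hχW hχ hχK using fun n : ℕ => exists_contDiff_cutoff (hK n) hW (hKW n)
  -- The factor restores the bound `1`, which smoothing exceeds by at most `1 / (n + 1)`.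
  refine ⟨fun n p => χ n p * ((1 + 1 / (n + 1 : ℝ))⁻¹ * f n p), fun n =>
    ⟨(hχs n).mul (contDiff_const.mul (hfs n)), (hχc n).mul_right,
      (closure_mono (Function.support_mul_subset_left _ _)).trans (hχW n)⟩, fun n p => ?_, ?_⟩
  · have h1 := hfd n p
    have h2 := hc1 n p
    rw [Real.dist_eq] at h1
    rw [Real.norm_eq_abs] at h2
    have h3 : |f n p| ≤ 1 + 1 / (n + 1) := by
      have : f n p = (f n p - c n p) + c n p := by ring
      rw [this]
      exact (abs_add_le _ _).trans (by linarith)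
    have h4 : |(1 + 1 / (n + 1 : ℝ))⁻¹ * f n p| ≤ 1 := by
      rw [abs_mul, abs_of_pos (by have := hδ n; positivity)]
      exact inv_mul_le_one_of_le₀ h3 (by have := hδ n; positivity)
    rw [abs_mul, abs_of_nonneg (hχ n p).1]
    exact mul_le_one₀ (hχ n p).2 (abs_nonneg _) h4
  · filter_upwards [hcs] with p hp hpW
    have h0 := tendsto_one_div_add_atTop_nhds_zero_nat (𝕜 := ℝ)
    have h1 : Tendsto (fun n => f n p) atTop (𝓝 (s p)) := by
      have h2 : Tendsto (fun n => f n p - c n p) atTop (𝓝 0) :=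
        squeeze_zero_norm (fun n => by
          have := (hfd n p).le
          rwa [Real.dist_eq] at this) h0
      simpa using h2.add hp
    have h3 : Tendsto (fun n : ℕ => (1 + 1 / (n + 1 : ℝ))⁻¹ * f n p) atTop (𝓝 (s p)) := by
      have := ((h0.const_add 1).inv₀ (by simp)).mul h1
      simpa using this
    refine h3.congr' ?_
    have hpos : 0 < Metric.infEDist p Wᶜ := by
      rw [Metric.infEDist_pos_iff_notMem_closure, hW.isClosed_compl.closure_eq]
      exact fun h => h hpW
    filter_upwards [tendsto_inv_natCast_add_one.eventually (gt_mem_nhds hpos),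
      eventually_ge_atTop ⌈‖p‖⌉₊] with n hn1 hn2
    rw [hχK n p ⟨by simpa using Nat.ceil_le.1 hn2, hn1.le⟩, one_mul]

end Approximation

/-! ### Fluxes, and the cost as a supremum of fluxes -/

/-- The coordinate directions of the plane, as vectors of the lifted space. -/
noncomputable def ex (i : Fin 2) : Lifted := (EuclideanSpace.single i 1, 0)

/-- The vertical direction. -/
noncomputable def es : Lifted := (0, 1)

theorem pair_eq_sum (e F : Lifted) :
    pair e F = e.1 0 * pair (ex 0) F + e.1 1 * pair (ex 1) F + e.2 * pair es F := by
  simp [pair, ex, es, PiLp.inner_apply, Fin.sum_univ_two]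
  ring

/-- The integral over `K` of the field `(φx, φs)` against the gradient with density `F`. -/
noncomputable def flux (K : Set Lifted) (lam : Measure Lifted) (F : Lifted → Lifted)
    (φx : Lifted → Plane) (φs : Lifted → ℝ) : ℝ :=
  ∫ p in K, pair (φx p, φs p) (F p) ∂lam

theorem IsTest.fderiv_eq_zero {U : Set Lifted} {ψ : Lifted → ℝ} (hψ : IsTest U ψ) {p : Lifted}
    (hp : p ∉ U) : fderiv ℝ ψ p = 0 := by
  by_contra h
  exact hp (hψ.supp (support_fderiv_subset ℝ h))

theorem IsTest.eq_zero {U : Set Lifted} {ψ : Lifted → ℝ} (hψ : IsTest U ψ) {p : Lifted}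
    (hp : p ∉ U) : ψ p = 0 :=
  image_eq_zero_of_notMem_tsupport fun h => hp (hψ.supp h)

theorem IsTest.mono {U W : Set Lifted} {ψ : Lifted → ℝ} (hψ : IsTest W ψ) (h : W ⊆ U) :
    IsTest U ψ := ⟨hψ.smooth, hψ.compact, hψ.supp.trans h⟩

theorem IsTest.exists_bound {U : Set Lifted} {ψ : Lifted → ℝ} (hψ : IsTest U ψ) :
    ∃ C, ∀ p, |ψ p| ≤ C := hψ.compact.exists_bound_of_continuous hψ.smooth.continuous

theorem tendsto_integral_mul_pair {lam : Measure Lifted} {F : Lifted → Lifted}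
    (hF : Integrable F lam) (e : Lifted) {K : Set Lifted} (hK : MeasurableSet K)
    {φ : Lifted → ℝ} {ψ : ℕ → Lifted → ℝ} (hψm : ∀ n, Continuous (ψ n)) {C : ℝ}
    (hC : ∀ n p, |ψ n p| ≤ C)
    (hψ : ∀ p, Tendsto (fun n => ψ n p) atTop (𝓝 (K.indicator φ p))) :
    Tendsto (fun n => ∫ p, ψ n p * pair e (F p) ∂lam) atTop
      (𝓝 (∫ p in K, φ p * pair e (F p) ∂lam)) := by
  rw [← integral_indicator hK]
  have hP := integrable_pair_const hF e
  refine tendsto_integral_of_dominated_convergence (fun p => C * |pair e (F p)|)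
    (fun n => (hψm n).aestronglyMeasurable.mul hP.aestronglyMeasurable)
    (hP.abs.const_mul C) (fun n => Eventually.of_forall fun p => ?_)
    (Eventually.of_forall fun p => ?_)
  · rw [norm_mul]
    exact mul_le_mul_of_nonneg_right (hC n p) (abs_nonneg _)
  · have := (hψ p).mul_const (pair e (F p))
    by_cases hp : p ∈ K <;> simpa [hp] using this

theorem HasGrad.integral_test_eq {U : Set Lifted} {w : Lifted → ℝ} {lam lam' : Measure Lifted}
    {F F' : Lifted → Lifted} (h : HasGrad U w lam F) (h' : HasGrad U w lam' F')
    {ψ : Lifted → ℝ} (hψ : IsTest U ψ) (e : Lifted) :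
    ∫ p, ψ p * pair e (F p) ∂lam = ∫ p, ψ p * pair e (F' p) ∂lam' := by
  have := (h.deriv ψ hψ e).symm.trans (h'.deriv ψ hψ e)
  linarith

/-- Uniqueness of the gradient: two representations agree on test functions, hence on the limits of
these that represent a continuous function on a compact subset. -/
theorem HasGrad.setIntegral_eq {U : Set Lifted} (hU : IsOpen U) {w : Lifted → ℝ}
    {lam lam' : Measure Lifted}
    {F F' : Lifted → Lifted} (h : HasGrad U w lam F) (h' : HasGrad U w lam' F') {K : Set Lifted}
    (hK : IsCompact K) (hKU : K ⊆ U) {φ : Lifted → ℝ} (hφ : ContinuousOn φ K) (e : Lifted) :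
    ∫ p in K, φ p * pair e (F p) ∂lam = ∫ p in K, φ p * pair e (F' p) ∂lam' := by
  obtain ⟨ψ, hψ, ⟨C, hC⟩, hlim, -⟩ := exists_test_tendsto_indicator hU hK hKU hφ
  refine tendsto_nhds_unique (tendsto_integral_mul_pair h.integrable e hK.measurableSet
    (fun n => (hψ n).smooth.continuous) hC hlim) ?_
  refine (tendsto_integral_mul_pair h'.integrable e hK.measurableSet
    (fun n => (hψ n).smooth.continuous) hC hlim).congr fun n => ?_
  exact h'.integral_test_eq h (hψ n) e

theorem integrableOn_mul_pair {lam : Measure Lifted} {F : Lifted → Lifted}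
    (hF : Integrable F lam) (e : Lifted) {K : Set Lifted} (hK : IsCompact K) {φ : Lifted → ℝ}
    (hφ : ContinuousOn φ K) : IntegrableOn (fun p => φ p * pair e (F p)) K lam :=
  (integrable_pair_const hF e).integrableOn.continuousOn_mul hφ hK

theorem flux_eq_sum {lam : Measure Lifted} {F : Lifted → Lifted}
    (hF : Integrable F lam) {K : Set Lifted} (hK : IsCompact K) {φx : Lifted → Plane}
    {φs : Lifted → ℝ} (hx : ContinuousOn φx K) (hs : ContinuousOn φs K) :
    flux K lam F φx φs = ∫ p in K, φx p 0 * pair (ex 0) (F p) ∂lam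
      + ∫ p in K, φx p 1 * pair (ex 1) (F p) ∂lam + ∫ p in K, φs p * pair es (F p) ∂lam := by
  have hxi : ∀ i : Fin 2, ContinuousOn (fun p => φx p i) K := fun i =>
    (EuclideanSpace.proj (𝕜 := ℝ) i : Plane →L[ℝ] ℝ).continuous.comp_continuousOn hx
  unfold flux
  have i0 := integrableOn_mul_pair hF (ex 0) hK (hxi 0)
  have i1 := integrableOn_mul_pair hF (ex 1) hK (hxi 1)
  have i01 : IntegrableOn (fun p => φx p 0 * pair (ex 0) (F p) + φx p 1 * pair (ex 1) (F p)) K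
      lam := i0.add i1
  rw [← integral_add i0 i1, ← integral_add i01 (integrableOn_mul_pair hF es hK hs)]
  refine integral_congr_ae (Eventually.of_forall fun p => ?_)
  exact pair_eq_sum _ _

theorem HasGrad.flux_eq {U : Set Lifted} (hU : IsOpen U) {w : Lifted → ℝ}
    {lam lam' : Measure Lifted}
    {F F' : Lifted → Lifted} (h : HasGrad U w lam F) (h' : HasGrad U w lam' F') {K : Set Lifted}
    (hK : IsCompact K) (hKU : K ⊆ U) {φx : Lifted → Plane}
    {φs : Lifted → ℝ} (hx : ContinuousOn φx K) (hs : ContinuousOn φs K) :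
    flux K lam F φx φs = flux K lam' F' φx φs := by
  have hxi : ∀ i : Fin 2, ContinuousOn (fun p => φx p i) K := fun i =>
    (EuclideanSpace.proj (𝕜 := ℝ) i : Plane →L[ℝ] ℝ).continuous.comp_continuousOn hx
  rw [flux_eq_sum h.integrable hK hx hs, flux_eq_sum h'.integrable hK hx hs,
    h.setIntegral_eq hU h' hK hKU (hxi 0), h.setIntegral_eq hU h' hK hKU (hxi 1),
    h.setIntegral_eq hU h' hK hKU hs]

theorem isOpen_liftedDomain (Ω : Set Plane) : IsOpen (liftedDomain Ω) :=
  Metric.isOpen_thickening.prod isOpen_univ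

theorem cylinder_subset_liftedDomain (Ω : Set Plane) (M : ℝ) : cylinder Ω M ⊆ liftedDomain Ω :=
  prod_mono (Metric.closure_subset_thickening one_pos Ω) (subset_univ _)

theorem isCompact_cylinder {Ω : Set Plane} (hΩb : Bornology.IsBounded Ω) (M : ℝ) :
    IsCompact (cylinder Ω M) := hΩb.isCompact_closure.prod isCompact_Icc

/-- All derivatives over which the infimum in the cost runs give the same fluxes, because the
cylinder is a compact subset of the open domain. Hence any one representation of the gradient
computes the cost. -/
theorem convexCost_eq {Ω : Set Plane} (hΩb : Bornology.IsBounded Ω) {M : ℝ} {τ : ℝ → ℝ}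
    {w : Lifted → ℝ} {lam : Measure Lifted} {F : Lifted → Lifted}
    (h : HasGrad (liftedDomain Ω) w lam F) (hw : LocallyIntegrableOn w (liftedDomain Ω)) :
    convexCost Ω M τ w = ⨆ (φx : Lifted → Plane) (φs : Lifted → ℝ) (_ : MemK Ω M τ φx φs),
      ENNReal.ofReal (flux (cylinder Ω M) lam F φx φs) := by
  have hU := isOpen_liftedDomain Ω
  have hK := isCompact_cylinder hΩb M
  have hKU := cylinder_subset_liftedDomain Ω M
  have key : ∀ Dx Ds, IsGradientMeasure (liftedDomain Ω) w Dx Ds → ∀ φx φs, MemK Ω M τ φx φs →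
      (Dx.restrict (cylinder Ω M)).integral φx (innerSL ℝ)
        + (Ds.restrict (cylinder Ω M)).integral φs (ContinuousLinearMap.lsmul ℝ ℝ)
        = flux (cylinder Ω M) lam F φx φs := by
    intro Dx Ds hD φx φs hφ
    obtain ⟨lam', F', h', rfl, rfl⟩ := hD.exists_hasGrad hU
    have hfin := h'.finite
    have hf1 : IsFiniteMeasure (lam'.withDensityᵥ fun p => (F' p).1).variation := ⟨hD.finite_x⟩
    have hf2 : IsFiniteMeasure (lam'.withDensityᵥ fun p => (F' p).2).variation := ⟨hD.finite_s⟩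
    have i1 := hφ.continuous_x.integrableOn_compact (μ := (lam'.withDensityᵥ fun p => (F' p).1).variation) hK
    have i2 := hφ.continuous_s.integrableOn_compact (μ := (lam'.withDensityᵥ fun p => (F' p).2).variation) hK
    rw [h.flux_eq hU h' hK hKU hφ.continuous_x hφ.continuous_s,
      setIntegral_withDensityᵥ h'.integrable.fst _ hK.measurableSet i1,
      setIntegral_withDensityᵥ h'.integrable.snd _ hK.measurableSet i2, flux, ← integral_add]
    · rfl
    · refine (integrable_bilin_of_integrable_variation h'.integrable.fst.integrableOn _ ?_).1
      rwa [Measure.variation_withDensityᵥ h'.integrable.fst.integrableOn,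
        ← restrict_withDensity hK.measurableSet, ← Measure.variation_withDensityᵥ h'.integrable.fst]
    · refine (integrable_bilin_of_integrable_variation h'.integrable.snd.integrableOn _ ?_).1
      rwa [Measure.variation_withDensityᵥ h'.integrable.snd.integrableOn,
        ← restrict_withDensity hK.measurableSet, ← Measure.variation_withDensityᵥ h'.integrable.snd]
  unfold convexCost
  refine le_antisymm ?_ ?_
  · refine (iInf_le_of_le _ (iInf_le_of_le _ (iInf_le_of_le (h.isGradientMeasure hU hw) ?_)))
    refine iSup_mono fun φx => iSup_mono fun φs => iSup_mono fun hφ => ?_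
    rw [key _ _ (h.isGradientMeasure hU hw) φx φs hφ]
  · refine le_iInf fun Dx => le_iInf fun Ds => le_iInf fun hD => ?_
    refine iSup_mono fun φx => iSup_mono fun φs => iSup_mono fun hφ => ?_
    rw [key Dx Ds hD φx φs hφ]

/-! ### Changes on null sets -/

theorem IsGradientMeasure.congr {U : Set Lifted} {w w' : Lifted → ℝ}
    {Dx : VectorMeasure Lifted Plane} {Ds : SignedMeasure Lifted}
    (h : IsGradientMeasure U w Dx Ds) (hw : w =ᵐ[volume.restrict U] w') :
    IsGradientMeasure U w' Dx Ds where
  locallyIntegrable := h.locallyIntegrable.congr hw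
  finite_x := h.finite_x
  finite_s := h.finite_s
  deriv_x ψ h1 h2 h3 e := by
    rw [← h.deriv_x ψ h1 h2 h3 e]
    refine integral_congr_ae ?_
    filter_upwards [hw] with p hp
    rw [hp]
  deriv_s ψ h1 h2 h3 := by
    rw [← h.deriv_s ψ h1 h2 h3]
    refine integral_congr_ae ?_
    filter_upwards [hw] with p hp
    rw [hp]

theorem convexCost_congr {Ω : Set Plane} {M : ℝ} {τ : ℝ → ℝ} {w w' : Lifted → ℝ}
    (hw : w =ᵐ[volume.restrict (liftedDomain Ω)] w') :
    convexCost Ω M τ w = convexCost Ω M τ w' := by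
  have : ∀ Dx Ds, IsGradientMeasure (liftedDomain Ω) w Dx Ds ↔
      IsGradientMeasure (liftedDomain Ω) w' Dx Ds := fun Dx Ds =>
    ⟨fun h => h.congr hw, fun h => h.congr hw.symm⟩
  simp only [convexCost, this]

theorem MemC.congr {Ω : Set Plane} {γ : ℝ → Plane} {L : ℝ} {μp μm : Measure Plane}
    {w w' : Lifted → ℝ} (h : MemC Ω γ L μp μm w)
    (hw : w =ᵐ[volume.restrict (liftedDomain Ω)] w') : MemC Ω γ L μp μm w' where
  range := by
    filter_upwards [h.range, hw] with p h1 h2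
    rwa [← h2]
  boundedVariation := by
    obtain ⟨Dx, Ds, h1⟩ := h.boundedVariation
    exact ⟨Dx, Ds, h1.congr hw⟩
  boundary := by
    filter_upwards [h.boundary, ae_restrict_of_ae_restrict_of_subset sdiff_subset hw] with p h1 h2
    rw [← h2, h1]

/-! ### Difference quotients, total variation and weak compactness -/

instance : (volume : Measure Lifted).IsAddHaarMeasure :=
  inferInstanceAs ((volume : Measure Plane).prod (volume : Measure ℝ)).IsAddHaarMeasure

theorem HasCompactSupport.comp_sub_const {ψ : Lifted → ℝ} (h : HasCompactSupport ψ) (a : Lifted) :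
    HasCompactSupport fun p => ψ (p - a) := by
  have := h.comp_homeomorph (Homeomorph.subRight a)
  exact this

theorem IsTest.translate {W O : Set Lifted} {ψ : Lifted → ℝ} (h : IsTest W ψ) {a : Lifted}
    (ha : ∀ p ∈ W, p + a ∈ O) : IsTest O fun p => ψ (p - a) where
  smooth := h.smooth.comp (contDiff_id.sub contDiff_const)
  compact := HasCompactSupport.comp_sub_const h.compact a
  supp p hp := by
    have h1 : tsupport (fun p => ψ (p - a)) ⊆ (fun p => p - a) ⁻¹' tsupport ψ :=
      tsupport_comp_subset_preimage ψ (f := fun p => p - a) (by fun_prop)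
    simpa using ha _ (h.supp (h1 hp))

theorem fderiv_comp_sub_const (ψ : Lifted → ℝ) (a p : Lifted) :
    fderiv ℝ (fun p => ψ (p - a)) p = fderiv ℝ ψ (p - a) := by
  exact fderiv_comp_sub a

/-- As a function of `s` this is the convolution of `w` with the reflected `ψ`, evaluated along the
line `s • e`, and the derivative falls on the smooth factor. -/
theorem hasDerivAt_integral_mul_translate {w ψ : Lifted → ℝ} (hw : LocallyIntegrable w)
    (hψ : ContDiff ℝ ∞ ψ) (hψc : HasCompactSupport ψ) (e : Lifted) (s : ℝ) :
    HasDerivAt (fun s : ℝ => ∫ p, w p * ψ (p - s • e))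
      (-∫ p, w p * fderiv ℝ ψ (p - s • e) e) s := by
  set g : Lifted → ℝ := fun y => ψ (-y) with hg
  have hgc : HasCompactSupport g := hψc.comp_homeomorph (Homeomorph.neg Lifted)
  have hgs : ContDiff ℝ 1 g := (hψ.of_le (by exact_mod_cast le_top)).comp contDiff_neg
  have h1 := hgc.hasFDerivAt_convolution_right (ContinuousLinearMap.mul ℝ ℝ) (μ := volume) hw hgs
    (s • e)
  have h2 : HasDerivAt (fun s : ℝ => s • e) e s := by
    simpa using (hasDerivAt_id s).smul_const e
  have h3 := h1.comp_hasDerivAt s h2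
  rw [convolution_precompR_apply _ hw (hgc.fderiv (𝕜 := ℝ))
    (hgs.continuous_fderiv one_ne_zero)] at h3
  convert! h3 using 1
  · ext s
    simp [convolution, hg]
  · rw [convolution, ← integral_neg]
    refine integral_congr_ae (Eventually.of_forall fun p => ?_)
    have : fderiv ℝ g (s • e - p) e = - fderiv ℝ ψ (p - s • e) e := by
      have h5 : HasFDerivAt g ((fderiv ℝ ψ (-(s • e - p))).comp (-ContinuousLinearMap.id ℝ Lifted))
          (s • e - p) :=
        ((hψ.differentiable (by simp)) _).hasFDerivAt.comp (s • e - p)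
          (hasFDerivAt_id (s • e - p)).neg
      rw [h5.fderiv]
      simp
    simp [this]

theorem integrable_mul_of_bound {w ψ : Lifted → ℝ} (hw : Measurable w) (hw1 : ∀ p, |w p| ≤ 1)
    (hψ : Continuous ψ) (hψc : HasCompactSupport ψ) : Integrable fun p => w p * ψ p :=
  (hψ.integrable_of_hasCompactSupport hψc).bdd_mul hw.aestronglyMeasurable
    (Eventually.of_forall hw1)

theorem locallyIntegrable_of_bound {w : Lifted → ℝ} (hw : Measurable w) (hw1 : ∀ p, |w p| ≤ 1) :
    LocallyIntegrable w :=
  (locallyIntegrable_const (1 : ℝ)).mono hw.aestronglyMeasurable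
    (Eventually.of_forall fun p => by simpa using hw1 p)

theorem integral_mul_translate_sub {w ψ : Lifted → ℝ} (hw : Measurable w)
    (hw1 : ∀ p, |w p| ≤ 1) (hψ : Continuous ψ) (hψc : HasCompactSupport ψ) (a : Lifted) :
    (∫ p, w p * ψ (p - a)) - ∫ p, w p * ψ p = ∫ p, ψ p * (w (p + a) - w p) := by
  have h1 : ∫ p, w p * ψ (p - a) = ∫ p, w (p + a) * ψ p := by
    rw [← integral_add_right_eq_self _ a]
    simp
  rw [h1, ← integral_sub]
  · exact integral_congr_ae (Eventually.of_forall fun p => by ring)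
  · exact integrable_mul_of_bound (hw.comp (measurable_add_const a)) (fun p => hw1 _) hψ hψc
  · exact integrable_mul_of_bound hw hw1 hψ hψc

theorem HasGrad.integral_mul_fderiv {U : Set Lifted} {w : Lifted → ℝ}
    {lam : Measure Lifted} {F : Lifted → Lifted} (h : HasGrad U w lam F)
    {ψ : Lifted → ℝ} (hψ : IsTest U ψ) (e : Lifted) :
    ∫ p, w p * fderiv ℝ ψ p e = -∫ p, ψ p * pair e (F p) ∂lam := by
  rw [← h.deriv ψ hψ e]
  refine (setIntegral_eq_integral_of_forall_compl_eq_zero fun p hp => ?_).symm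
  simp [hψ.fderiv_eq_zero hp]

theorem abs_integral_mul_le {σ : Measure Lifted} {W : Set Lifted} (hW : MeasurableSet W)
    {ψ g : Lifted → ℝ}
    (hg : IntegrableOn g W σ) {C : ℝ} (hψ : ∀ p, |ψ p| ≤ C) (hψW : ∀ p ∉ W, ψ p = 0) :
    |∫ p, ψ p * g p ∂σ| ≤ C * ∫ p in W, |g p| ∂σ := by
  rw [← integral_const_mul, ← integral_indicator hW, ← Real.norm_eq_abs]
  refine norm_integral_le_of_norm_le ((IntegrableOn.integrable_indicator (hg.abs.const_mul C) hW)) ?_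
  refine Eventually.of_forall fun p => ?_
  by_cases hp : p ∈ W
  · simp only [hp, indicator_of_mem, norm_mul]
    exact mul_le_mul_of_nonneg_right (hψ p) (abs_nonneg _)
  · simp [hp, hψW p hp]

/-- A function whose integrals against test functions bounded by one are bounded. -/
theorem lintegral_enorm_le_of_forall_test {σ : Measure Lifted} [IsFiniteMeasureOnCompacts σ]
    {W : Set Lifted} (hW : IsOpen W) {g : Lifted → ℝ} (hg : LocallyIntegrable g σ) {A : ℝ}
    (hA : ∀ ψ, IsTest W ψ → (∀ p, |ψ p| ≤ 1) → ∫ p, ψ p * g p ∂σ ≤ A) :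
    ∫⁻ p in W, ‖g p‖ₑ ∂σ ≤ ENNReal.ofReal A := by
  -- Balls exhaust `W`, since `σ` and `g` are only locally finite.
  have key : ∀ n : ℕ, ∫⁻ p in W ∩ Metric.ball 0 n, ‖g p‖ₑ ∂σ ≤ ENNReal.ofReal A := by
    intro n
    set B := W ∩ Metric.ball (0 : Lifted) n
    have hB : IsOpen B := hW.inter Metric.isOpen_ball
    have hBf : σ B < ⊤ := (measure_mono inter_subset_right).trans_lt measure_ball_lt_top
    have : IsFiniteMeasure (σ.restrict B) := ⟨by simpa using hBf⟩
    have hgB : IntegrableOn g B σ :=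
      (hg.integrableOn_isCompact (isCompact_closedBall 0 n)).mono_set
        (inter_subset_right.trans Metric.ball_subset_closedBall)
    -- Tests approximating the sign of `g` produce the integral of `|g|` in the limit.
    obtain ⟨ψ, hψ, hψ1, hψl⟩ := exists_test_tendsto_ae (σ.restrict B) hB
      (s := fun p => (SignType.sign (g p) : ℝ)) (by
        have hs : Measurable fun x : ℝ => ((SignType.sign x : SignType) : ℝ) := by
          have : (fun x : ℝ => ((SignType.sign x : SignType) : ℝ))
              = fun x => if 0 < x then 1 else if x < 0 then -1 else 0 := by
            ext x
            rcases lt_trichotomy x 0 with h | h | h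
            · simp [h, h.not_gt]
            · simp [h]
            · simp [h]
          rw [this]
          exact Measurable.ite measurableSet_Ioi measurable_const
            (Measurable.ite measurableSet_Iio measurable_const measurable_const)
        exact (hs.comp_aemeasurable hgB.1.aemeasurable).aestronglyMeasurable) (fun p => by
        rcases lt_trichotomy (g p) 0 with h | h | h <;> simp [h])
    have hlim : Tendsto (fun n => ∫ p in B, ψ n p * g p ∂σ) atTop (𝓝 (∫ p in B, |g p| ∂σ)) := by
      refine tendsto_integral_of_dominated_convergence (fun p => |g p|)
        (fun n => (hψ n).smooth.continuous.aestronglyMeasurable.mul hgB.1) hgB.abs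
        (fun n => Eventually.of_forall fun p => ?_) ?_
      · rw [norm_mul]
        exact mul_le_of_le_one_left (abs_nonneg _) (hψ1 n p)
      · filter_upwards [hψl, ae_restrict_mem hB.measurableSet] with p hp hpB
        have := (hp hpB).mul_const (g p)
        rwa [sign_mul_self] at this
    rw [← ofReal_integral_norm_eq_lintegral_enorm hgB]
    refine ENNReal.ofReal_le_ofReal (le_of_tendsto' hlim fun n => ?_)
    rw [setIntegral_eq_integral_of_forall_compl_eq_zero fun p hp => by
      rw [(hψ n).eq_zero hp, zero_mul]]
    exact hA _ ((hψ n).mono inter_subset_left) (hψ1 n)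
  have hU : W = ⋃ n : ℕ, W ∩ Metric.ball 0 n := by
    rw [← inter_iUnion, Metric.iUnion_ball_nat, inter_univ]
  conv_lhs => rw [hU]
  rw [setLIntegral_iUnion_of_directed]
  · exact iSup_le key
  · refine directed_of_isDirected_le fun m n h => inter_subset_inter_right _ ?_
    exact Metric.ball_subset_ball (by exact_mod_cast h)

/-- Tested against `ψ`, the increment is the change of `∫ w ψ(· - s e)` over `s ∈ [0, r]`. Its
derivative is at most the directional variation on `O`, because the translated test functions stay
supported in `O`. -/
theorem HasGrad.lintegral_translate_le {U : Set Lifted} {w : Lifted → ℝ}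
    {lam : Measure Lifted} {F : Lifted → Lifted} (h : HasGrad U w lam F) (hw : Measurable w)
    (hw1 : ∀ p, |w p| ≤ 1) {W O : Set Lifted} (hW : IsOpen W) (hO : MeasurableSet O) (hOU : O ⊆ U)
    {e : Lifted} {r : ℝ} (hr : 0 ≤ r) (hWO : ∀ p ∈ W, ∀ s ∈ Icc 0 r, p + s • e ∈ O) :
    ∫⁻ p in W, ‖w (p + r • e) - w p‖ₑ ≤ ENNReal.ofReal r * ∫⁻ p in O, ‖pair e (F p)‖ₑ ∂lam := by
  have hP := (integrable_pair_const h.integrable e)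
  rw [← ofReal_integral_norm_eq_lintegral_enorm hP.integrableOn, ← ENNReal.ofReal_mul hr]
  have hwl := locallyIntegrable_of_bound hw hw1
  refine lintegral_enorm_le_of_forall_test hW ?_ fun ψ hψ hψ1 => ?_
  · refine LocallyIntegrable.sub ?_ hwl
    exact locallyIntegrable_of_bound (hw.comp (measurable_add_const _)) fun p => hw1 _
  rw [← integral_mul_translate_sub hw hw1 hψ.smooth.continuous hψ.compact]
  have hD := fun s => hasDerivAt_integral_mul_translate hwl hψ.smooth hψ.compact e s
  have hb : ∀ s ∈ Icc 0 r, ‖-∫ p, w p * fderiv ℝ ψ (p - s • e) e‖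
      ≤ ∫ p in O, ‖pair e (F p)‖ ∂lam := by
    intro s hs
    have ht : IsTest O fun p => ψ (p - s • e) := hψ.translate fun p hp => hWO p hp s hs
    have := h.integral_mul_fderiv (ht.mono hOU) e
    simp only [fderiv_comp_sub_const] at this
    rw [this, neg_neg]
    have h2 := abs_integral_mul_le hO hP.integrableOn (ψ := fun p => ψ (p - s • e))
      (fun p => hψ1 _) (fun p hp => ht.eq_zero hp)
    simpa using h2
  have := (convex_Icc (0 : ℝ) r).norm_image_sub_le_of_norm_hasDerivWithin_le
    (fun s _ => (hD s).hasDerivWithinAt) hb (left_mem_Icc.2 hr) (right_mem_Icc.2 hr)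
  simp only [zero_smul, sub_zero, Real.norm_eq_abs, abs_of_nonneg hr] at this
  rw [mul_comm]
  exact (le_abs_self _).trans this

/-- The difference quotient of step `1 / (n + 1)` in direction `e`. -/
noncomputable def dq (w : Lifted → ℝ) (e : Lifted) (n : ℕ) (p : Lifted) : ℝ :=
  ((n : ℝ) + 1) * (w (p + ((n : ℝ) + 1)⁻¹ • e) - w p)

theorem measurable_dq {w : Lifted → ℝ} (hw : Measurable w) (e : Lifted) (n : ℕ) :
    Measurable (dq w e n) :=
  ((hw.comp (measurable_add_const _)).sub hw).const_mul _

theorem abs_dq_le {w : Lifted → ℝ} (hw1 : ∀ p, |w p| ≤ 1) (e : Lifted) (n : ℕ) (p : Lifted) :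
    |dq w e n p| ≤ ((n : ℝ) + 1) * 2 := by
  rw [dq, abs_mul, abs_of_pos (by positivity : (0 : ℝ) < n + 1)]
  gcongr
  have := abs_sub (w (p + ((n : ℝ) + 1)⁻¹ • e)) (w p)
  linarith [hw1 p, hw1 (p + ((n : ℝ) + 1)⁻¹ • e)]

theorem locallyIntegrable_dq {w : Lifted → ℝ} (hw : Measurable w) (hw1 : ∀ p, |w p| ≤ 1)
    (e : Lifted) (n : ℕ) : LocallyIntegrable (dq w e n) :=
  (locallyIntegrable_const (((n : ℝ) + 1) * 2)).mono (measurable_dq hw e n).aestronglyMeasurable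
    (Eventually.of_forall fun p => (abs_dq_le hw1 e n p).trans (le_abs_self _))

theorem enorm_dq (w : Lifted → ℝ) (e : Lifted) (n : ℕ) (p : Lifted) :
    ‖dq w e n p‖ₑ = ENNReal.ofReal (n + 1) * ‖w (p + ((n : ℝ) + 1)⁻¹ • e) - w p‖ₑ := by
  rw [dq, enorm_mul, Real.enorm_eq_ofReal (by positivity : (0 : ℝ) ≤ n + 1)]

theorem HasGrad.lintegral_dq_le {U : Set Lifted} {w : Lifted → ℝ}
    {lam : Measure Lifted} {F : Lifted → Lifted} (h : HasGrad U w lam F) (hw : Measurable w)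
    (hw1 : ∀ p, |w p| ≤ 1) {W O : Set Lifted} (hW : IsOpen W) (hO : MeasurableSet O) (hOU : O ⊆ U)
    {e : Lifted} {n : ℕ} (hWO : ∀ p ∈ W, ∀ s ∈ Icc 0 ((n : ℝ) + 1)⁻¹, p + s • e ∈ O) :
    ∫⁻ p in W, ‖dq w e n p‖ₑ ≤ ∫⁻ p in O, ‖pair e (F p)‖ₑ ∂lam := by
  simp only [enorm_dq]
  rw [lintegral_const_mul' _ _ ENNReal.ofReal_ne_top]
  have := h.lintegral_translate_le hw hw1 hW hO hOU (by positivity) hWO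
  refine (mul_le_mul_right this _).trans ?_
  rw [← mul_assoc, ← ENNReal.ofReal_mul (by positivity), mul_inv_cancel₀ (by positivity)]
  simp

theorem tendsto_natCast_add_one_inv : Tendsto (fun n : ℕ => ((n : ℝ) + 1)⁻¹) atTop (𝓝 0) := by
  simpa using tendsto_one_div_add_atTop_nhds_zero_nat (𝕜 := ℝ)

theorem tendsto_integral_mul_dq {w ψ : Lifted → ℝ} (hw : Measurable w) (hw1 : ∀ p, |w p| ≤ 1)
    (hψ : ContDiff ℝ ∞ ψ) (hψc : HasCompactSupport ψ) (e : Lifted) :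
    Tendsto (fun n => ∫ p, ψ p * dq w e n p) atTop (𝓝 (-∫ p, w p * fderiv ℝ ψ p e)) := by
  have hD := hasDerivAt_integral_mul_translate (locallyIntegrable_of_bound hw hw1) hψ hψc e 0
  have h1 := hD.tendsto_slope_zero.comp (f := fun n : ℕ => ((n : ℝ) + 1)⁻¹) (x := atTop)
    (tendsto_nhdsWithin_iff.2 ⟨tendsto_natCast_add_one_inv,
      Eventually.of_forall fun n => by simp; positivity⟩)
  simp only [zero_smul, sub_zero] at h1
  refine h1.congr fun n => ?_
  simp only [Function.comp, zero_add, inv_inv, smul_eq_mul]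
  rw [integral_mul_translate_sub hw hw1 hψ.continuous hψc, ← integral_const_mul]
  exact integral_congr_ae (Eventually.of_forall fun p => by simp only [dq]; ring)

/-- The left side is the limit of `ψ` integrated against difference quotients. The sets `W n` may
vary with the step, because difference quotients are only controlled at a distance from the boundary
of the domain. -/
theorem enorm_integral_mul_fderiv_le {w ψ : Lifted → ℝ} (hw : Measurable w)
    (hw1 : ∀ p, |w p| ≤ 1) (hψ : ContDiff ℝ ∞ ψ) (hψc : HasCompactSupport ψ) (e : Lifted)
    {C : ℝ} (hC : ∀ p, |ψ p| ≤ C) {W : ℕ → Set Lifted}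
    (hψW : ∀ᶠ n in atTop, tsupport ψ ⊆ W n) :
    ‖∫ p, w p * fderiv ℝ ψ p e‖ₑ
      ≤ ENNReal.ofReal C * liminf (fun n => ∫⁻ p in W n, ‖dq w e n p‖ₑ) atTop := by
  rw [← ENNReal.liminf_const_mul_of_ne_top ENNReal.ofReal_ne_top, ← enorm_neg]
  have h1 := (tendsto_integral_mul_dq hw hw1 hψ hψc e).enorm
  rw [← h1.liminf_eq]
  refine liminf_le_liminf ?_
  filter_upwards [hψW] with n hn
  refine (enorm_integral_le_lintegral_enorm _).trans ?_
  rw [← lintegral_const_mul' _ _ ENNReal.ofReal_ne_top]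
  rw [← setLIntegral_eq_of_support_subset (s := tsupport ψ) ?_]
  · refine (lintegral_mono fun p => ?_).trans (lintegral_mono_set hn)
    rw [enorm_mul]
    gcongr
    rw [Real.enorm_eq_ofReal_abs]
    exact ENNReal.ofReal_le_ofReal (hC p)
  · intro p hp
    refine subset_tsupport _ fun h0 => hp ?_
    simp [h0]

/-- Lower semicontinuity of the total variation; together with `HasGrad.lintegral_dq_le` it
characterizes directional variation by difference quotients. -/
theorem HasGrad.lintegral_pair_le_liminf {U : Set Lifted} {w : Lifted → ℝ}
    {lam : Measure Lifted} {F : Lifted → Lifted} (h : HasGrad U w lam F) (hw : Measurable w)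
    (hw1 : ∀ p, |w p| ≤ 1) {W : Set Lifted} (hW : IsOpen W) (hWU : W ⊆ U) (e : Lifted) :
    ∫⁻ p in W, ‖pair e (F p)‖ₑ ∂lam ≤ liminf (fun n => ∫⁻ p in W, ‖dq w e n p‖ₑ) atTop := by
  have := h.finite
  by_cases htop : liminf (fun n => ∫⁻ p in W, ‖dq w e n p‖ₑ) atTop = ⊤
  · rw [htop]; exact le_top
  rw [← ENNReal.ofReal_toReal htop]
  refine lintegral_enorm_le_of_forall_test hW
    (integrable_pair_const h.integrable e).locallyIntegrable fun ψ hψ hψ1 => ?_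
  have h1 := enorm_integral_mul_fderiv_le hw hw1 hψ.smooth hψ.compact e hψ1 (W := fun _ => W)
    (Eventually.of_forall fun _ => hψ.supp)
  rw [h.integral_mul_fderiv (hψ.mono hWU), enorm_neg, ENNReal.ofReal_one, one_mul] at h1
  refine (Real.le_norm_self _).trans ?_
  have := ENNReal.toReal_mono htop h1
  simpa using this

/-- The difference quotients near the support of `φ` are bounded in `L¹` by the directional
variation, so uniform approximation of `φ` by test functions extends the convergence from smooth to
continuous `φ`. This is how the gradients of explicit functions are evaluated. -/
theorem HasGrad.tendsto_integral_mul_dq_of_continuous {U : Set Lifted} (hU : IsOpen U)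
    {w : Lifted → ℝ}
    {lam : Measure Lifted} {F : Lifted → Lifted} (h : HasGrad U w lam F) (hw : Measurable w)
    (hw1 : ∀ p, |w p| ≤ 1) {φ : Lifted → ℝ} (hφ : Continuous φ) (hφc : HasCompactSupport φ)
    (hφU : tsupport φ ⊆ U) (e : Lifted) :
    Tendsto (fun n => ∫ p, φ p * dq w e n p) atTop (𝓝 (∫ p, φ p * pair e (F p) ∂lam)) := by
  have hfin := h.finite
  have hP := integrable_pair_const h.integrable e
  set A := ∫ p, |pair e (F p)| ∂lam with hA
  have hA0 : 0 ≤ A := integral_nonneg fun p => abs_nonneg _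
  obtain ⟨O, hO, hKO, hOc⟩ := exists_isOpen_superset_and_isCompact_closure hφc
  obtain ⟨δ, hδ, hδU⟩ := hφc.exists_thickening_subset_open hU hφU
  set W := Metric.thickening (δ / 2) (tsupport φ) with hW
  have hWo : IsOpen W := Metric.isOpen_thickening
  have hWb : Bornology.IsBounded W := hφc.isBounded.thickening
  have hWK : tsupport φ ⊆ W := Metric.self_subset_thickening (by positivity) _
  have hev : ∀ᶠ n : ℕ in atTop, ∫ p in W, |dq w e n p| ≤ A := by
    have h1 : Tendsto (fun n : ℕ => ((n : ℝ) + 1)⁻¹ * ‖e‖) atTop (𝓝 0) := by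
      simpa using tendsto_natCast_add_one_inv.mul_const ‖e‖
    filter_upwards [h1.eventually (gt_mem_nhds (by positivity : (0 : ℝ) < δ / 2))] with n hn
    have h2 := h.lintegral_dq_le hw hw1 hWo hU.measurableSet subset_rfl (e := e) (n := n)
      fun p hp s hs => hδU (by
        obtain ⟨z, hz, hpz⟩ := Metric.mem_thickening_iff.1 hp
        refine Metric.mem_thickening_iff.2 ⟨z, hz, ?_⟩
        have h3 : dist (p + s • e) p ≤ ((n : ℝ) + 1)⁻¹ * ‖e‖ := by
          rw [dist_eq_norm, add_sub_cancel_left, norm_smul, Real.norm_eq_abs, abs_of_nonneg hs.1]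
          exact mul_le_mul_of_nonneg_right hs.2 (norm_nonneg _)
        linarith [dist_triangle (p + s • e) p z])
    have h4 : ∫⁻ p in W, ‖dq w e n p‖ₑ ≤ ENNReal.ofReal A := by
      refine h2.trans ((setLIntegral_le_lintegral _ _).trans ?_)
      rw [hA, ← ofReal_integral_norm_eq_lintegral_enorm hP]
      rfl
    have hi : IntegrableOn (dq w e n) W :=
      ((locallyIntegrable_dq hw hw1 e n).integrableOn_isCompact hWb.isCompact_closure).mono_set
        subset_closure
    rw [← ofReal_integral_norm_eq_lintegral_enorm hi, ENNReal.ofReal_le_ofReal_iff hA0] at h4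
    exact h4
  rw [Metric.tendsto_atTop']
  intro ε hε
  -- The approximation error `η` is multiplied by at most `A`, once for the difference quotients and
  -- once for the gradient.
  set η := ε / (4 * (A + 1)) with hη
  have hη0 : 0 < η := by positivity
  obtain ⟨ψ, hψs, hψd, hψsupp⟩ := hφ.exists_contDiff_approx (ε := fun _ => η) ⊤
    continuous_const fun _ => hη0
  have hts : tsupport ψ ⊆ tsupport φ := closure_mono hψsupp
  have hψ : IsTest U ψ := ⟨hψs, hφc.mono hψsupp, hts.trans hφU⟩
  have hlim := tendsto_integral_mul_dq hw hw1 hψ.smooth hψ.compact e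
  rw [h.integral_mul_fderiv hψ, neg_neg] at hlim
  obtain ⟨N, hN⟩ := eventually_atTop.1 (hev.and (Metric.tendsto_nhds.1 hlim (ε / 4)
    (by positivity)))
  refine ⟨N, fun n hn => ?_⟩
  obtain ⟨h1, h2⟩ := hN n hn.le
  have hd : ∀ p, |φ p - ψ p| ≤ η := fun p => by
    have := (hψd p).le
    rwa [dist_comm, Real.dist_eq] at this
  have hz : ∀ p ∉ W, φ p - ψ p = 0 := fun p hp => by
    rw [image_eq_zero_of_notMem_tsupport fun hh => hp (hWK hh),
      image_eq_zero_of_notMem_tsupport fun hh => hp (hWK (hts hh)), sub_zero]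
  have hηA : η * A ≤ ε / 4 := by
    rw [hη, div_mul_eq_mul_div, div_le_div_iff₀ (by positivity) (by positivity)]
    nlinarith
  have hi : IntegrableOn (dq w e n) W :=
      ((locallyIntegrable_dq hw hw1 e n).integrableOn_isCompact hWb.isCompact_closure).mono_set
        subset_closure
  have h3 : |∫ p, (φ p - ψ p) * dq w e n p| ≤ ε / 4 :=
    (abs_integral_mul_le hWo.measurableSet hi hd hz).trans
      ((mul_le_mul_of_nonneg_left h1 hη0.le).trans hηA)
  have h4 : |∫ p, (φ p - ψ p) * pair e (F p) ∂lam| ≤ ε / 4 := by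
    refine (abs_integral_mul_le MeasurableSet.univ hP.integrableOn hd (by simp)).trans ?_
    rw [setIntegral_univ]
    exact hηA
  have int1 : ∀ f : Lifted → ℝ, Continuous f → HasCompactSupport f →
      Integrable fun p => f p * dq w e n p := fun f hf hfc => by
    have := (locallyIntegrable_dq hw hw1 e n).integrable_smul_left_of_hasCompactSupport hf hfc
    simpa using this
  have int2 : ∀ f : Lifted → ℝ, Continuous f → HasCompactSupport f →
      Integrable (fun p => f p * pair e (F p)) lam := fun f hf hfc => by
    have := hP.locallyIntegrable.integrable_smul_left_of_hasCompactSupport hf hfc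
    simpa using this
  have e1 : ∫ p, (φ p - ψ p) * dq w e n p
      = (∫ p, φ p * dq w e n p) - ∫ p, ψ p * dq w e n p := by
    rw [← integral_sub (int1 φ hφ hφc) (int1 ψ hψs.continuous hψ.compact)]
    simp only [sub_mul]
  have e2 : ∫ p, (φ p - ψ p) * pair e (F p) ∂lam
      = ∫ p, φ p * pair e (F p) ∂lam - ∫ p, ψ p * pair e (F p) ∂lam := by
    rw [← integral_sub (int2 φ hφ hφc) (int2 ψ hψs.continuous hψ.compact)]
    simp only [sub_mul]
  rw [e1] at h3
  rw [e2] at h4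
  rw [Real.dist_eq] at h2 ⊢
  rw [abs_le] at h3 h4
  rw [abs_lt] at h2 ⊢
  constructor <;> linarith

/-- The positive and negative parts of the difference quotients are densities of measures on the
compact set `K₀`, with bounded mass along infinitely many steps. Such measures are weakly compact,
and their limits `α` and `β` represent the directional derivative as `α - β`. -/
theorem exists_measures_of_liminf {U K₀ : Set Lifted} (hK₀ : IsCompact K₀)
    {w : Lifted → ℝ} (hw : Measurable w) (hw1 : ∀ p, |w p| ≤ 1) {W : ℕ → Set Lifted}
    (hWm : ∀ n, MeasurableSet (W n))
    (hW : ∀ K ⊆ U, IsCompact K → ∀ᶠ n in atTop, K ⊆ W n) {e : Lifted}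
    (h0 : ∀ n, ∀ p ∈ W n, p ∉ K₀ → dq w e n p = 0)
    (hfin : liminf (fun n => ∫⁻ p in W n, ‖dq w e n p‖ₑ) atTop < ⊤) :
    ∃ α β : Measure Lifted, IsFiniteMeasure α ∧ IsFiniteMeasure β ∧
      ∀ ψ, IsTest U ψ → ∫ p, w p * fderiv ℝ ψ p e = -(∫ p, ψ p ∂α - ∫ p, ψ p ∂β) := by
  obtain ⟨C, hC1, hC2⟩ := exists_between hfin
  lift C to NNReal using hC2.ne
  have hfreq : ∃ᶠ n in atTop, ∫⁻ p in W n, ‖dq w e n p‖ₑ < C := frequently_lt_of_liminf_lt (by isBoundedDefault) hC1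
  set A : Set ℕ := {n | ∫⁻ p in W n, ‖dq w e n p‖ₑ < C} with hA
  have hne : (atTop ⊓ 𝓟 A).NeBot := frequently_mem_iff_neBot.1 hfreq
  -- An ultrafilter on the indices with bounded norm replaces a subsequence and serves for both
  -- signs at once.
  set 𝓕 : Ultrafilter ℕ := Ultrafilter.of (atTop ⊓ 𝓟 A)
  have hle : (𝓕 : Filter ℕ) ≤ atTop ⊓ 𝓟 A := Ultrafilter.of_le _
  have hsetm : ∀ n, MeasurableSet (W n ∩ K₀) := fun n => (hWm n).inter hK₀.measurableSet
  -- `ε = 1` selects the positive part and `ε = -1` the negative part.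
  have key : ∀ ε : ℝ, |ε| = 1 → ∃ α : Measure Lifted, IsFiniteMeasure α ∧ ∀ ψ, IsTest U ψ →
      Tendsto (fun n => ∫ p in W n ∩ K₀, max (ε * dq w e n p) 0 * ψ p) 𝓕 (𝓝 (∫ p, ψ p ∂α)) := by
    intro ε hε
    let d : ℕ → Lifted → ℝ≥0∞ := fun n p => ENNReal.ofReal (ε * dq w e n p)
    have hd : ∀ n, Measurable (d n) := fun n =>
      ((measurable_dq hw e n).const_mul ε).ennreal_ofReal
    have hdle : ∀ n p, d n p ≤ ‖dq w e n p‖ₑ := fun n p => by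
      rw [Real.enorm_eq_ofReal_abs]
      refine ENNReal.ofReal_le_ofReal ((le_abs_self _).trans ?_)
      rw [abs_mul, hε, one_mul]
    let ν : ℕ → Measure Lifted := fun n =>
      if n ∈ A then (volume.restrict (W n ∩ K₀)).withDensity (d n) else 0
    have hνC : ∀ n, ν n univ ≤ C := fun n => by
      by_cases hn : n ∈ A
      · simp only [ν, hn, if_true]
        rw [withDensity_apply _ MeasurableSet.univ, Measure.restrict_univ]
        refine le_trans ?_ (le_of_lt hn)
        exact (lintegral_mono (hdle n)).trans (lintegral_mono_set inter_subset_left)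
      · simp [ν, hn]
    have hνf : ∀ n, IsFiniteMeasure (ν n) := fun n => ⟨(hνC n).trans_lt ENNReal.coe_lt_top⟩
    have hνK : ∀ n, ν n K₀ᶜ = 0 := fun n => by
      by_cases hn : n ∈ A
      · simp only [ν, hn, if_true]
        rw [withDensity_apply _ hK₀.measurableSet.compl, Measure.restrict_restrict
          hK₀.measurableSet.compl]
        have : K₀ᶜ ∩ (W n ∩ K₀) = ∅ := by
          ext p; simp; tauto
        simp [this]
      · simp [ν, hn]
    have hcomp := isCompact_setOfPred_finiteMeasure_le_of_isCompact (E := Lifted) C hK₀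
    let ν' : ℕ → FiniteMeasure Lifted := fun n => ⟨ν n, hνf n⟩
    obtain ⟨α, -, hα⟩ := hcomp.ultrafilter_le_nhds (𝓕.map ν')
      (by
        rw [Ultrafilter.coe_map, le_principal_iff, mem_map]
        refine Eventually.of_forall fun n => ?_
        refine ⟨?_, ?_⟩
        · have := hνC n
          rw [← ENNReal.coe_le_coe, FiniteMeasure.ennreal_mass]
          exact this
        · rw [FiniteMeasure.null_iff_toMeasure_null]
          exact hνK n)
    refine ⟨α, inferInstance, fun ψ hψ => ?_⟩
    have hα' : Tendsto ν' 𝓕 (𝓝 α) := hα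
    rw [FiniteMeasure.tendsto_iff_forall_integral_tendsto] at hα'
    obtain ⟨B, hB⟩ := hψ.exists_bound
    have := hα' (BoundedContinuousFunction.ofNormedAddCommGroup ψ hψ.smooth.continuous B hB)
    refine this.congr' ?_
    have hmem : ∀ᶠ n in (𝓕 : Filter ℕ), n ∈ A := (hle.trans inf_le_right) (mem_principal_self A)
    filter_upwards [hmem] with n hn
    simp only [ν', FiniteMeasure.toMeasure_mk, ν, hn, if_true,
      BoundedContinuousFunction.coe_ofNormedAddCommGroup]
    rw [integral_withDensity_eq_integral_toReal_smul (hd n)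
      (Eventually.of_forall fun p => ENNReal.ofReal_lt_top)]
    refine integral_congr_ae (Eventually.of_forall fun p => ?_)
    simp [d, ENNReal.toReal_ofReal']
  obtain ⟨α, hαf, hα⟩ := key 1 (by simp)
  obtain ⟨β, hβf, hβ⟩ := key (-1) (by simp)
  refine ⟨α, β, hαf, hβf, fun ψ hψ => ?_⟩
  have h1 : Tendsto (fun n => ∫ p, ψ p * dq w e n p) 𝓕 (𝓝 (-∫ p, w p * fderiv ℝ ψ p e)) :=
    (tendsto_integral_mul_dq hw hw1 hψ.smooth hψ.compact e).mono_left (hle.trans inf_le_left)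
  have h2 := (hα ψ hψ).sub (hβ ψ hψ)
  have h3 := tendsto_nhds_unique h1 (h2.congr' ?_)
  · linarith
  filter_upwards [(hle.trans inf_le_left) (hW _ hψ.supp hψ.compact)] with n hn
  have hi : ∀ ε : ℝ, Integrable (fun p => max (ε * dq w e n p) 0 * ψ p) := fun ε => by
    refine (hψ.smooth.continuous.integrable_of_hasCompactSupport hψ.compact).bdd_mul
      (c := |ε| * (((n : ℝ) + 1) * 2))
      (((measurable_dq hw e n).const_mul ε).max measurable_const).aestronglyMeasurable
      (Eventually.of_forall fun p => ?_)
    rw [Real.norm_eq_abs, abs_of_nonneg (le_max_right _ _)]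
    refine max_le ((le_abs_self _).trans ?_) (by positivity)
    rw [abs_mul]
    exact mul_le_mul_of_nonneg_left (abs_dq_le hw1 e n p) (abs_nonneg _)
  rw [← integral_sub (hi 1).integrableOn (hi (-1)).integrableOn,
    ← integral_indicator (hsetm n)]
  refine integral_congr_ae (Eventually.of_forall fun p => ?_)
  by_cases hp : p ∈ W n ∩ K₀
  · simp only [hp, indicator_of_mem]
    rcases le_total 0 (dq w e n p) with h | h
    · simp [h]; ring
    · simp [h]; ring
  · simp only [hp, not_false_eq_true, indicator_of_notMem]
    by_cases hpψ : p ∈ tsupport ψ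
    · have hpW := hn hpψ
      simp [h0 n p hpW fun hpK => hp ⟨hpW, hpK⟩]
    · simp [image_eq_zero_of_notMem_tsupport hpψ]

theorem exists_integrable_of_measures {lam α β : Measure Lifted} [IsFiniteMeasure lam]
    [IsFiniteMeasure α] [IsFiniteMeasure β] (hα : α ≪ lam) (hβ : β ≪ lam) :
    ∃ f : Lifted → ℝ, Integrable f lam ∧ ∀ ψ : Lifted → ℝ, Continuous ψ → (∃ C, ∀ p, |ψ p| ≤ C) →
      ∫ p, ψ p ∂α - ∫ p, ψ p ∂β = ∫ p, ψ p * f p ∂lam := by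
  have hLα : α.HaveLebesgueDecomposition lam :=
    Measure.haveLebesgueDecomposition_of_sigmaFinite α lam
  have hLβ : β.HaveLebesgueDecomposition lam :=
    Measure.haveLebesgueDecomposition_of_sigmaFinite β lam
  refine ⟨fun p => (α.rnDeriv lam p).toReal - (β.rnDeriv lam p).toReal,
    Measure.integrable_toReal_rnDeriv.sub Measure.integrable_toReal_rnDeriv, fun ψ hψ ⟨C, hC⟩ => ?_⟩
  rw [← integral_toReal_rnDeriv_mul hα, ← integral_toReal_rnDeriv_mul hβ, ← integral_sub]
  · exact integral_congr_ae (Eventually.of_forall fun p => by ring)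
  all_goals
    exact Measure.integrable_toReal_rnDeriv.mul_bdd hψ.aestronglyMeasurable
      (Eventually.of_forall hC)

/-- Bounded difference quotients in three independent directions suffice: the sum of the six limit
measures dominates each of them and serves as the common base measure. -/
theorem exists_hasGrad_of_liminf {U K₀ : Set Lifted} (hK₀ : IsCompact K₀)
    {w : Lifted → ℝ} (hw : Measurable w) (hw1 : ∀ p, |w p| ≤ 1) {W : ℕ → Set Lifted}
    (hWm : ∀ n, MeasurableSet (W n))
    (hW : ∀ K ⊆ U, IsCompact K → ∀ᶠ n in atTop, K ⊆ W n)
    (h0 : ∀ e ∈ ({ex 0, ex 1, es} : Set Lifted), ∀ n, ∀ p ∈ W n, p ∉ K₀ → dq w e n p = 0)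
    (hfin : ∀ e ∈ ({ex 0, ex 1, es} : Set Lifted),
      liminf (fun n => ∫⁻ p in W n, ‖dq w e n p‖ₑ) atTop < ⊤) :
    ∃ lam F, HasGrad U w lam F := by
  obtain ⟨α₀, β₀, i1, i2, H0⟩ := exists_measures_of_liminf hK₀ hw hw1 hWm hW
    (h0 (ex 0) (by simp)) (hfin (ex 0) (by simp))
  obtain ⟨α₁, β₁, i3, i4, H1⟩ := exists_measures_of_liminf hK₀ hw hw1 hWm hW
    (h0 (ex 1) (by simp)) (hfin (ex 1) (by simp))
  obtain ⟨α₂, β₂, i5, i6, H2⟩ := exists_measures_of_liminf hK₀ hw hw1 hWm hW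
    (h0 es (by simp)) (hfin es (by simp))
  set lam := (α₀ + β₀) + ((α₁ + β₁) + (α₂ + β₂)) with hlam
  have le0 : α₀ + β₀ ≤ lam := Measure.le_add_right le_rfl
  have le1 : α₁ + β₁ ≤ lam := (Measure.le_add_right le_rfl).trans (Measure.le_add_left le_rfl)
  have le2 : α₂ + β₂ ≤ lam := (Measure.le_add_left le_rfl).trans (Measure.le_add_left le_rfl)
  have ac : ∀ α β : Measure Lifted, α + β ≤ lam → α ≪ lam ∧ β ≪ lam := fun α β h =>
    ⟨((Measure.le_add_right le_rfl).trans h).absolutelyContinuous,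
      ((Measure.le_add_left le_rfl).trans h).absolutelyContinuous⟩
  obtain ⟨f0, hf0, G0⟩ := exists_integrable_of_measures (ac _ _ le0).1 (ac _ _ le0).2
  obtain ⟨f1, hf1, G1⟩ := exists_integrable_of_measures (ac _ _ le1).1 (ac _ _ le1).2
  obtain ⟨f2, hf2, G2⟩ := exists_integrable_of_measures (ac _ _ le2).1 (ac _ _ le2).2
  refine ⟨lam, fun p => (f0 p • EuclideanSpace.single 0 1 + f1 p • EuclideanSpace.single 1 1, f2 p),
    inferInstance, ?_, fun ψ hψ e => ?_⟩
  · exact ((hf0.smul_const _).add (hf1.smul_const _)).prodMk hf2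
  · have hint : ∀ f : Lifted → ℝ, Integrable f lam → Integrable (fun p => ψ p * f p) lam :=
      fun f hf => by
        obtain ⟨C, hC⟩ := hψ.exists_bound
        exact hf.bdd_mul hψ.smooth.continuous.aestronglyMeasurable (Eventually.of_forall hC)
    have hpair : ∀ p, ψ p * pair e (f0 p • EuclideanSpace.single 0 1
        + f1 p • EuclideanSpace.single 1 1, f2 p)
        = e.1 0 * (ψ p * f0 p) + e.1 1 * (ψ p * f1 p) + e.2 * (ψ p * f2 p) := fun p => by
      simp [pair, PiLp.inner_apply, Fin.sum_univ_two]
      ring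
    simp only [hpair]
    have j0 := (hint f0 hf0).const_mul (e.1 0)
    have j1 := (hint f1 hf1).const_mul (e.1 1)
    have j2 := (hint f2 hf2).const_mul e.2
    have j01 : Integrable (fun p => e.1 0 * (ψ p * f0 p) + e.1 1 * (ψ p * f1 p)) lam := j0.add j1
    rw [integral_add j01 j2, integral_add j0 j1, integral_const_mul, integral_const_mul,
      integral_const_mul, ← G0 ψ hψ.smooth.continuous hψ.exists_bound,
      ← G1 ψ hψ.smooth.continuous hψ.exists_bound, ← G2 ψ hψ.smooth.continuous hψ.exists_bound]
    rw [setIntegral_eq_integral_of_forall_compl_eq_zero fun p hp => by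
      simp [hψ.fderiv_eq_zero hp]]
    have he : e = e.1 0 • ex 0 + e.1 1 • ex 1 + e.2 • es := by
      refine Prod.ext ?_ ?_
      · ext i
        fin_cases i <;> simp [ex, es]
      · simp [ex, es]
    have hD : ∀ p, w p * fderiv ℝ ψ p e = e.1 0 * (w p * fderiv ℝ ψ p (ex 0))
        + e.1 1 * (w p * fderiv ℝ ψ p (ex 1)) + e.2 * (w p * fderiv ℝ ψ p es) := fun p => by
      conv_lhs => rw [he, map_add, map_add, map_smul, map_smul, map_smul]
      simp only [smul_eq_mul]
      ring
    have hDi : ∀ a : Lifted, Integrable fun p => w p * fderiv ℝ ψ p a := fun a =>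
      integrable_mul_of_bound hw hw1
        ((hψ.smooth.continuous_fderiv (by simp)).clm_apply continuous_const)
        (hψ.compact.fderiv_apply (𝕜 := ℝ) a)
    have k0 := (hDi (ex 0)).const_mul (e.1 0)
    have k1 := (hDi (ex 1)).const_mul (e.1 1)
    have k2 := (hDi es).const_mul e.2
    have k01 : Integrable (fun p => e.1 0 * (w p * fderiv ℝ ψ p (ex 0))
        + e.1 1 * (w p * fderiv ℝ ψ p (ex 1))) := k0.add k1
    simp only [hD]
    rw [integral_add k01 k2, integral_add k0 k1, integral_const_mul, integral_const_mul,
      integral_const_mul, H0 ψ hψ, H1 ψ hψ, H2 ψ hψ]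
    ring

/-! ### Normalized functions and their superlevel sets -/

/-- Measurable functions with values in `[0, 1]` that equal `1` below height `0` and `0` above
height `M`. -/
structure IsNormalized (M : ℝ) (v : Lifted → ℝ) : Prop where
  measurable : Measurable v
  range : ∀ p, v p ∈ Icc (0 : ℝ) 1
  below : ∀ p : Lifted, p.2 < 0 → v p = 1
  above : ∀ p : Lifted, M < p.2 → 0 ≤ p.2 → v p = 0

theorem IsNormalized.abs_le {M : ℝ} {v : Lifted → ℝ} (h : IsNormalized M v) (p : Lifted) :
    |v p| ≤ 1 := by
  rw [abs_of_nonneg (h.range p).1]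
  exact (h.range p).2

theorem IsNormalized.locallyIntegrable {M : ℝ} {v : Lifted → ℝ} (h : IsNormalized M v) :
    LocallyIntegrable v := locallyIntegrable_of_bound h.measurable h.abs_le

theorem boundaryLift_of_neg (Ω : Set Plane) (γ : ℝ → Plane) (L : ℝ) (μp μm : Measure Plane)
    {p : Lifted} (hp : p.2 < 0) : boundaryLift Ω γ L μp μm p = 1 := by simp [boundaryLift, hp]

theorem boundaryLift_of_gt (Ω : Set Plane) (γ : ℝ → Plane) (L : ℝ) (μp μm : Measure Plane)
    {p : Lifted} (h0 : 0 ≤ p.2) (hp : maxValue γ L μp μm < p.2) :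
    boundaryLift Ω γ L μp μm p = 0 := by simp [boundaryLift, hp, h0.not_gt]

theorem boundaryLift_eq_zero_or_one (Ω : Set Plane) (γ : ℝ → Plane) (L : ℝ) (μp μm : Measure Plane)
    (p : Lifted) : boundaryLift Ω γ L μp μm p = 0 ∨ boundaryLift Ω γ L μp μm p = 1 := by
  unfold boundaryLift subgraph
  split_ifs <;> simp

theorem ae_restrict_of_ae_sdiff {U K : Set Lifted} (hU : MeasurableSet U) (hK : MeasurableSet K)
    {P : Lifted → Prop} (h : ∀ᵐ p ∂(volume.restrict (U \ K)), P p) :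
    ∀ᵐ p ∂(volume.restrict U), p ∉ K → P p := by
  rw [ae_restrict_iff' (hU.diff hK)] at h
  rw [ae_restrict_iff' hU]
  filter_upwards [h] with p hp h1 h2 using hp ⟨h1, h2⟩

theorem measurableSet_cylinder (Ω : Set Plane) (M : ℝ) : MeasurableSet (cylinder Ω M) :=
  isClosed_closure.measurableSet.prod measurableSet_Icc

/-- A representative that is Borel and satisfies the bounds everywhere makes difference quotients of
all superlevel functions jointly measurable in level and point. Below `0` and above `M` the
prescribed values are constant, so this region can be set without reference to the boundary image.
-/
theorem MemC.exists_normalized {Ω : Set Plane} {γ : ℝ → Plane} {L : ℝ} {μp μm : Measure Plane}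
    {v : Lifted → ℝ} (h : MemC Ω γ L μp μm v) :
    ∃ v', IsNormalized (maxValue γ L μp μm) v' ∧
      v =ᵐ[volume.restrict (liftedDomain Ω)] v' := by
  have hU := (isOpen_liftedDomain Ω).measurableSet
  have hK := measurableSet_cylinder Ω (maxValue γ L μp μm)
  obtain ⟨Dx, Ds, hD⟩ := h.boundedVariation
  have hm := hD.locallyIntegrable.aestronglyMeasurable
  set g := hm.mk v with hg
  have hgm : Measurable g := hm.stronglyMeasurable_mk.measurable
  refine ⟨fun p => if p.2 < 0 then 1 else if maxValue γ L μp μm < p.2 then 0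
    else max 0 (min 1 (g p)), ⟨?_, fun p => ?_, fun p hp => by simp [hp], fun p hp h0 => by
      simp [hp, h0.not_gt]⟩, ?_⟩
  · refine Measurable.ite (measurableSet_lt measurable_snd measurable_const) measurable_const ?_
    exact Measurable.ite (measurableSet_lt measurable_const measurable_snd) measurable_const
      (measurable_const.max (measurable_const.min hgm))
  · split_ifs <;> simp
  · have hb := ae_restrict_of_ae_sdiff hU hK h.boundary
    filter_upwards [h.range, hm.ae_eq_mk, hb] with p h1 h2 h3
    by_cases hp : p.2 < 0
    · have := h3 fun hc => hc.2.1.not_gt hp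
      rw [this, boundaryLift_of_neg _ _ _ _ _ hp]
      simp [hp]
    by_cases hp' : maxValue γ L μp μm < p.2
    · have := h3 fun hc => hc.2.2.not_gt hp'
      rw [this, boundaryLift_of_gt _ _ _ _ _ (not_lt.1 hp) hp']
      simp [hp, hp']
    · simp only [hp, hp', if_false]
      rw [hg, ← h2, min_eq_right h1.2, max_eq_right h1.1]

theorem superlevel_eq_ite (v : Lifted → ℝ) (t : ℝ) (p : Lifted) :
    superlevel v t p = if t < v p then 1 else 0 := by
  simp [superlevel, indicator_apply]

theorem superlevel_congr {v v' : Lifted → ℝ} {μ : Measure Lifted} (h : v =ᵐ[μ] v') (t : ℝ) :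
    superlevel v t =ᵐ[μ] superlevel v' t := by
  filter_upwards [h] with p hp
  rw [superlevel_eq_ite, superlevel_eq_ite, hp]

theorem measurable_superlevel_uncurry {v : Lifted → ℝ} (hv : Measurable v) :
    Measurable fun q : ℝ × Lifted => superlevel v q.1 q.2 := by
  simp only [superlevel_eq_ite]
  exact Measurable.ite (measurableSet_lt measurable_fst (hv.comp measurable_snd)) measurable_const
    measurable_const

theorem IsNormalized.superlevel {M : ℝ} {v : Lifted → ℝ} (h : IsNormalized M v) {t : ℝ}
    (ht : t ∈ Ioo (0 : ℝ) 1) : IsNormalized M (superlevel v t) where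
  measurable := (measurable_superlevel_uncurry h.measurable).comp measurable_prodMk_left
  range p := by rw [superlevel_eq_ite]; split_ifs <;> simp
  below p hp := by rw [superlevel_eq_ite, h.below p hp, if_pos ht.2]
  above p hp h0 := by rw [superlevel_eq_ite, h.above p hp h0, if_neg ht.1.not_gt]

/-- The integrand is the indicator of the interval between `a` and `b`. This one-dimensional
identity is the source of the coarea formula. -/
theorem lintegral_enorm_ite_sub {a b : ℝ} (ha : a ∈ Icc (0 : ℝ) 1) (hb : b ∈ Icc (0 : ℝ) 1) :
    ∫⁻ t in Ioo (0 : ℝ) 1, ‖(if t < a then (1 : ℝ) else 0) - (if t < b then 1 else 0)‖ₑ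
      = ‖a - b‖ₑ := by
  wlog hab : b ≤ a generalizing a b
  · have := this hb ha (le_of_not_ge hab)
    rw [← enorm_neg, neg_sub, ← this]
    refine lintegral_congr fun t => ?_
    rw [← enorm_neg, neg_sub]
  have : ∀ t : ℝ, ‖(if t < a then (1 : ℝ) else 0) - (if t < b then 1 else 0)‖ₑ
      = (Ico b a).indicator (fun _ => 1) t := fun t => by
    by_cases h1 : t < b
    · simp [h1, h1.trans_le hab]
    · by_cases h2 : t < a
      · simp [h1, h2, not_lt.1 h1]
      · simp [h1, h2]
  simp_rw [this]
  rw [lintegral_indicator measurableSet_Ico, Measure.restrict_restrict measurableSet_Ico,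
    lintegral_const, one_mul, Measure.restrict_apply MeasurableSet.univ, univ_inter,
    Real.enorm_eq_ofReal (sub_nonneg.2 hab), ← Real.volume_Ico]
  refine le_antisymm (measure_mono inter_subset_left) ?_
  have : Ioo b a ⊆ Ico b a ∩ Ioo 0 1 := fun t ht =>
    ⟨⟨ht.1.le, ht.2⟩, hb.1.trans_lt ht.1, ht.2.trans_le ha.2⟩
  refine le_trans ?_ (measure_mono this)
  simp

theorem integral_ite_lt {a : ℝ} (ha : a ∈ Icc (0 : ℝ) 1) :
    ∫ t in Ioo (0 : ℝ) 1, (if t < a then (1 : ℝ) else 0) = a := by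
  have : (fun t : ℝ => if t < a then (1 : ℝ) else 0) = (Iio a).indicator fun _ => 1 := by
    ext t; simp [indicator_apply]
  rw [this, integral_indicator measurableSet_Iio, Measure.restrict_restrict measurableSet_Iio,
    setIntegral_const, smul_eq_mul, mul_one]
  have : Iio a ∩ Ioo 0 1 = Ioo 0 a := by
    ext t
    simp only [mem_inter_iff, mem_Iio, mem_Ioo]
    constructor
    · rintro ⟨h1, h2, -⟩; exact ⟨h2, h1⟩
    · rintro ⟨h1, h2⟩; exact ⟨h2, h1, h2.trans_le ha.2⟩
  rw [this]
  simp [ha.1]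

theorem measurable_dq_superlevel {v : Lifted → ℝ} (hv : Measurable v) (e : Lifted) (n : ℕ) :
    Measurable fun q : ℝ × Lifted => ‖dq (superlevel v q.1) e n q.2‖ₑ := by
  unfold dq
  have h1 := measurable_superlevel_uncurry hv
  have h2 : Measurable fun q : ℝ × Lifted => (q.1, q.2 + ((n : ℝ) + 1)⁻¹ • e) :=
    measurable_fst.prodMk (measurable_snd.add_const _)
  exact (((h1.comp h2).sub h1).const_mul _).enorm

/-- Coarea is an identity already at positive step size, by Tonelli; only the passage to the limit
loses equality. -/
theorem lintegral_dq_superlevel {M : ℝ} {v : Lifted → ℝ} (hv : IsNormalized M v) (e : Lifted)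
    (n : ℕ) (W : Set Lifted) :
    ∫⁻ t in Ioo (0 : ℝ) 1, ∫⁻ p in W, ‖dq (superlevel v t) e n p‖ₑ
      = ∫⁻ p in W, ‖dq v e n p‖ₑ := by
  rw [lintegral_lintegral_swap (measurable_dq_superlevel hv.measurable e n).aemeasurable]
  refine lintegral_congr fun p => ?_
  simp only [enorm_dq, superlevel_eq_ite]
  rw [lintegral_const_mul' _ _ ENNReal.ofReal_ne_top,
    lintegral_enorm_ite_sub (hv.range _) (hv.range _)]

theorem measurable_lintegral_dq_superlevel {v : Lifted → ℝ} (hv : Measurable v) (e : Lifted)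
    (n : ℕ) (W : Set Lifted) :
    Measurable fun t => ∫⁻ p in W, ‖dq (superlevel v t) e n p‖ₑ :=
  (measurable_dq_superlevel hv e n).lintegral_prod_right'

theorem lintegral_liminf_dq_superlevel_le {M : ℝ} {v : Lifted → ℝ} (hv : IsNormalized M v)
    (e : Lifted) (W : ℕ → Set Lifted) :
    ∫⁻ t in Ioo (0 : ℝ) 1, liminf (fun n => ∫⁻ p in W n, ‖dq (superlevel v t) e n p‖ₑ) atTop
      ≤ liminf (fun n => ∫⁻ p in W n, ‖dq v e n p‖ₑ) atTop := by
  refine (lintegral_liminf_le fun n =>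
    measurable_lintegral_dq_superlevel hv.measurable e n (W n)).trans_eq ?_
  simp only [lintegral_dq_superlevel hv]

/-- The vertical shift is upward and at most `1`, which explains the margin `1` below and none
above. With the bounded base this confines all difference quotients to one compact set, so no mass
escapes in the weak limit. -/
theorem IsNormalized.dq_eq_zero {M : ℝ} {v : Lifted → ℝ} (hv : IsNormalized M v) {e : Lifted}
    (he : e.2 ∈ Icc (0 : ℝ) 1) {n : ℕ} {p : Lifted} (hp : p.2 ∉ Icc (-1) (max M 0)) :
    dq v e n p = 0 := by
  have hn : ((n : ℝ) + 1)⁻¹ ≤ 1 := inv_le_one_of_one_le₀ (by linarith [n.cast_nonneg (α := ℝ)])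
  have hn0 : 0 ≤ ((n : ℝ) + 1)⁻¹ := by positivity
  have h2 : ((n : ℝ) + 1)⁻¹ * e.2 ≤ 1 := mul_le_one₀ hn he.1 he.2
  have h3 : 0 ≤ ((n : ℝ) + 1)⁻¹ * e.2 := mul_nonneg hn0 he.1
  rw [mem_Icc, not_and_or, not_le, not_le] at hp
  rcases hp with hp | hp
  · rw [dq, hv.below p (by linarith), hv.below _ (by simp; linarith)]
    simp
  · have h4 := le_max_left M 0
    have h5 := le_max_right M 0
    rw [dq, hv.above p (by linarith) (by linarith), hv.above _ (by simp; linarith)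
      (by simp; linarith)]
    simp

theorem norm_ex (i : Fin 2) : ‖ex i‖ = 1 := by simp [ex, Prod.norm_def]
theorem norm_es : ‖es‖ = 1 := by simp [es, Prod.norm_def]

/-- The margin of the `n`-th inner part is the step of the `n`-th difference quotient. -/
theorem add_smul_mem_of_mem_innerPart {U : Set Lifted} {n : ℕ} {p : Lifted} (hp : p ∈ innerPart U n)
    {e : Lifted} (he : ‖e‖ ≤ 1) {s : ℝ} (hs : s ∈ Icc 0 ((n : ℝ) + 1)⁻¹) : p + s • e ∈ U := by
  by_contra hc
  have h1 : Metric.infEDist p Uᶜ ≤ edist p (p + s • e) := Metric.infEDist_le_edist_of_mem hc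
  have h2 : edist p (p + s • e) ≤ ((n : ℝ≥0∞) + 1)⁻¹ := by
    rw [edist_dist, dist_eq_norm, sub_add_cancel_left, norm_neg, norm_smul, Real.norm_eq_abs,
      abs_of_nonneg hs.1]
    have : ((n : ℝ≥0∞) + 1)⁻¹ = ENNReal.ofReal (((n : ℝ) + 1)⁻¹) := by
      rw [ENNReal.ofReal_inv_of_pos (by positivity), ENNReal.ofReal_add (by positivity) zero_le_one]
      simp
    rw [this]
    refine ENNReal.ofReal_le_ofReal ((mul_le_of_le_one_right hs.1 he).trans hs.2)
  exact absurd hp (not_lt.2 (h1.trans h2))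

theorem HasGrad.lintegral_innerPart_dq_le {U : Set Lifted} (hU : IsOpen U) {w : Lifted → ℝ}
    {lam : Measure Lifted} {F : Lifted → Lifted} (h : HasGrad U w lam F) (hw : Measurable w)
    (hw1 : ∀ p, |w p| ≤ 1) {e : Lifted} (he : ‖e‖ ≤ 1) (n : ℕ) :
    ∫⁻ p in innerPart U n, ‖dq w e n p‖ₑ ≤ ∫⁻ p in U, ‖pair e (F p)‖ₑ ∂lam :=
  h.lintegral_dq_le hw hw1 (isOpen_innerPart U n) hU.measurableSet subset_rfl
    fun _ hp _ hs => add_smul_mem_of_mem_innerPart hp he hs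

theorem IsNormalized.exists_hasGrad {Ω : Set Plane} (hΩb : Bornology.IsBounded Ω) {M : ℝ}
    {w : Lifted → ℝ} (hw : IsNormalized M w) {W : ℕ → Set Lifted} (hWo : ∀ n, IsOpen (W n))
    (hWU : ∀ n, W n ⊆ liftedDomain Ω)
    (hW : ∀ K ⊆ liftedDomain Ω, IsCompact K → ∀ᶠ n in atTop, K ⊆ W n)
    (hfin : ∀ e ∈ ({ex 0, ex 1, es} : Set Lifted),
      liminf (fun n => ∫⁻ p in W n, ‖dq w e n p‖ₑ) atTop < ⊤) :
    ∃ lam F, HasGrad (liftedDomain Ω) w lam F := by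
  have hb : Bornology.IsBounded (Metric.thickening 1 Ω) := hΩb.thickening
  refine exists_hasGrad_of_liminf (hb.isCompact_closure.prod
    (isCompact_Icc (a := -1) (b := max M 0))) hw.measurable hw.abs_le
    (fun n => (hWo n).measurableSet) hW (fun e he n p hp hpK => ?_) hfin
  refine hw.dq_eq_zero ?_ fun h2 => hpK ⟨subset_closure (hWU n hp).1, h2⟩
  rcases he with rfl | rfl | rfl <;> simp [ex, es]

theorem norm_le_one_of_mem_basis {e : Lifted} (he : e ∈ ({ex 0, ex 1, es} : Set Lifted)) :
    ‖e‖ ≤ 1 := by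
  rcases he with rfl | rfl | rfl
  · exact (norm_ex 0).le
  · exact (norm_ex 1).le
  · exact norm_es.le

/-- Gradients of almost all superlevel functions of `v`, with integrable bounds. -/
structure HasLevelGrads (U : Set Lifted) (v : Lifted → ℝ) (lam : ℝ → Measure Lifted)
    (F : ℝ → Lifted → Lifted) : Prop where
  hasGrad : ∀ᵐ t ∂(volume.restrict (Ioo (0 : ℝ) 1)), HasGrad U (superlevel v t) (lam t) (F t)
  bound : ∀ e ∈ ({ex 0, ex 1, es} : Set Lifted), ∃ a : ℝ → ℝ,
    IntegrableOn a (Ioo 0 1) ∧ ∀ᵐ t ∂(volume.restrict (Ioo (0 : ℝ) 1)), ∀ ψ, IsTest U ψ →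
      ∀ C, (∀ p, |ψ p| ≤ C) → |∫ p, superlevel v t p * fderiv ℝ ψ p e| ≤ C * a t

/-- By Fatou the liminf of the difference quotient norms of the levels is integrable in `t`, hence
finite for almost every `t`, and compactness then gives a gradient. The same liminf is the
integrable bound on test integrals. -/
theorem IsNormalized.exists_hasLevelGrads {Ω : Set Plane} (hΩb : Bornology.IsBounded Ω) {M : ℝ}
    {v : Lifted → ℝ} (hv : IsNormalized M v) {lam : Measure Lifted} {F : Lifted → Lifted}
    (h : HasGrad (liftedDomain Ω) v lam F) :
    ∃ lam' F', HasLevelGrads (liftedDomain Ω) v lam' F' := by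
  classical
  have hU := isOpen_liftedDomain Ω
  set W : ℕ → Set Lifted := innerPart (liftedDomain Ω)
  have hW : ∀ K ⊆ liftedDomain Ω, IsCompact K → ∀ᶠ n in atTop, K ⊆ W n := fun K hK hKc =>
    eventually_subset_innerPart hU hKc hK
  let a : Lifted → ℝ → ℝ≥0∞ := fun e t =>
    liminf (fun n => ∫⁻ p in W n, ‖dq (BranchedTransport.superlevel v t) e n p‖ₑ) atTop
  have ha : ∀ e, Measurable (a e) := fun e => Measurable.liminf fun n =>
    measurable_lintegral_dq_superlevel hv.measurable e n (W n)
  have haint : ∀ e ∈ ({ex 0, ex 1, es} : Set Lifted), ∫⁻ t in Ioo (0 : ℝ) 1, a e t < ⊤ := by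
    intro e he
    refine (lintegral_liminf_dq_superlevel_le hv e W).trans_lt ?_
    refine lt_of_le_of_lt (b := ∫⁻ p in liftedDomain Ω, ‖pair e (F p)‖ₑ ∂lam) ?_
      ((setLIntegral_le_lintegral _ _).trans_lt (integrable_pair_const h.integrable e).2)
    refine (liminf_le_liminf (Eventually.of_forall fun n => h.lintegral_innerPart_dq_le hU
      hv.measurable hv.abs_le (norm_le_one_of_mem_basis he) n)).trans ?_
    simp
  have hafin : ∀ e ∈ ({ex 0, ex 1, es} : Set Lifted),
      ∀ᵐ t ∂(volume.restrict (Ioo (0 : ℝ) 1)), a e t < ⊤ := fun e he =>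
    ae_lt_top (ha e) (haint e he).ne
  have hall : ∀ᵐ t ∂(volume.restrict (Ioo (0 : ℝ) 1)), ∃ q : Measure Lifted × (Lifted → Lifted),
      HasGrad (liftedDomain Ω) (BranchedTransport.superlevel v t) q.1 q.2 := by
    filter_upwards [hafin _ (by simp : ex 0 ∈ _), hafin _ (by simp : ex 1 ∈ _),
      hafin _ (by simp : es ∈ _), ae_restrict_mem measurableSet_Ioo] with t h0 h1 h2 ht
    obtain ⟨l, f, hlf⟩ := (hv.superlevel ht).exists_hasGrad hΩb (fun n => isOpen_innerPart _ n)
      (fun n => innerPart_subset _ n) hW (by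
        rintro e (rfl | rfl | rfl)
        exacts [h0, h1, h2])
    exact ⟨(l, f), hlf⟩
  -- The gradients are chosen level by level, with a default on the exceptional null set;
  -- measurability in `t` of the choice is neither known nor needed.
  let q : ℝ → Measure Lifted × (Lifted → Lifted) := fun t =>
    if ht : ∃ q : Measure Lifted × (Lifted → Lifted),
      HasGrad (liftedDomain Ω) (BranchedTransport.superlevel v t) q.1 q.2 then ht.choose else (0, 0)
  refine ⟨fun t => (q t).1, fun t => (q t).2, ?_, fun e he => ?_⟩
  · filter_upwards [hall] with t ht
    simp only [q, ht, dif_pos]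
    exact ht.choose_spec
  · refine ⟨fun t => (a e t).toReal,
      integrable_toReal_of_lintegral_ne_top (ha e).aemeasurable (haint e he).ne, ?_⟩
    filter_upwards [hafin e he, ae_restrict_mem measurableSet_Ioo] with t ht ht1 ψ hψ C hC
    have h1 := enorm_integral_mul_fderiv_le (hv.superlevel ht1).measurable (hv.superlevel ht1).abs_le
      hψ.smooth hψ.compact e hC (hW _ hψ.supp hψ.compact)
    have hC0 : 0 ≤ C := (abs_nonneg _).trans (hC 0)
    have h2 := ENNReal.toReal_mono (ENNReal.mul_ne_top ENNReal.ofReal_ne_top ht.ne) h1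
    simpa [ENNReal.toReal_ofReal hC0] using h2

theorem norm_fderiv_apply_bound {ψ : Lifted → ℝ} {U : Set Lifted} (hψ : IsTest U ψ) (e : Lifted) :
    Integrable fun p => fderiv ℝ ψ p e :=
  (((hψ.smooth.continuous_fderiv (by simp)).clm_apply continuous_const)).integrable_of_hasCompactSupport
    (hψ.compact.fderiv_apply (𝕜 := ℝ) e)

theorem integrable_prod_superlevel_mul {v : Lifted → ℝ} (hv : Measurable v)
    {g : Lifted → ℝ} (hg : Integrable g) :
    Integrable (fun q : ℝ × Lifted => superlevel v q.1 q.2 * g q.2)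
      ((volume.restrict (Ioo (0 : ℝ) 1)).prod volume) := by
  refine (hg.comp_snd (volume.restrict (Ioo (0 : ℝ) 1))).bdd_mul (c := 1)
    (measurable_superlevel_uncurry hv).aestronglyMeasurable (Eventually.of_forall fun q => ?_)
  rw [superlevel_eq_ite]
  split_ifs <;> simp

theorem integral_integral_superlevel_mul {M : ℝ} {v : Lifted → ℝ} (hv : IsNormalized M v)
    {g : Lifted → ℝ} (hg : Integrable g) :
    ∫ t in Ioo (0 : ℝ) 1, ∫ p, superlevel v t p * g p = ∫ p, v p * g p := by
  rw [integral_integral_swap (integrable_prod_superlevel_mul hv.measurable hg)]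
  refine integral_congr_ae (Eventually.of_forall fun p => ?_)
  simp only [superlevel_eq_ite]
  rw [integral_mul_const, integral_ite_lt (hv.range p)]

/-- Linearity of the gradient in `v`, averaged over levels. For test functions it is Fubini applied
to `v = ∫ χ_{v>t} dt`; the integrable bound of `HasLevelGrads` lets continuous fields on `K` be
reached by dominated convergence in `t`. -/
theorem HasLevelGrads.integral_setIntegral {Ω : Set Plane} {M : ℝ}
    {v : Lifted → ℝ} (hv : IsNormalized M v) {lam : Measure Lifted} {F : Lifted → Lifted}
    (h : HasGrad (liftedDomain Ω) v lam F) {lam' : ℝ → Measure Lifted} {F' : ℝ → Lifted → Lifted}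
    (h' : HasLevelGrads (liftedDomain Ω) v lam' F') {K : Set Lifted} (hK : IsCompact K)
    (hKU : K ⊆ liftedDomain Ω) {φ : Lifted → ℝ} (hφ : ContinuousOn φ K) {e : Lifted}
    (he : e ∈ ({ex 0, ex 1, es} : Set Lifted)) :
    IntegrableOn (fun t => ∫ p in K, φ p * pair e (F' t p) ∂lam' t) (Ioo (0 : ℝ) 1) ∧
    ∫ t in Ioo (0 : ℝ) 1, ∫ p in K, φ p * pair e (F' t p) ∂lam' t
      = ∫ p in K, φ p * pair e (F p) ∂lam := by
  have hU := isOpen_liftedDomain Ω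
  have hfin := h.finite
  obtain ⟨ψ, hψ, ⟨C, hC⟩, hlim, -⟩ := exists_test_tendsto_indicator hU hK hKU hφ
  obtain ⟨a, hai, ha⟩ := h'.bound e he
  -- In this form, free of the chosen gradients, measurability in `t` is visible.
  set Q : ℕ → ℝ → ℝ := fun n t => -∫ p, superlevel v t p * fderiv ℝ (ψ n) p e with hQ
  have hQm : ∀ n, AEStronglyMeasurable (Q n) (volume.restrict (Ioo (0 : ℝ) 1)) := fun n =>
    ((integrable_prod_superlevel_mul hv.measurable
      (norm_fderiv_apply_bound (hψ n) e)).aestronglyMeasurable.integral_prod_right').neg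
  have hQb : ∀ n, ∀ᵐ t ∂(volume.restrict (Ioo (0 : ℝ) 1)), ‖Q n t‖ ≤ C * a t := fun n => by
    filter_upwards [ha] with t ht
    rw [hQ, norm_neg]
    exact ht _ (hψ n) C (hC n)
  have hQl : ∀ᵐ t ∂(volume.restrict (Ioo (0 : ℝ) 1)), Tendsto (fun n => Q n t) atTop
      (𝓝 (∫ p in K, φ p * pair e (F' t p) ∂lam' t)) := by
    filter_upwards [h'.hasGrad] with t ht
    refine (tendsto_integral_mul_pair ht.integrable e hK.measurableSet
      (fun n => (hψ n).smooth.continuous) hC hlim).congr fun n => ?_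
    simp only [hQ]
    rw [ht.integral_mul_fderiv (hψ n), neg_neg]
  have hlim1 := tendsto_integral_of_dominated_convergence _ hQm (hai.const_mul C) hQb hQl
  refine ⟨?_, tendsto_nhds_unique hlim1 ?_⟩
  · refine (hai.const_mul C).mono' (aestronglyMeasurable_of_tendsto_ae _ hQm hQl) ?_
    filter_upwards [hQl, ae_all_iff.2 hQb] with t h1 h2
    exact le_of_tendsto' h1.norm h2
  · refine (tendsto_integral_mul_pair h.integrable e hK.measurableSet
      (fun n => (hψ n).smooth.continuous) hC hlim).congr fun n => ?_
    simp only [hQ]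
    rw [integral_neg, integral_integral_superlevel_mul hv (norm_fderiv_apply_bound (hψ n) e),
      h.integral_mul_fderiv (hψ n), neg_neg]

theorem HasLevelGrads.integral_flux {Ω : Set Plane} {M : ℝ}
    {v : Lifted → ℝ} (hv : IsNormalized M v) {lam : Measure Lifted} {F : Lifted → Lifted}
    (h : HasGrad (liftedDomain Ω) v lam F) {lam' : ℝ → Measure Lifted} {F' : ℝ → Lifted → Lifted}
    (h' : HasLevelGrads (liftedDomain Ω) v lam' F') {K : Set Lifted} (hK : IsCompact K)
    (hKU : K ⊆ liftedDomain Ω) {φx : Lifted → Plane} {φs : Lifted → ℝ} (hx : ContinuousOn φx K)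
    (hs : ContinuousOn φs K) :
    IntegrableOn (fun t => flux K (lam' t) (F' t) φx φs) (Ioo (0 : ℝ) 1) ∧
    ∫ t in Ioo (0 : ℝ) 1, flux K (lam' t) (F' t) φx φs = flux K lam F φx φs := by
  have hxi : ∀ i : Fin 2, ContinuousOn (fun p => φx p i) K := fun i =>
    (EuclideanSpace.proj (𝕜 := ℝ) i : Plane →L[ℝ] ℝ).continuous.comp_continuousOn hx
  obtain ⟨i0, e0⟩ := h'.integral_setIntegral hv h hK hKU (hxi 0) (e := ex 0) (by simp)
  obtain ⟨i1, e1⟩ := h'.integral_setIntegral hv h hK hKU (hxi 1) (e := ex 1) (by simp)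
  obtain ⟨i2, e2⟩ := h'.integral_setIntegral hv h hK hKU hs (e := es) (by simp)
  have hae : (fun t => flux K (lam' t) (F' t) φx φs) =ᵐ[volume.restrict (Ioo (0 : ℝ) 1)]
      fun t => ∫ p in K, φx p 0 * pair (ex 0) (F' t p) ∂lam' t
      + ∫ p in K, φx p 1 * pair (ex 1) (F' t p) ∂lam' t
      + ∫ p in K, φs p * pair es (F' t p) ∂lam' t := by
    filter_upwards [h'.hasGrad] with t ht
    exact flux_eq_sum ht.integrable hK hx hs
  have i01 : IntegrableOn (fun t => ∫ p in K, φx p 0 * pair (ex 0) (F' t p) ∂lam' t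
      + ∫ p in K, φx p 1 * pair (ex 1) (F' t p) ∂lam' t) (Ioo (0 : ℝ) 1) := i0.add i1
  refine ⟨(i01.add i2).congr hae.symm, ?_⟩
  rw [integral_congr_ae hae, integral_add i01 i2, integral_add i0 i1, e0, e1, e2,
    flux_eq_sum h.integrable hK hx hs]

/-! ### Measurability in the level and the general inequality -/

theorem memK_zero {Ω : Set Plane} {M : ℝ} {τ : ℝ → ℝ} (hτ : IsTransportationCost τ) :
    MemK Ω M τ (fun _ => 0) (fun _ => 0) where
  continuous_x := continuousOn_const
  continuous_s := continuousOn_const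
  bound p _ := by simp
  nonneg p _ := le_rfl
  integral_bound x _ s₁ s₂ _ h _ := by simpa using hτ.nonneg _ (by linarith)

theorem flux_congr {K : Set Lifted} (hK : MeasurableSet K) {lam : Measure Lifted}
    {F : Lifted → Lifted} {φx φx' : Lifted → Plane} {φs φs' : Lifted → ℝ}
    (hx : EqOn φx φx' K) (hs : EqOn φs φs' K) :
    flux K lam F φx φs = flux K lam F φx' φs' :=
  setIntegral_congr_fun hK fun p hp => by simp only [hx hp, hs hp]

/-- Countably many admissible fields suffice to compute the supremum of the flux. -/
theorem exists_countable_fields {Ω : Set Plane} (hΩb : Bornology.IsBounded Ω) (M : ℝ) {τ : ℝ → ℝ}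
    (hτ : IsTransportationCost τ) :
    ∃ D : ℕ → (Lifted → Plane) × (Lifted → ℝ), (∀ n, MemK Ω M τ (D n).1 (D n).2) ∧
      ∀ (lam : Measure Lifted) (F : Lifted → Lifted), Integrable F lam →
        ⨆ (φx : Lifted → Plane) (φs : Lifted → ℝ) (_ : MemK Ω M τ φx φs),
          ENNReal.ofReal (flux (cylinder Ω M) lam F φx φs)
        = ⨆ n, ENNReal.ofReal (flux (cylinder Ω M) lam F (D n).1 (D n).2) := by
  set K := cylinder Ω M with hKdef
  have hK : IsCompact K := isCompact_cylinder hΩb M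
  have : CompactSpace K := isCompact_iff_compactSpace.1 hK
  -- Only the values on the compact set `K` matter, so fields are encoded in the separable space
  -- `C(K, Lifted)` and extended continuously to be defined everywhere.
  have hproj : ∀ q : C(K, Lifted), ∃ Q : C(Lifted, Lifted), Q.restrict K = q := fun q =>
    ContinuousMap.exists_restrict_eq hK.isClosed q
  choose E hE using hproj
  have hEc : ∀ q : C(K, Lifted), ∀ p (hp : p ∈ K), E q p = q ⟨p, hp⟩ := fun q p hp => by
    conv_rhs => rw [← hE q]
    rfl
  let S : Set C(K, Lifted) := {q | MemK Ω M τ (fun p => (E q p).1) (fun p => (E q p).2)}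
  have hmk : ∀ φx φs, MemK Ω M τ φx φs → ∃ q ∈ S, ∀ p ∈ K, E q p = (φx p, φs p) := by
    intro φx φs hφ
    let q : C(K, Lifted) := ⟨fun p => (φx p, φs p),
      (hφ.continuous_x.domRestrict).prodMk (hφ.continuous_s.domRestrict)⟩
    have hq : ∀ p ∈ K, E q p = (φx p, φs p) := fun p hp => hEc q p hp
    refine ⟨q, ⟨(E q).continuous.fst.continuousOn, (E q).continuous.snd.continuousOn,
      fun p hp => ?_, fun p hp => ?_, fun x hx s₁ s₂ h1 h2 h3 => ?_⟩, hq⟩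
    · rw [hq p hp]; exact hφ.bound p hp
    · rw [hq p hp]; exact hφ.nonneg p hp
    · refine le_trans (le_of_eq ?_) (hφ.integral_bound x hx s₁ s₂ h1 h2 h3)
      congr 1
      refine intervalIntegral.integral_congr fun s hs => ?_
      rw [uIcc_of_le h2.le] at hs
      have : (x, s) ∈ K := ⟨hx, h1.trans hs.1, hs.2.trans h3⟩
      simp only [hq _ this]
  obtain ⟨c, hcS, hcc, hcd⟩ := (TopologicalSpace.IsSeparable.of_separableSpace S).exists_countable_dense_subset
  have hSne : S.Nonempty := by
    obtain ⟨q, hq, -⟩ := hmk _ _ (memK_zero (Ω := Ω) (M := M) hτ)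
    exact ⟨q, hq⟩
  have hcne : c.Nonempty := by
    rw [nonempty_iff_ne_empty]
    rintro rfl
    simp at hcd
    exact hSne.ne_empty hcd
  obtain ⟨d, hd⟩ := hcc.exists_eq_range hcne
  refine ⟨fun n => (fun p => (E (d n) p).1, fun p => (E (d n) p).2), fun n =>
    hcS (hd ▸ mem_range_self n), fun lam F hF => le_antisymm ?_ ?_⟩
  · refine iSup_le fun φx => iSup_le fun φs => iSup_le fun hφ => ?_
    obtain ⟨q, hqS, hq⟩ := hmk φx φs hφ
    rw [flux_congr hK.measurableSet (φx' := fun p => (E q p).1) (φs' := fun p => (E q p).2)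
      (fun p hp => by simp [hq p hp]) (fun p hp => by simp [hq p hp])]
    set Φ : C(K, Lifted) → ℝ := fun q =>
      flux K lam F (fun p => (E q p).1) (fun p => (E q p).2) with hΦ
    have hint : ∀ q : C(K, Lifted), IntegrableOn (fun p => pair (E q p) (F p)) K lam := fun q => by
      have h1 := integrableOn_mul_pair hF (ex 0) hK (φ := fun p => (E q p).1 0)
        ((EuclideanSpace.proj (𝕜 := ℝ) (0 : Fin 2) : Plane →L[ℝ] ℝ).continuous.comp
          (E q).continuous.fst).continuousOn
      have h2 := integrableOn_mul_pair hF (ex 1) hK (φ := fun p => (E q p).1 1)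
        ((EuclideanSpace.proj (𝕜 := ℝ) (1 : Fin 2) : Plane →L[ℝ] ℝ).continuous.comp
          (E q).continuous.fst).continuousOn
      have h3 := integrableOn_mul_pair hF es hK (φ := fun p => (E q p).2)
        (E q).continuous.snd.continuousOn
      exact ((h1.add h2).add h3).congr (Eventually.of_forall fun p => (pair_eq_sum _ _).symm)
    -- The flux is Lipschitz for the uniform norm, so a dense set of admissible fields computes the
    -- supremum. The dense sequence does not depend on the gradient and hence serves all levels.
    have hΦc : Continuous Φ := by
      have hL : LipschitzWith (Real.toNNReal (2 * ∫ p in K, ‖F p‖ ∂lam)) Φ := by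
        refine LipschitzWith.of_dist_le_mul fun q r => ?_
        have h0 : 0 ≤ ∫ p in K, ‖F p‖ ∂lam := integral_nonneg fun p => norm_nonneg _
        rw [Real.coe_toNNReal _ (by positivity), Real.dist_eq, hΦ]
        simp only [flux]
        rw [← integral_sub (hint q) (hint r), mul_right_comm, ← integral_const_mul,
          ← Real.norm_eq_abs]
        refine norm_integral_le_of_norm_le (hF.norm.integrableOn.const_mul _) ?_
        filter_upwards [ae_restrict_mem hK.measurableSet] with p hp
        rw [← pair_sub_left]
        refine (abs_pair_le _ _).trans ?_
        gcongr
        rw [hEc q p hp, hEc r p hp, ← dist_eq_norm]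
        exact ContinuousMap.dist_apply_le_dist _
      exact hL.continuous
    have hmem : ∀ q ∈ c, ENNReal.ofReal (Φ q) ≤ ⨆ n, ENNReal.ofReal (Φ (d n)) := by
      intro q hq
      rw [hd] at hq
      obtain ⟨n, rfl⟩ := hq
      exact le_iSup (fun n => ENNReal.ofReal (Φ (d n))) n
    have hcl : IsClosed {q | ENNReal.ofReal (Φ q) ≤ ⨆ n, ENNReal.ofReal (Φ (d n))} :=
      isClosed_le (ENNReal.continuous_ofReal.comp hΦc) continuous_const
    exact closure_minimal hmem hcl (hcd hqS)
  · refine iSup_le fun n => ?_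
    exact le_iSup_of_le _ (le_iSup_of_le _ (le_iSup_of_le (hcS (hd ▸ mem_range_self n)) le_rfl))

/-- The prescribed outer values are `0` or `1`, so passing to a level `t` in `(0, 1)` leaves them
unchanged. -/
theorem MemC.superlevel_of_hasGrad {Ω : Set Plane} {γ : ℝ → Plane} {L : ℝ}
    {μp μm : Measure Plane} {v : Lifted → ℝ} (h : MemC Ω γ L μp μm v) {M : ℝ}
    (hv : IsNormalized M v) {t : ℝ} (ht : t ∈ Ioo (0 : ℝ) 1) {lam : Measure Lifted}
    {F : Lifted → Lifted} (hg : HasGrad (liftedDomain Ω) (superlevel v t) lam F) :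
    MemC Ω γ L μp μm (superlevel v t) where
  range := Eventually.of_forall (hv.superlevel ht).range
  boundedVariation := ⟨_, _, hg.isGradientMeasure (isOpen_liftedDomain Ω)
    ((hv.superlevel ht).locallyIntegrable.locallyIntegrableOn _)⟩
  boundary := by
    filter_upwards [h.boundary] with p hp
    rw [superlevel_eq_ite, hp]
    rcases boundaryLift_eq_zero_or_one Ω γ L μp μm p with h0 | h0 <;> rw [h0]
    · rw [if_neg ht.1.not_gt]
    · rw [if_pos ht.2]

theorem MemC.exists_data {Ω : Set Plane} (hΩb : Bornology.IsBounded Ω) {γ : ℝ → Plane} {L : ℝ}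
    {μp μm : Measure Plane} {v : Lifted → ℝ} (h : MemC Ω γ L μp μm v) :
    ∃ v' lam F lam' F', IsNormalized (maxValue γ L μp μm) v' ∧
      v =ᵐ[volume.restrict (liftedDomain Ω)] v' ∧ MemC Ω γ L μp μm v' ∧
      HasGrad (liftedDomain Ω) v' lam F ∧ HasLevelGrads (liftedDomain Ω) v' lam' F' := by
  obtain ⟨v', hv', hvv⟩ := h.exists_normalized
  have hC := h.congr hvv
  obtain ⟨Dx, Ds, hD⟩ := hC.boundedVariation
  obtain ⟨lam, F, hF, -, -⟩ := hD.exists_hasGrad (isOpen_liftedDomain Ω)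
  obtain ⟨lam', F', hF'⟩ := hv'.exists_hasLevelGrads hΩb hF
  exact ⟨v', lam, F, lam', F', hv', hvv, hC, hF, hF'⟩

/-- For each field the flux for `v` is the average of the fluxes for the levels, each bounded by the
cost of its level; the supremum over fields comes last. Measurability comes from the countable
supremum. -/
theorem convexCost_le_lintegral_superlevel {Ω : Set Plane} (hΩb : Bornology.IsBounded Ω)
    {γ : ℝ → Plane} {L : ℝ} {τ : ℝ → ℝ} (hτ : IsTransportationCost τ)
    {μp μm : Measure Plane} {v : Lifted → ℝ} (h : MemC Ω γ L μp μm v) :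
    (∀ᵐ t ∂(volume.restrict (Ioo (0 : ℝ) 1)), MemC Ω γ L μp μm (superlevel v t)) ∧
    AEMeasurable (fun t => convexCost Ω (maxValue γ L μp μm) τ (superlevel v t))
      (volume.restrict (Ioo (0 : ℝ) 1)) ∧
    convexCost Ω (maxValue γ L μp μm) τ v
      ≤ ∫⁻ t in Ioo (0 : ℝ) 1, convexCost Ω (maxValue γ L μp μm) τ (superlevel v t) := by
  obtain ⟨v', lam, F, lam', F', hv', hvv, hC, hF, hF'⟩ := h.exists_data hΩb
  set M := maxValue γ L μp μm
  have hcyl := isCompact_cylinder hΩb M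
  have hcU := cylinder_subset_liftedDomain Ω M
  have hcost : ∀ᵐ t ∂(volume.restrict (Ioo (0 : ℝ) 1)), convexCost Ω M τ (superlevel v t)
      = ⨆ (φx : Lifted → Plane) (φs : Lifted → ℝ) (_ : MemK Ω M τ φx φs),
      ENNReal.ofReal (flux (cylinder Ω M) (lam' t) (F' t) φx φs) := by
    filter_upwards [hF'.hasGrad, ae_restrict_mem measurableSet_Ioo] with t ht ht1
    rw [convexCost_congr (superlevel_congr hvv t)]
    exact convexCost_eq hΩb ht ((hv'.superlevel ht1).locallyIntegrable.locallyIntegrableOn _)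
  refine ⟨?_, ?_, ?_⟩
  · filter_upwards [hF'.hasGrad, ae_restrict_mem measurableSet_Ioo] with t ht ht1
    exact (hC.superlevel_of_hasGrad hv' ht1 ht).congr (superlevel_congr hvv t).symm
  · obtain ⟨D, hD, hDs⟩ := exists_countable_fields hΩb M hτ
    have hm : AEMeasurable (fun t => ⨆ n, ENNReal.ofReal
        (flux (cylinder Ω M) (lam' t) (F' t) (D n).1 (D n).2)) (volume.restrict (Ioo (0 : ℝ) 1)) :=
      AEMeasurable.iSup fun n => (hF'.integral_flux hv' hF hcyl hcU (hD n).continuous_x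
        (hD n).continuous_s).1.1.aemeasurable.ennreal_ofReal
    refine hm.congr ?_
    filter_upwards [hcost, hF'.hasGrad] with t h1 h2
    rw [h1, hDs _ _ h2.integrable]
  · rw [convexCost_congr hvv, convexCost_eq hΩb hF (hv'.locallyIntegrable.locallyIntegrableOn _)]
    refine iSup_le fun φx => iSup_le fun φs => iSup_le fun hφ => ?_
    obtain ⟨hi, he⟩ := hF'.integral_flux hv' hF hcyl hcU hφ.continuous_x hφ.continuous_s
    rw [← he]
    refine le_trans ?_ (lintegral_mono_ae (f := fun t =>
      ENNReal.ofReal (flux (cylinder Ω M) (lam' t) (F' t) φx φs)) ?_)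
    -- The level fluxes may be negative; discarding their negative parts only increases the average.
    · rw [integral_eq_lintegral_pos_part_sub_lintegral_neg_part hi]
      exact (ENNReal.ofReal_le_ofReal (sub_le_self _ ENNReal.toReal_nonneg)).trans
        ENNReal.ofReal_toReal_le
    · filter_upwards [hcost] with t ht
      rw [ht]
      exact le_iSup_of_le φx (le_iSup_of_le φs (le_iSup_of_le hφ le_rfl))

/-! ### Coarea inequality averaged over directions -/

theorem measurable_dq_superlevel_direction {v : Lifted → ℝ} (hv : Measurable v) (n : ℕ) :
    Measurable fun q : (ℝ × Lifted) × Lifted => ‖dq (superlevel v q.1.1) q.1.2 n q.2‖ₑ := by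
  unfold dq
  have h1 := measurable_superlevel_uncurry hv
  have h2 : Measurable fun q : (ℝ × Lifted) × Lifted =>
      (q.1.1, q.2 + ((n : ℝ) + 1)⁻¹ • q.1.2) :=
    measurable_fst.fst.prodMk (by fun_prop)
  have h3 : Measurable fun q : (ℝ × Lifted) × Lifted => (q.1.1, q.2) :=
    measurable_fst.fst.prodMk measurable_snd
  exact (((h1.comp h2).sub (h1.comp h3)).const_mul _).enorm

theorem measurable_enorm_pair_swap {F : Lifted → Lifted} (hF : Measurable F) :
    Measurable fun q : Lifted × Lifted => ‖pair q.1 (F q.2)‖ₑ :=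
  (continuous_pair.measurable.comp (measurable_fst.prodMk (hF.comp measurable_snd))).enorm

theorem lintegral_lintegral_pair_swap {lam ρ : Measure Lifted} [IsFiniteMeasure lam]
    [IsFiniteMeasure ρ] {F : Lifted → Lifted} (hF : AEMeasurable F lam) (W : Set Lifted) :
    ∫⁻ e, ∫⁻ p in W, ‖pair e (F p)‖ₑ ∂lam ∂ρ = ∫⁻ p in W, ∫⁻ e, ‖pair e (F p)‖ₑ ∂ρ ∂lam := by
  have hG := measurable_enorm_pair_swap hF.measurable_mk
  have h1 : ∀ e, ∫⁻ p in W, ‖pair e (F p)‖ₑ ∂lam = ∫⁻ p in W, ‖pair e (hF.mk F p)‖ₑ ∂lam :=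
    fun e => lintegral_congr_ae (ae_restrict_of_ae (by
      filter_upwards [hF.ae_eq_mk] with p hp
      rw [hp]))
  have h2 : ∫⁻ p in W, ∫⁻ e, ‖pair e (F p)‖ₑ ∂ρ ∂lam
      = ∫⁻ p in W, ∫⁻ e, ‖pair e (hF.mk F p)‖ₑ ∂ρ ∂lam :=
    lintegral_congr_ae (ae_restrict_of_ae (by
      filter_upwards [hF.ae_eq_mk] with p hp
      rw [hp]))
  simp_rw [h1]
  rw [h2, lintegral_lintegral_swap hG.aemeasurable]

theorem add_smul_mem_thickening {K : Set Lifted} {r h : ℝ} {p e : Lifted}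
    (hp : p ∈ Metric.thickening (r / 2) K) (he : ‖e‖ ≤ 1) {s : ℝ} (hs : s ∈ Icc 0 h)
    (hr : h ≤ r / 2) : p + s • e ∈ Metric.thickening r K := by
  obtain ⟨z, hz, hpz⟩ := Metric.mem_thickening_iff.1 hp
  refine Metric.mem_thickening_iff.2 ⟨z, hz, ?_⟩
  have h3 : dist (p + s • e) p ≤ h := by
    rw [dist_eq_norm, add_sub_cancel_left, norm_smul, Real.norm_eq_abs, abs_of_nonneg hs.1]
    exact (mul_le_of_le_one_right hs.1 he).trans hs.2
  linarith [dist_triangle (p + s • e) p z]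

theorem lintegral_direction_ne_top {lam ρ : Measure Lifted} [IsFiniteMeasure ρ]
    {F : Lifted → Lifted} (hF : Integrable F lam) (hρ : ∀ᵐ e ∂ρ, ‖e‖ ≤ 1) :
    ∫⁻ p, ∫⁻ e, ‖pair e (F p)‖ₑ ∂ρ ∂lam ≠ ⊤ := by
  have hb : ∀ p, ∫⁻ e, ‖pair e (F p)‖ₑ ∂ρ ≤ (2 * ρ univ) * ‖F p‖ₑ := fun p => by
    refine (lintegral_mono_ae (g := fun _ => 2 * ‖F p‖ₑ) ?_).trans_eq ?_
    · filter_upwards [hρ] with e he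
      have : ‖pair e (F p)‖ ≤ ‖(2 : ℝ) * ‖F p‖‖ := by
        rw [norm_mul, norm_norm, Real.norm_eq_abs, Real.norm_two]
        refine (abs_pair_le e (F p)).trans ?_
        nlinarith [norm_nonneg (F p)]
      have := enorm_le_iff_norm_le.2 this
      rwa [enorm_mul, enorm_norm, show ‖(2 : ℝ)‖ₑ = 2 by
        rw [Real.enorm_eq_ofReal (by norm_num)]; simp] at this
    · rw [lintegral_const]; ring
  refine ne_of_lt ((lintegral_mono hb).trans_lt ?_)
  rw [lintegral_const_mul' _ _ (ENNReal.mul_ne_top (by simp) (measure_ne_top _ _))]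
  exact ENNReal.mul_lt_top (ENNReal.mul_lt_top (by simp) (measure_lt_top _ _)) hF.2

theorem tendsto_setLIntegral_thickening {lam : Measure Lifted} {K : Set Lifted} (hK : IsClosed K)
    {f : Lifted → ℝ≥0∞} (hf : ∫⁻ p, f p ∂lam ≠ ⊤) :
    Tendsto (fun r => ∫⁻ p in Metric.thickening r K, f p ∂lam) (𝓝[>] 0)
      (𝓝 (∫⁻ p in K, f p ∂lam)) := by
  have hσf : ∀ s, lam.withDensity f s ≠ ⊤ := fun s => by
    refine ((measure_mono (subset_univ s)).trans_lt ?_).ne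
    rw [withDensity_apply _ MeasurableSet.univ, setLIntegral_univ]
    exact hf.lt_top
  have h1 := tendsto_measure_thickening_of_isClosed (μ := lam.withDensity f) (s := K)
    ⟨1, one_pos, hσf _⟩ hK
  rw [withDensity_apply _ hK.measurableSet] at h1
  refine h1.congr fun k => ?_
  rw [withDensity_apply _ Metric.isOpen_thickening.measurableSet]

set_option maxHeartbeats 1000000 in
/-- The coarea inequality on a compact set, for the total variation in the directions weighted
by `ρ`. -/
theorem HasLevelGrads.exists_coarea {Ω : Set Plane} {M : ℝ}
    {v : Lifted → ℝ} (hv : IsNormalized M v) {lam : Measure Lifted} {F : Lifted → Lifted}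
    (h : HasGrad (liftedDomain Ω) v lam F) {lam' : ℝ → Measure Lifted} {F' : ℝ → Lifted → Lifted}
    (h' : HasLevelGrads (liftedDomain Ω) v lam' F') {K : Set Lifted} (hK : IsCompact K)
    (hKU : K ⊆ liftedDomain Ω) (ρ : Measure Lifted) [IsFiniteMeasure ρ]
    (hρ : ∀ᵐ e ∂ρ, ‖e‖ ≤ 1) :
    ∃ m : ℝ → ℝ≥0∞, Measurable m ∧
      (∀ᵐ t ∂(volume.restrict (Ioo (0 : ℝ) 1)),
        ∫⁻ p in K, ∫⁻ e, ‖pair e (F' t p)‖ₑ ∂ρ ∂(lam' t) ≤ m t) ∧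
      ∫⁻ t in Ioo (0 : ℝ) 1, m t ≤ ∫⁻ p in K, ∫⁻ e, ‖pair e (F p)‖ₑ ∂ρ ∂lam := by
  have hU := isOpen_liftedDomain Ω
  have hfin := h.finite
  obtain ⟨δ, hδ, hδU⟩ := hK.exists_thickening_subset_open hU hKU
  -- Neighbourhoods of `K` shrinking to `K`; those of half the radius leave room for translation by
  -- the step.
  let r : ℕ → ℝ := fun k => δ * ((k : ℝ) + 1)⁻¹
  have hr : ∀ k, 0 < r k := fun k => by positivity
  have hrδ : ∀ k, r k ≤ δ := fun k =>
    mul_le_of_le_one_right hδ.le (inv_le_one_of_one_le₀ (by linarith [k.cast_nonneg (α := ℝ)]))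
  let W : ℕ → Set Lifted := fun k => Metric.thickening (r k / 2) K
  let O : ℕ → Set Lifted := fun k => Metric.thickening (r k) K
  have hWo : ∀ k, IsOpen (W k) := fun k => Metric.isOpen_thickening
  have hOU : ∀ k, O k ⊆ liftedDomain Ω := fun k => (Metric.thickening_mono (hrδ k) _).trans hδU
  have hWU : ∀ k, W k ⊆ liftedDomain Ω := fun k =>
    (Metric.thickening_mono (by linarith [hr k]) _).trans (hOU k)
  have hKW : ∀ k, K ⊆ W k := fun k => Metric.self_subset_thickening (by linarith [hr k]) _
  -- A measurable majorant of the variation of the level `t`, obtained from difference quotients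
  -- since the chosen gradients need not depend measurably on `t`. The majorant sought is the
  -- infimum over `k`.
  let m : ℕ → ℝ → ℝ≥0∞ := fun k t =>
    liminf (fun n => ∫⁻ e, (∫⁻ p in W k, ‖dq (superlevel v t) e n p‖ₑ) ∂ρ) atTop
  have hj : ∀ k n, Measurable fun q : ℝ × Lifted =>
      ∫⁻ p in W k, ‖dq (superlevel v q.1) q.2 n p‖ₑ := fun k n =>
    (measurable_dq_superlevel_direction hv.measurable n).lintegral_prod_right'
  have hj' : ∀ k n, Measurable fun t : ℝ =>
      ∫⁻ e, (∫⁻ p in W k, ‖dq (superlevel v t) e n p‖ₑ) ∂ρ := fun k n =>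
    (hj k n).lintegral_prod_right' (ν := ρ)
  have hm : ∀ k, Measurable (m k) := fun k => Measurable.liminf fun n => hj' k n
  refine ⟨fun t => ⨅ k, m k t, Measurable.iInf hm, ?_, ?_⟩
  · filter_upwards [h'.hasGrad, ae_restrict_mem measurableSet_Ioo] with t ht ht1
    have hfin' := ht.finite
    refine le_iInf fun k => ?_
    refine (lintegral_mono_set (hKW k)).trans ?_
    rw [← lintegral_lintegral_pair_swap ht.integrable.1.aemeasurable]
    refine le_trans (lintegral_mono fun e => ht.lintegral_pair_le_liminf
      (hv.superlevel ht1).measurable (hv.superlevel ht1).abs_le (hWo k) (hWU k) e) ?_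
    exact lintegral_liminf_le fun n => (hj k n).comp (measurable_prodMk_left (x := t))
  · have hk : ∀ k, ∫⁻ t in Ioo (0 : ℝ) 1, m k t
        ≤ ∫⁻ p in O k, ∫⁻ e, ‖pair e (F p)‖ₑ ∂ρ ∂lam := by
      intro k
      refine (lintegral_liminf_le fun n => hj' k n).trans ?_
      refine (liminf_le_liminf (v := fun _ => ∫⁻ p in O k, ∫⁻ e, ‖pair e (F p)‖ₑ ∂ρ ∂lam)
        ?_).trans (by simp)
      filter_upwards [tendsto_natCast_add_one_inv.eventually
        (gt_mem_nhds (half_pos (hr k)))] with n hn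
      rw [lintegral_lintegral_swap (hj k n).aemeasurable,
        ← lintegral_lintegral_pair_swap h.integrable.1.aemeasurable]
      refine lintegral_mono_ae ?_
      filter_upwards [hρ] with e he
      rw [lintegral_dq_superlevel hv]
      refine h.lintegral_dq_le hv.measurable hv.abs_le (hWo k)
        Metric.isOpen_thickening.measurableSet (hOU k) fun p hp s hs => ?_
      exact add_smul_mem_thickening hp he hs hn.le
    -- Continuity from above removes the excess of the neighbourhoods over `K`.
    have hlim : Tendsto (fun k => ∫⁻ p in O k, ∫⁻ e, ‖pair e (F p)‖ₑ ∂ρ ∂lam) atTop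
        (𝓝 (∫⁻ p in K, ∫⁻ e, ‖pair e (F p)‖ₑ ∂ρ ∂lam)) :=
      (tendsto_setLIntegral_thickening hK.isClosed
        (lintegral_direction_ne_top h.integrable hρ)).comp (tendsto_nhdsWithin_iff.2
        ⟨by simpa using tendsto_natCast_add_one_inv.const_mul δ, Eventually.of_forall hr⟩)
    refine ge_of_tendsto' hlim fun k => (lintegral_mono fun t => iInf_le _ k).trans (hk k)

/-- The measure on horizontal unit directions, weighted by the unit disc. -/
noncomputable def discDirections : Measure Lifted :=
  (volume.restrict (Metric.ball (0 : Plane) 1)).map fun x => (x, 0)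

instance : IsFiniteMeasure discDirections := by
  have : IsFiniteMeasure ((volume : Measure Plane).restrict (Metric.ball 0 1)) :=
    ⟨by simp⟩
  unfold discDirections
  infer_instance

theorem ae_discDirections : ∀ᵐ e ∂discDirections, ‖e‖ ≤ 1 := by
  unfold discDirections
  rw [ae_map_iff (by fun_prop) (measurableSet_le measurable_norm measurable_const)]
  filter_upwards [ae_restrict_mem Metric.isOpen_ball.measurableSet] with x hx
  have : ‖x‖ < 1 := by simpa using hx
  simpa [Prod.norm_def] using this.le

theorem exists_linearIsometryEquiv_eq (f : Plane) :
    ∃ R : Plane ≃ₗᵢ[ℝ] Plane, R f = ‖f‖ • EuclideanSpace.single 0 1 := by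
  refine ⟨Submodule.reflection (ℝ ∙ (f - ‖f‖ • EuclideanSpace.single 0 1))ᗮ, ?_⟩
  exact Submodule.reflection_sub (by simp [norm_smul])

/-- By invariance of the disc under isometries, the average of `|⟨e, f⟩|` over horizontal `e` is a
fixed multiple of the norm of the horizontal part of `f`. The full horizontal variation is thus
recovered from directional ones. -/
theorem lintegral_discDirections (f : Lifted) :
    ∫⁻ e, ‖pair e f‖ₑ ∂discDirections
      = (∫⁻ x in Metric.ball (0 : Plane) 1, ‖x 0‖ₑ) * ‖f.1‖ₑ := by
  unfold discDirections
  rw [lintegral_map (by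
    exact (continuous_pair.measurable.comp (measurable_id.prodMk measurable_const)).enorm)
    (by fun_prop)]
  obtain ⟨R, hR⟩ := exists_linearIsometryEquiv_eq f.1
  have h1 : ∀ x : Plane, ‖pair (x, 0) f‖ₑ = ‖(R x) 0‖ₑ * ‖f.1‖ₑ := fun x => by
    have : pair (x, 0) f = (R x) 0 * ‖f.1‖ := by
      simp only [pair, zero_mul, add_zero]
      rw [← R.inner_map_map, hR, inner_smul_right]
      simp [PiLp.inner_apply]
      ring
    rw [this, enorm_mul, enorm_norm]
  simp_rw [h1]
  rw [lintegral_mul_const' _ _ enorm_ne_top]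
  congr 1
  have h2 := (R.measurePreserving).restrict_preimage
    (Metric.isOpen_ball (x := (0 : Plane)) (ε := 1)).measurableSet
  have h3 : R ⁻¹' Metric.ball (0 : Plane) 1 = Metric.ball 0 1 := by
    ext x; simp
  rw [h3] at h2
  exact h2.lintegral_comp (f := fun x : Plane => ‖x 0‖ₑ)
    ((EuclideanSpace.proj (𝕜 := ℝ) (0 : Fin 2) : Plane →L[ℝ] ℝ).continuous.measurable.enorm)

theorem lintegral_ball_ne_top : ∫⁻ x in Metric.ball (0 : Plane) 1, ‖x 0‖ₑ ≠ ⊤ := by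
  refine ne_of_lt (lt_of_le_of_lt (setLIntegral_mono' (g := fun _ => 1)
    Metric.isOpen_ball.measurableSet fun x hx => ?_) ?_)
  · have h1 : ‖x‖ < 1 := by simpa using hx
    have h2 := (PiLp.norm_apply_le x 0).trans h1.le
    have := enorm_le_iff_norm_le.2 (h2.trans (le_of_eq (norm_one (α := ℝ)).symm))
    simpa using this
  · simp

theorem lintegral_ball_ne_zero : ∫⁻ x in Metric.ball (0 : Plane) 1, ‖x 0‖ₑ ≠ 0 := by
  have hm : Measurable fun x : Plane => ‖x 0‖ₑ :=
    (EuclideanSpace.proj (𝕜 := ℝ) (0 : Fin 2) : Plane →L[ℝ] ℝ).continuous.measurable.enorm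
  rw [← pos_iff_ne_zero, setLIntegral_pos_iff hm]
  have ho : IsOpen (Function.support (fun x : Plane => ‖x 0‖ₑ) ∩ Metric.ball 0 1) := by
    refine IsOpen.inter ?_ Metric.isOpen_ball
    have : (Function.support fun x : Plane => ‖x 0‖ₑ) = {x : Plane | x 0 ≠ 0} := by
      ext x; simp
    rw [this]
    exact isOpen_ne_fun (EuclideanSpace.proj (𝕜 := ℝ) (0 : Fin 2) : Plane →L[ℝ] ℝ).continuous
      continuous_const
  refine ho.measure_pos _ ⟨EuclideanSpace.single 0 (1 / 2), ?_, ?_⟩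
  · simp
  · simp; norm_num

theorem lintegral_dirac_es (f : Lifted) :
    ∫⁻ e, ‖pair e f‖ₑ ∂(Measure.dirac es) = ‖f.2‖ₑ := by
  rw [lintegral_dirac]
  simp [pair, es]

/-! ### The one-homogeneous case -/

theorem rightDerivZero_of_linear {τ : ℝ → ℝ} {α : ℝ} (hα : ∀ s, 0 ≤ s → τ s = α * s) :
    rightDerivZero τ = ENNReal.ofReal α := by
  unfold rightDerivZero
  rw [limsup_congr (v := fun _ => ENNReal.ofReal α)]
  · exact limsup_const _
  · filter_upwards [self_mem_nhdsWithin] with h hh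
    rw [hα h (le_of_lt hh), mul_div_assoc, div_self (ne_of_gt hh), mul_one]

theorem memK_of_linear {Ω : Set Plane} {M : ℝ} {τ : ℝ → ℝ} {α : ℝ}
    (hα : ∀ s, 0 ≤ s → τ s = α * s) {φx : Lifted → Plane} {φs : Lifted → ℝ}
    (hx : ContinuousOn φx (cylinder Ω M)) (hs : ContinuousOn φs (cylinder Ω M))
    (hb : ∀ p ∈ cylinder Ω M, ‖φx p‖ ≤ α) (h0 : ∀ p ∈ cylinder Ω M, 0 ≤ φs p) :
    MemK Ω M τ φx φs where
  continuous_x := hx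
  continuous_s := hs
  bound p hp := by
    rw [rightDerivZero_of_linear hα, ← ofReal_norm]
    exact ENNReal.ofReal_le_ofReal (hb p hp)
  nonneg := h0
  integral_bound x hx s₁ s₂ h1 h2 h3 := by
    rw [hα _ (by linarith)]
    refine (intervalIntegral.norm_integral_le_of_norm_le_const (C := α) fun s hs => ?_).trans_eq ?_
    · rw [uIoc_of_le h2.le] at hs
      exact hb _ ⟨hx, h1.trans hs.1.le, hs.2.trans h3⟩
    · rw [abs_of_pos (by linarith)]

/-- Continuous fields in the unit ball that converge almost everywhere to the normalized horizontal
gradient attain its variation in the limit. -/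
theorem setIntegral_pair_ge {K : Set Lifted} {lam : Measure Lifted}
    {F : Lifted → Lifted} (hF : Integrable F lam) {A : ℝ}
    (hA : ∀ c : Lifted → Plane, Continuous c → (∀ p, ‖c p‖ ≤ 1) →
      ∫ p in K, inner ℝ (c p) (F p).1 ∂lam ≤ A) [IsFiniteMeasure lam] :
    ∫ p in K, ‖(F p).1‖ ∂lam ≤ A := by
  have hf := hF.fst.integrableOn (s := K)
  obtain ⟨c, hc, hc1, hcl⟩ := exists_continuous_tendsto_ae (lam.restrict K)
    (s := fun p => (‖(F p).1‖)⁻¹ • (F p).1)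
    (hf.1.norm.aemeasurable.inv.aestronglyMeasurable.smul hf.1) (fun p => by
      rw [norm_smul, norm_inv, norm_norm]
      exact inv_mul_le_one)
  have hlim : Tendsto (fun n => ∫ p in K, inner ℝ (c n p) (F p).1 ∂lam) atTop
      (𝓝 (∫ p in K, ‖(F p).1‖ ∂lam)) := by
    refine tendsto_integral_of_dominated_convergence (fun p => ‖(F p).1‖)
      (fun n => (hc n).aestronglyMeasurable.inner hf.1) hf.norm
      (fun n => Eventually.of_forall fun p => ?_) ?_
    · refine (norm_inner_le_norm _ _).trans ?_
      exact mul_le_of_le_one_left (norm_nonneg _) (hc1 n p)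
    · filter_upwards [hcl] with p hp
      have := hp.inner (𝕜 := ℝ) (tendsto_const_nhds (x := (F p).1))
      convert this using 2
      rw [real_inner_smul_left, real_inner_self_eq_norm_sq]
      rcases eq_or_ne ‖(F p).1‖ 0 with h | h
      · simp [h]
      · field_simp
  exact le_of_tendsto' hlim fun n => hA _ (hc n) (hc1 n)

theorem ae_nonpos_of_forall_continuous {K : Set Lifted} {lam : Measure Lifted} [IsFiniteMeasure lam]
    {g : Lifted → ℝ} (hg : IntegrableOn g K lam)
    (hA : ∀ c : Lifted → ℝ, Continuous c → (∀ p, 0 ≤ c p) → (∀ p, |c p| ≤ 1) →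
      ∫ p in K, c p * g p ∂lam ≤ 0) :
    ∀ᵐ p ∂(lam.restrict K), g p ≤ 0 := by
  have hs : Measurable fun x : ℝ => if 0 < x then (1 : ℝ) else 0 :=
    Measurable.ite measurableSet_Ioi measurable_const measurable_const
  obtain ⟨c, hc, hc1, hcl⟩ := exists_continuous_tendsto_ae (lam.restrict K)
    (s := fun p => if 0 < g p then (1 : ℝ) else 0)
    (hs.comp_aemeasurable hg.1.aemeasurable).aestronglyMeasurable (fun p => by
      split_ifs <;> simp)
  -- Squaring makes the approximations nonnegative and keeps the limit, which is `0` or `1`.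
  have hc2 : ∀ n p, |c n p ^ 2| ≤ 1 := fun n p => by
    rw [abs_pow]; exact pow_le_one₀ (abs_nonneg _) (hc1 n p)
  have hlim : Tendsto (fun n => ∫ p in K, c n p ^ 2 * g p ∂lam) atTop
      (𝓝 (∫ p in K, max (g p) 0 ∂lam)) := by
    refine tendsto_integral_of_dominated_convergence (fun p => ‖g p‖)
      (fun n => ((hc n).pow 2).aestronglyMeasurable.mul hg.1) hg.norm
      (fun n => Eventually.of_forall fun p => ?_) ?_
    · rw [norm_mul]
      exact mul_le_of_le_one_left (norm_nonneg _) (hc2 n p)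
    · filter_upwards [hcl] with p hp
      have := (hp.pow 2).mul_const (g p)
      convert this using 2
      split_ifs with h
      · simp [h.le]
      · simp [not_lt.1 h]
  have h1 : ∫ p in K, max (g p) 0 ∂lam ≤ 0 := le_of_tendsto' hlim fun n =>
    hA _ ((hc n).pow 2) (fun p => sq_nonneg _) (hc2 n)
  have h2 := (integral_eq_zero_iff_of_nonneg (μ := lam.restrict K)
    (f := fun p => max (g p) 0) (fun p => le_max_right _ _) hg.pos_part).1
    (le_antisymm h1 (integral_nonneg fun p => le_max_right _ _))
  filter_upwards [h2] with p hp
  have : max (g p) 0 = 0 := hp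
  exact max_eq_right_iff.1 this

theorem flux_vertical {K : Set Lifted} {lam : Measure Lifted} {F : Lifted → Lifted}
    (φs : Lifted → ℝ) : flux K lam F (fun _ => 0) φs = ∫ p in K, φs p * (F p).2 ∂lam := by
  simp [flux, pair]

theorem flux_horizontal {K : Set Lifted} {lam : Measure Lifted} {F : Lifted → Lifted}
    (φx : Lifted → Plane) :
    flux K lam F φx (fun _ => 0) = ∫ p in K, inner ℝ (φx p) (F p).1 ∂lam := by
  simp [flux, pair]

/-- For a finite one-homogeneous cost the vertical derivative is nonpositive on the cylinder. -/
theorem ae_snd_nonpos_of_cost_ne_top {Ω : Set Plane} {M : ℝ} {τ : ℝ → ℝ}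
    (hτ : IsTransportationCost τ) {lam : Measure Lifted}
    {F : Lifted → Lifted} (hF : Integrable F lam) [IsFiniteMeasure lam]
    (hfin : ⨆ (φx : Lifted → Plane) (φs : Lifted → ℝ) (_ : MemK Ω M τ φx φs),
      ENNReal.ofReal (flux (cylinder Ω M) lam F φx φs) ≠ ⊤) :
    ∀ᵐ p ∂(lam.restrict (cylinder Ω M)), (F p).2 ≤ 0 := by
  refine ae_nonpos_of_forall_continuous hF.snd.integrableOn fun c hc hc0 hc1 => ?_
  by_contra! hpos
  set I := ∫ p in cylinder Ω M, c p * (F p).2 ∂lam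
  set G := ⨆ (φx : Lifted → Plane) (φs : Lifted → ℝ) (_ : MemK Ω M τ φx φs),
      ENNReal.ofReal (flux (cylinder Ω M) lam F φx φs)
  -- Vertical components have no upper bound: a positive flux of a vertical field could be
  -- multiplied by any `n`, making the cost infinite.
  obtain ⟨n, hn⟩ := exists_nat_gt (G.toReal / I)
  have hmem : MemK Ω M τ (fun _ => 0) (fun p => n * c p) :=
    ⟨continuousOn_const, (continuous_const.mul hc).continuousOn, fun p _ => by simp,
      fun p _ => mul_nonneg n.cast_nonneg (hc0 p),
      fun x _ s₁ s₂ _ h _ => by simpa using hτ.nonneg _ (by linarith)⟩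
  have h1 : ENNReal.ofReal (n * I) ≤ G := by
    refine le_iSup_of_le _ (le_iSup_of_le _ (le_iSup_of_le hmem ?_))
    rw [flux_vertical, ← integral_const_mul]
    simp only [mul_assoc]
    exact le_rfl
  rw [← ENNReal.ofReal_toReal hfin, ENNReal.ofReal_le_ofReal_iff ENNReal.toReal_nonneg] at h1
  rw [div_lt_iff₀ hpos] at hn
  linarith

theorem integrableOn_pair_field {lam : Measure Lifted} {F : Lifted → Lifted}
    (hF : Integrable F lam) {K : Set Lifted} (hK : IsCompact K) {φx : Lifted → Plane}
    {φs : Lifted → ℝ} (hx : ContinuousOn φx K) (hs : ContinuousOn φs K) :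
    IntegrableOn (fun p => pair (φx p, φs p) (F p)) K lam := by
  have hxi : ∀ i : Fin 2, ContinuousOn (fun p => φx p i) K := fun i =>
    (EuclideanSpace.proj (𝕜 := ℝ) i : Plane →L[ℝ] ℝ).continuous.comp_continuousOn hx
  exact (((integrableOn_mul_pair hF (ex 0) hK (hxi 0)).add
    (integrableOn_mul_pair hF (ex 1) hK (hxi 1))).add (integrableOn_mul_pair hF es hK hs)).congr
    (Eventually.of_forall fun p => (pair_eq_sum (φx p, φs p) (F p)).symm)

theorem flux_le_of_norm_le {lam : Measure Lifted} {F : Lifted → Lifted}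
    (hF : Integrable F lam) {K : Set Lifted} (hK : IsCompact K) {φx : Lifted → Plane}
    {φs : Lifted → ℝ} (hx : ContinuousOn φx K) (hs : ContinuousOn φs K) {α : ℝ}
    (hα : ∀ p ∈ K, ‖φx p‖ ≤ α) (h0 : ∀ p ∈ K, 0 ≤ φs p)
    (hneg : ∀ᵐ p ∂(lam.restrict K), (F p).2 ≤ 0) :
    flux K lam F φx φs ≤ α * ∫ p in K, ‖(F p).1‖ ∂lam := by
  rw [← integral_const_mul]
  refine integral_mono_ae (integrableOn_pair_field hF hK hx hs)
    (hF.fst.norm.integrableOn.const_mul α) ?_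
  filter_upwards [hneg, ae_restrict_mem hK.measurableSet] with p hp hpK
  have h1 := real_inner_le_norm (φx p) (F p).1
  have h2 := mul_le_mul_of_nonneg_right (hα p hpK) (norm_nonneg (F p).1)
  have h3 := mul_nonpos_of_nonneg_of_nonpos (h0 p hpK) hp
  simp only [pair]
  linarith

theorem norm_le_of_memK_linear {Ω : Set Plane} {M : ℝ} {τ : ℝ → ℝ} {α : ℝ}
    (hα : ∀ s, 0 ≤ s → τ s = α * s) (hα0 : 0 ≤ α) {φx : Lifted → Plane} {φs : Lifted → ℝ}
    (h : MemK Ω M τ φx φs) {p : Lifted} (hp : p ∈ cylinder Ω M) : ‖φx p‖ ≤ α := by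
  have h1 := h.bound p hp
  rwa [rightDerivZero_of_linear hα, ← ofReal_norm, ENNReal.ofReal_le_ofReal_iff hα0] at h1

/-- If the cost of `v` is finite, its vertical derivative is nonpositive on the cylinder and the
cost is at least `α` times the horizontal variation. Almost every level inherits the sign, so its
cost is at most `α` times its own horizontal variation, and coarea bounds the average of these. -/
theorem lintegral_superlevel_le_of_linear {Ω : Set Plane} (hΩb : Bornology.IsBounded Ω)
    {γ : ℝ → Plane} {L : ℝ} {τ : ℝ → ℝ} (hτ : IsTransportationCost τ)
    {μp μm : Measure Plane} {v : Lifted → ℝ} (h : MemC Ω γ L μp μm v) {α : ℝ}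
    (hα : ∀ s, 0 ≤ s → τ s = α * s) :
    ∫⁻ t in Ioo (0 : ℝ) 1, convexCost Ω (maxValue γ L μp μm) τ (superlevel v t)
      ≤ convexCost Ω (maxValue γ L μp μm) τ v := by
  obtain ⟨v', lam, F, lam', F', hv', hvv, hC, hF, hF'⟩ := h.exists_data hΩb
  set M := maxValue γ L μp μm
  have hα0 : 0 ≤ α := by simpa [hα 1 zero_le_one] using hτ.nonneg 1 zero_le_one
  have hcyl := isCompact_cylinder hΩb M
  have hcU := cylinder_subset_liftedDomain Ω M
  have hfin := hF.finite
  rw [convexCost_congr hvv, convexCost_eq hΩb hF (hv'.locallyIntegrable.locallyIntegrableOn _)]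
  by_cases htop : ⨆ (φx : Lifted → Plane) (φs : Lifted → ℝ) (_ : MemK Ω M τ φx φs),
      ENNReal.ofReal (flux (cylinder Ω M) lam F φx φs) = ⊤
  · rw [htop]; exact le_top
  have hneg := ae_snd_nonpos_of_cost_ne_top hτ hF.integrable htop
  have hlow : ENNReal.ofReal α * ∫⁻ p in cylinder Ω M, ‖(F p).1‖ₑ ∂lam
      ≤ ⨆ (φx : Lifted → Plane) (φs : Lifted → ℝ) (_ : MemK Ω M τ φx φs),
      ENNReal.ofReal (flux (cylinder Ω M) lam F φx φs) := by
    rw [← ofReal_integral_norm_eq_lintegral_enorm hF.integrable.fst.integrableOn,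
      ← ENNReal.ofReal_mul hα0]
    refine ENNReal.ofReal_le_of_le_toReal ?_
    rcases hα0.eq_or_lt with h0 | h0
    · rw [← h0, zero_mul]; exact ENNReal.toReal_nonneg
    rw [mul_comm, ← le_div_iff₀ h0]
    refine setIntegral_pair_ge hF.integrable fun c hc hc1 => ?_
    rw [le_div_iff₀ h0, mul_comm, ← integral_const_mul, ← ENNReal.ofReal_le_iff_le_toReal htop]
    have hmem : MemK Ω M τ (fun p => α • c p) (fun _ => 0) := memK_of_linear hα
      (hc.const_smul α).continuousOn continuousOn_const (fun p _ => by
        rw [norm_smul, Real.norm_eq_abs, abs_of_pos h0]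
        exact mul_le_of_le_one_right h0.le (hc1 p)) fun _ _ => le_rfl
    refine le_iSup_of_le _ (le_iSup_of_le _ (le_iSup_of_le hmem ?_))
    rw [flux_horizontal]
    simp only [real_inner_smul_left]
    exact le_rfl
  refine le_trans ?_ hlow
  have hes : es ∈ ({ex 0, ex 1, es} : Set Lifted) := by simp
  -- Coarea gives that the average of `∫ |∂ₛ χ_{v>t}|` is at most `∫ |∂ₛ v| = -∫ ∂ₛ v`, which is
  -- minus the average of `∫ ∂ₛ χ_{v>t}`. So the nonnegative quantity `∫ (|∂ₛ χ_{v>t}| + ∂ₛ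
  -- χ_{v>t})` vanishes for almost every `t`.
  have hnegt : ∀ᵐ t ∂(volume.restrict (Ioo (0 : ℝ) 1)),
      ∀ᵐ p ∂((lam' t).restrict (cylinder Ω M)), (F' t p).2 ≤ 0 := by
    obtain ⟨m, hm, hm1, hm2⟩ := hF'.exists_coarea hv' hF hcyl hcU (Measure.dirac es)
      ((ae_dirac_iff (measurableSet_le measurable_norm measurable_const)).2 norm_es.le)
    simp only [lintegral_dirac_es] at hm1 hm2
    obtain ⟨hi, he⟩ := hF'.integral_setIntegral hv' hF hcyl hcU (φ := fun _ => 1)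
      continuousOn_const hes
    have hpe : ∀ f : Lifted, 1 * pair es f = f.2 := fun f => by simp [pair, es]
    simp only [hpe] at hi he
    have hmfin : ∫⁻ t in Ioo (0 : ℝ) 1, m t ≠ ⊤ :=
      (hm2.trans_lt ((setLIntegral_le_lintegral _ _).trans_lt hF.integrable.snd.2)).ne
    have hmi : IntegrableOn (fun t => (m t).toReal) (Ioo (0 : ℝ) 1) :=
      integrable_toReal_of_lintegral_ne_top hm.aemeasurable hmfin
    have hmt : ∀ᵐ t ∂(volume.restrict (Ioo (0 : ℝ) 1)), ∫ p in cylinder Ω M, |(F' t p).2| ∂lam' t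
        ≤ (m t).toReal := by
      filter_upwards [hm1, ae_lt_top hm hmfin, hF'.hasGrad] with t h1 h2 h3
      rw [← ofReal_integral_norm_eq_lintegral_enorm h3.integrable.snd.integrableOn] at h1
      exact (ENNReal.ofReal_le_iff_le_toReal h2.ne).1 h1
    have hnn : 0 ≤ᵐ[volume.restrict (Ioo (0 : ℝ) 1)]
        fun t => (m t).toReal + ∫ p in cylinder Ω M, (F' t p).2 ∂lam' t := by
      filter_upwards [hmt] with t ht
      have := neg_abs_le (∫ p in cylinder Ω M, (F' t p).2 ∂lam' t)
      have h2 := abs_integral_le_integral_abs (μ := (lam' t).restrict (cylinder Ω M))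
        (f := fun p => (F' t p).2)
      simp only [Pi.zero_apply]
      linarith
    have hle0 : ∫ t in Ioo (0 : ℝ) 1, ((m t).toReal + ∫ p in cylinder Ω M, (F' t p).2 ∂lam' t)
        ≤ 0 := by
      rw [integral_add hmi hi, he, integral_toReal hm.aemeasurable (ae_lt_top hm hmfin)]
      have h1 : (∫⁻ t in Ioo (0 : ℝ) 1, m t).toReal ≤ ∫ p in cylinder Ω M, |(F p).2| ∂lam := by
        refine ENNReal.toReal_le_of_le_ofReal (integral_nonneg fun p => abs_nonneg _) ?_
        rw [← ofReal_integral_norm_eq_lintegral_enorm hF.integrable.snd.integrableOn] at hm2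
        exact hm2
      have h2 : ∫ p in cylinder Ω M, |(F p).2| ∂lam = -∫ p in cylinder Ω M, (F p).2 ∂lam := by
        rw [← integral_neg]
        refine integral_congr_ae ?_
        filter_upwards [hneg] with p hp
        rw [abs_of_nonpos hp]
      linarith
    have hz := (integral_eq_zero_iff_of_nonneg_ae hnn (hmi.add hi)).1
      (le_antisymm hle0 (integral_nonneg_of_ae hnn))
    filter_upwards [hz, hmt, hF'.hasGrad] with t h1 h2 h3
    have h4 : (m t).toReal + ∫ p in cylinder Ω M, (F' t p).2 ∂lam' t = 0 := h1
    have hi3 : IntegrableOn (fun p => (F' t p).2) (cylinder Ω M) (lam' t) :=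
      h3.integrable.snd.integrableOn
    have h5 : ∫ p in cylinder Ω M, (|(F' t p).2| + (F' t p).2) ∂lam' t ≤ 0 := by
      rw [integral_add hi3.abs hi3]
      linarith
    have hnn' : ∀ p, 0 ≤ |(F' t p).2| + (F' t p).2 := fun p => by
      linarith [neg_abs_le (F' t p).2]
    have h6 := (integral_eq_zero_iff_of_nonneg hnn' (hi3.abs.add hi3)).1
      (le_antisymm h5 (integral_nonneg hnn'))
    filter_upwards [h6] with p hp
    have : |(F' t p).2| + (F' t p).2 = 0 := hp
    linarith [abs_nonneg (F' t p).2]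
  obtain ⟨m, hm, hm1, hm2⟩ := hF'.exists_coarea hv' hF hcyl hcU discDirections ae_discDirections
  simp only [lintegral_discDirections] at hm1 hm2
  set κ := ∫⁻ x in Metric.ball (0 : Plane) 1, ‖x 0‖ₑ with hκ
  have hκ0 : κ ≠ 0 := lintegral_ball_ne_zero
  have hκt : κ ≠ ⊤ := lintegral_ball_ne_top
  -- Here `κ` is the normalizing constant of the disc average, finite and nonzero.
  have hup : ∀ᵐ t ∂(volume.restrict (Ioo (0 : ℝ) 1)), convexCost Ω M τ (superlevel v t)
      ≤ ENNReal.ofReal α * (κ⁻¹ * m t) := by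
    filter_upwards [hF'.hasGrad, ae_restrict_mem measurableSet_Ioo, hnegt, hm1] with t ht ht1 h2 h3
    rw [convexCost_congr (superlevel_congr hvv t),
      convexCost_eq hΩb ht ((hv'.superlevel ht1).locallyIntegrable.locallyIntegrableOn _)]
    rw [lintegral_const_mul' _ _ hκt] at h3
    have h4 : ∫⁻ p in cylinder Ω M, ‖(F' t p).1‖ₑ ∂lam' t ≤ κ⁻¹ * m t := by
      refine le_trans (le_of_eq ?_) (mul_le_mul_right h3 _)
      rw [← mul_assoc, ENNReal.inv_mul_cancel hκ0 hκt, one_mul]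
    refine le_trans ?_ (mul_le_mul_right h4 _)
    refine iSup_le fun φx => iSup_le fun φs => iSup_le fun hφ => ?_
    rw [← ofReal_integral_norm_eq_lintegral_enorm ht.integrable.fst.integrableOn,
      ← ENNReal.ofReal_mul hα0]
    refine ENNReal.ofReal_le_ofReal ?_
    exact flux_le_of_norm_le ht.integrable hcyl hφ.continuous_x hφ.continuous_s
      (fun p hp => norm_le_of_memK_linear hα hα0 hφ hp) hφ.nonneg h2
  refine (lintegral_mono_ae hup).trans ?_
  rw [lintegral_const_mul' _ _ ENNReal.ofReal_ne_top, lintegral_const_mul' _ _ (by simp [hκ0])]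
  gcongr
  rw [lintegral_const_mul' _ _ hκt] at hm2
  refine (mul_le_mul_right hm2 _).trans (le_of_eq ?_)
  rw [← mul_assoc, ENNReal.inv_mul_cancel hκ0 hκt, one_mul]

/-! ### Segments crossing a convex set -/

theorem isClosed_exists_mem_Icc {X : Type*} [TopologicalSpace X] {C : Set (X × ℝ)}
    (hC : IsClosed C) (a b : ℝ) : IsClosed {x | ∃ s ∈ Icc a b, (x, s) ∈ C} := by
  have h1 : IsClosed {q : X × Icc a b | (q.1, (q.2 : ℝ)) ∈ C} :=
    hC.preimage (by fun_prop)
  have h2 := isClosedMap_fst_of_compactSpace _ h1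
  convert h2 using 1
  ext x
  constructor
  · rintro ⟨s, hs, hx⟩
    exact ⟨(x, ⟨s, hs⟩), hx, rfl⟩
  · rintro ⟨⟨y, s⟩, hy, rfl⟩
    exact ⟨s, s.2, hy⟩

/-- The points `x` such that the segment from `x` to `x + h e` meets `N` but does not have both
endpoints in `N`. -/
def crossing (N : Set Plane) (e : Plane) (h : ℝ) : Set Plane :=
  {x | (∃ s ∈ Icc 0 h, x + s • e ∈ N) ∧ ¬(x ∈ N ∧ x + h • e ∈ N)}

theorem isClosed_hitting {N : Set Plane} (hN : IsClosed N) (e : Plane) (h : ℝ) :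
    IsClosed {x | ∃ s ∈ Icc 0 h, x + s • e ∈ N} :=
  isClosed_exists_mem_Icc (C := {q : Plane × ℝ | q.1 + q.2 • e ∈ N})
    (hN.preimage (by fun_prop)) 0 h

theorem measurableSet_crossing {N : Set Plane} (hN : IsClosed N) (e : Plane) (h : ℝ) :
    MeasurableSet (crossing N e h) := by
  refine (isClosed_hitting hN e h).measurableSet.inter (MeasurableSet.compl ?_)
  exact hN.measurableSet.inter (hN.measurableSet.preimage (measurable_add_const _))

/-- A line meets a convex set in an interval. Crossing segments start either within `h` before the
interval (`B₁`) or within its last stretch of length `h` (`B₂`). -/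
theorem volume_line_crossing_le {N : Set Plane} (hN : Convex ℝ N) (e x : Plane) {h : ℝ}
    (hh : 0 ≤ h) : volume {s : ℝ | x + s • e ∈ crossing N e h} ≤ ENNReal.ofReal (2 * h) := by
  set A : Set ℝ := {s | x + s • e ∈ N} with hA
  have hAc : ∀ a ∈ A, ∀ b ∈ A, ∀ y, a ≤ y → y ≤ b → y ∈ A := by
    intro a ha b hb y hay hyb
    rcases hay.eq_or_lt with rfl | hay
    · exact ha
    have hab : a < b := hay.trans_le hyb
    have := hN ha hb (a := (b - y) / (b - a)) (b := (y - a) / (b - a))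
      (div_nonneg (by linarith) (by linarith)) (div_nonneg (by linarith) (by linarith))
      (by rw [← add_div, div_eq_one_iff_eq (by linarith)]; ring)
    simp only [hA, mem_ofPred_eq]
    convert this using 1
    have hne : b - a ≠ 0 := by linarith
    have h1 : (b - y) / (b - a) + (y - a) / (b - a) = 1 := by
      rw [← add_div, div_eq_one_iff_eq (by linarith)]; ring
    have h2 : (b - y) / (b - a) * a + (y - a) / (b - a) * b = y := by
      field_simp; ring
    rw [smul_add, smul_add, smul_smul, smul_smul, add_add_add_comm, ← add_smul, ← add_smul, h1, h2,
      one_smul]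
  set B₁ : Set ℝ := {s | s ∉ A ∧ ∃ r ∈ Icc 0 h, s + r ∈ A}
  set B₂ : Set ℝ := {s | s ∈ A ∧ s + h ∉ A}
  have hsub : {s : ℝ | x + s • e ∈ crossing N e h} ⊆ B₁ ∪ B₂ := by
    rintro s ⟨⟨r, hr, h1⟩, h2⟩
    have h3 : ∀ r : ℝ, x + s • e + r • e = x + (s + r) • e := fun r => by
      rw [add_assoc, ← add_smul]
    rw [h3] at h1 h2
    by_cases hs : s ∈ A
    · exact Or.inr ⟨hs, fun h4 => h2 ⟨hs, h4⟩⟩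
    · exact Or.inl ⟨hs, r, hr, h1⟩
  have hd₁ : volume B₁ ≤ ENNReal.ofReal h := by
    refine (Real.volume_le_diam _).trans (Metric.ediam_le fun s hs s' hs' => ?_)
    wlog hss : s ≤ s' generalizing s s'
    · rw [edist_comm]; exact this s' hs' s hs (le_of_not_ge hss)
    rw [edist_dist, Real.dist_eq, abs_sub_comm, abs_of_nonneg (sub_nonneg.2 hss)]
    refine ENNReal.ofReal_le_ofReal ?_
    by_contra! hlt
    obtain ⟨-, r, hr, h1⟩ := hs
    obtain ⟨h2, r', hr', h3⟩ := hs'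
    exact h2 (hAc _ h1 _ h3 _ (by linarith [hr.2]) (by linarith [hr'.1]))
  have hd₂ : volume B₂ ≤ ENNReal.ofReal h := by
    refine (Real.volume_le_diam _).trans (Metric.ediam_le fun s hs s' hs' => ?_)
    wlog hss : s ≤ s' generalizing s s'
    · rw [edist_comm]; exact this s' hs' s hs (le_of_not_ge hss)
    rw [edist_dist, Real.dist_eq, abs_sub_comm, abs_of_nonneg (sub_nonneg.2 hss)]
    refine ENNReal.ofReal_le_ofReal ?_
    by_contra! hlt
    exact hs.2 (hAc _ hs.1 _ hs'.1 _ (by linarith) (by linarith))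
  refine (measure_mono hsub).trans ((measure_union_le _ _).trans ?_)
  rw [two_mul, ENNReal.ofReal_add hh hh]
  exact add_le_add hd₁ hd₂

/-- Translation by `s • e` preserves the volume; averaging over `s ∈ [0, 1]` and exchanging the
integrals reduces the claim to lines in direction `e`. The translations enlarge the ball from radius
`R` to `R + 1`. -/
theorem volume_crossing_le {N : Set Plane} (hN : Convex ℝ N) (hNc : IsClosed N) {e : Plane}
    (he : ‖e‖ ≤ 1) {h : ℝ} (hh : 0 ≤ h) (R : ℝ) :
    volume (crossing N e h ∩ Metric.ball 0 R)
      ≤ ENNReal.ofReal (2 * h) * volume (Metric.ball (0 : Plane) (R + 1)) := by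
  set A := crossing N e h ∩ Metric.ball 0 R with hA
  have hAm : MeasurableSet A := (measurableSet_crossing hNc e h).inter Metric.isOpen_ball.measurableSet
  have h1 : ∀ s : ℝ, ∫⁻ x, A.indicator (fun _ => (1 : ℝ≥0∞)) (x + s • e) = volume A := fun s => by
    rw [lintegral_add_right_eq_self (fun x => A.indicator (fun _ => (1 : ℝ≥0∞)) x)]
    rw [lintegral_indicator hAm, setLIntegral_const, one_mul]
  have h2 : volume A = ∫⁻ s in Icc (0 : ℝ) 1, ∫⁻ x, A.indicator (fun _ => (1 : ℝ≥0∞)) (x + s • e) := by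
    rw [lintegral_congr h1, setLIntegral_const]
    simp
  have hmq : Measurable fun q : ℝ × Plane => q.2 + q.1 • e :=
    (by fun_prop : Continuous fun q : ℝ × Plane => q.2 + q.1 • e).measurable
  have hm : Measurable fun q : ℝ × Plane => A.indicator (fun _ => (1 : ℝ≥0∞)) (q.2 + q.1 • e) :=
    (measurable_const.indicator hAm).comp hmq
  rw [h2, lintegral_lintegral_swap hm.aemeasurable]
  have h3 : ∀ x, ∫⁻ s in Icc (0 : ℝ) 1, A.indicator (fun _ => (1 : ℝ≥0∞)) (x + s • e)
      ≤ (Metric.ball (0 : Plane) (R + 1)).indicator (fun _ => ENNReal.ofReal (2 * h)) x := by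
    intro x
    by_cases hx : x ∈ Metric.ball (0 : Plane) (R + 1)
    · rw [indicator_of_mem hx]
      have hms : MeasurableSet {s : ℝ | x + s • e ∈ A} :=
        hAm.preimage (by fun_prop : Measurable fun s : ℝ => x + s • e)
      have h4 : (fun s : ℝ => A.indicator (fun _ => (1 : ℝ≥0∞)) (x + s • e))
          = {s : ℝ | x + s • e ∈ A}.indicator fun _ => 1 := by
        funext s
        by_cases hs : x + s • e ∈ A
        · rw [indicator_of_mem hs, indicator_of_mem (show s ∈ {s : ℝ | x + s • e ∈ A} from hs)]
        · rw [indicator_of_notMem hs,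
            indicator_of_notMem (show s ∉ {s : ℝ | x + s • e ∈ A} from hs)]
      rw [h4]
      refine (setLIntegral_le_lintegral _ _).trans ?_
      rw [lintegral_indicator hms, setLIntegral_const, one_mul]
      exact (measure_mono fun s hs => hs.1).trans (volume_line_crossing_le hN e x hh)
    · rw [indicator_of_notMem hx, nonpos_iff_eq_zero]
      refine setLIntegral_eq_zero measurableSet_Icc fun s hs => ?_
      have : x + s • e ∉ A := fun h5 => hx (by
        have h6 : ‖x + s • e‖ < R := by simpa using h5.2
        have h7 : ‖s • e‖ ≤ 1 := by
          rw [norm_smul, Real.norm_eq_abs, abs_of_nonneg hs.1]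
          exact mul_le_one₀ hs.2 (norm_nonneg _) he
        have h8 : ‖x‖ ≤ ‖x + s • e‖ + ‖s • e‖ := by
          simpa using norm_sub_le (x + s • e) (s • e)
        simp only [Metric.mem_ball, dist_zero_right]
        linarith)
      simp [this]
  refine (lintegral_mono h3).trans_eq ?_
  rw [lintegral_indicator Metric.isOpen_ball.measurableSet, setLIntegral_const]

/-! ### Nearest point projection and boundary parameter -/

/-- The point of a closed convex set nearest to `x`. -/
noncomputable def nearest (S : Set Plane) (x : Plane) : Plane :=
  Classical.epsilon fun y => y ∈ S ∧ ∀ w ∈ S, inner ℝ (x - y) (w - y) ≤ 0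

theorem nearest_spec {S : Set Plane} (hSc : IsClosed S) (hSv : Convex ℝ S) (hSn : S.Nonempty)
    (x : Plane) :
    nearest S x ∈ S ∧ ∀ w ∈ S, inner ℝ (x - nearest S x) (w - nearest S x) ≤ 0 := by
  refine Classical.epsilon_spec (p := fun y => y ∈ S ∧ ∀ w ∈ S, inner ℝ (x - y) (w - y) ≤ 0) ?_
  obtain ⟨y, hy, h⟩ := exists_norm_eq_iInf_of_complete_convex hSn hSc.isComplete hSv x
  exact ⟨y, hy, (norm_eq_iInf_iff_real_inner_le_zero hSv hy).1 h⟩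

theorem nearest_unique {S : Set Plane} (hSc : IsClosed S) (hSv : Convex ℝ S) (hSn : S.Nonempty)
    {x y : Plane} (hy : y ∈ S) (h : ∀ w ∈ S, inner ℝ (x - y) (w - y) ≤ 0) : nearest S x = y := by
  obtain ⟨h1, h2⟩ := nearest_spec hSc hSv hSn x
  have h3 := h _ h1
  have h4 := h2 _ hy
  have h5 : inner ℝ (nearest S x - y) (nearest S x - y) ≤ 0 := by
    have h6 : inner ℝ (nearest S x - y) (nearest S x - y)
        = inner ℝ (x - y) (nearest S x - y) + inner ℝ (x - nearest S x) (y - nearest S x) := by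
      have : x - nearest S x = (x - y) - (nearest S x - y) := by abel
      rw [this, ← neg_sub (nearest S x) y, inner_neg_right, inner_sub_left (x - y)]
      ring
    rw [h6]; linarith
  rw [real_inner_self_nonpos] at h5
  exact sub_eq_zero.1 h5

theorem nearest_eq_self {S : Set Plane} (hSc : IsClosed S) (hSv : Convex ℝ S) {x : Plane}
    (hx : x ∈ S) : nearest S x = x :=
  nearest_unique hSc hSv ⟨x, hx⟩ hx (by simp)

theorem lipschitzWith_nearest {S : Set Plane} (hSc : IsClosed S) (hSv : Convex ℝ S)
    (hSn : S.Nonempty) : LipschitzWith 1 (nearest S) := by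
  refine LipschitzWith.of_dist_le_mul fun x y => ?_
  obtain ⟨h1, h2⟩ := nearest_spec hSc hSv hSn x
  obtain ⟨h3, h4⟩ := nearest_spec hSc hSv hSn y
  set a := nearest S x
  set b := nearest S y
  have h5 := h2 b h3
  have h6 := h4 a h1
  have h7 : ‖a - b‖ ^ 2 ≤ inner ℝ (x - y) (a - b) := by
    rw [← real_inner_self_eq_norm_sq]
    have e1 : inner ℝ (x - a) (b - a) + inner ℝ (y - b) (a - b)
        = inner ℝ (a - b) (a - b) - inner ℝ (x - y) (a - b) := by
      rw [← neg_sub a b, inner_neg_right, ← sub_eq_neg_add, ← inner_sub_left, ← inner_sub_left]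
      congr 1
      abel
    linarith
  have h8 := h7.trans (real_inner_le_norm _ _)
  rw [dist_eq_norm, dist_eq_norm, NNReal.coe_one, one_mul]
  rcases (norm_nonneg (a - b)).eq_or_lt with h9 | h9
  · rw [← h9]; exact norm_nonneg _
  · nlinarith

/-- The fiber is the normal cone at `z`, translated to `z`. Its convexity makes the crossing
estimate applicable to fibers. -/
theorem nearest_fiber_eq {S : Set Plane} (hSc : IsClosed S) (hSv : Convex ℝ S)
    {z : Plane} (hz : z ∈ S) :
    nearest S ⁻¹' {z} = {x | ∀ w ∈ S, inner ℝ (x - z) (w - z) ≤ 0} := by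
  ext x
  simp only [mem_preimage, mem_singleton_iff, mem_ofPred_eq]
  constructor
  · rintro rfl
    exact (nearest_spec hSc hSv ⟨_, hz⟩ x).2
  · exact nearest_unique hSc hSv ⟨_, hz⟩ hz

theorem convex_nearest_fiber {S : Set Plane} (hSc : IsClosed S) (hSv : Convex ℝ S)
    {z : Plane} (hz : z ∈ S) : Convex ℝ (nearest S ⁻¹' {z}) := by
  rw [nearest_fiber_eq hSc hSv hz]
  intro x hx y hy a b ha hb hab w hw
  have h1 : a • x + b • y - z = a • (x - z) + b • (y - z) := by
    rw [smul_sub, smul_sub, sub_add_sub_comm, ← add_smul, hab, one_smul]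
  rw [h1, inner_add_left, real_inner_smul_left, real_inner_smul_left]
  have := mul_nonpos_of_nonneg_of_nonpos ha (hx w hw)
  have := mul_nonpos_of_nonneg_of_nonpos hb (hy w hw)
  linarith

theorem dist_nearest_sq_add_le {S : Set Plane} (hSc : IsClosed S) (hSv : Convex ℝ S)
    (x : Plane) {w : Plane} (hw : w ∈ S) :
    dist x (nearest S x) ^ 2 + dist w (nearest S x) ^ 2 ≤ dist x w ^ 2 := by
  obtain ⟨-, h2⟩ := nearest_spec hSc hSv ⟨_, hw⟩ x
  have h3 := h2 w hw
  have : x - w = (x - nearest S x) - (w - nearest S x) := by abel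
  rw [dist_eq_norm x w, this, norm_sub_sq_real, dist_eq_norm, dist_eq_norm]
  linarith

theorem HasUnitSpeedOn.lipschitzOnWith {γ : ℝ → Plane} {s : Set ℝ}
    (h : HasUnitSpeedOn γ s) : LipschitzOnWith 1 γ s := by
  intro x hx y hy
  wlog hxy : x ≤ y generalizing x y
  · rw [edist_comm, edist_comm x]
    exact this hy hx (le_of_not_ge hxy)
  have h1 := h hx hy
  have h2 := eVariationOn.edist_le γ (s := s ∩ Icc x y) ⟨hx, left_mem_Icc.2 hxy⟩
    ⟨hy, right_mem_Icc.2 hxy⟩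
  rw [h1] at h2
  refine h2.trans (le_of_eq ?_)
  rw [edist_comm, edist_dist, Real.dist_eq, abs_of_nonneg (sub_nonneg.2 hxy)]
  simp

theorem nearest_mem_frontier {Ω : Set Plane} (hΩo : IsOpen Ω) (hΩc : Convex ℝ Ω)
    (hΩn : Ω.Nonempty) {x : Plane} (hx : x ∉ closure Ω) :
    nearest (closure Ω) x ∈ frontier Ω := by
  obtain ⟨h1, h2⟩ := nearest_spec isClosed_closure hΩc.closure hΩn.closure x
  rw [hΩo.frontier_eq]
  refine ⟨h1, fun h3 => hx ?_⟩
  set y := nearest (closure Ω) x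
  have hcont : Continuous fun ε : ℝ => y + ε • (x - y) := by fun_prop
  have hev : ∀ᶠ ε : ℝ in 𝓝[>] 0, y + ε • (x - y) ∈ Ω := by
    refine (hcont.continuousAt.eventually_mem (hΩo.mem_nhds ?_)).filter_mono nhdsWithin_le_nhds
    simpa using h3
  obtain ⟨ε, hε, hε0⟩ := (hev.and self_mem_nhdsWithin).exists
  have h4 := h2 _ (subset_closure hε)
  rw [add_sub_cancel_left, real_inner_smul_right] at h4
  have h5 : inner ℝ (x - y) (x - y) ≤ 0 := nonpos_of_mul_nonpos_right h4 hε0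
  rw [real_inner_self_nonpos, sub_eq_zero] at h5
  rwa [h5]

theorem infDist_frontier {Ω : Set Plane} (hΩo : IsOpen Ω) (hΩc : Convex ℝ Ω)
    (hΩn : Ω.Nonempty) {x : Plane} (hx : x ∉ closure Ω) :
    Metric.infDist x (frontier Ω) = dist x (nearest (closure Ω) x) := by
  have h1 := nearest_mem_frontier hΩo hΩc hΩn hx
  refine le_antisymm (Metric.infDist_le_dist_of_mem h1) ?_
  refine (Metric.le_infDist ⟨_, h1⟩).2 fun w hw => ?_
  have h2 := dist_nearest_sq_add_le isClosed_closure hΩc.closure x (frontier_subset_closure hw)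
  refine abs_le_of_sq_le_sq' (?_ : dist x (nearest (closure Ω) x) ^ 2 ≤ dist x w ^ 2)
    dist_nonneg |>.2
  nlinarith [sq_nonneg (dist w (nearest (closure Ω) x))]

/-- Uniqueness of the nearest point and injectivity of `γ` make the set in `boundaryParam` a
singleton, so its infimum is a true parameter. -/
theorem IsArclengthParam.boundaryParam_spec {Ω : Set Plane} (hΩo : IsOpen Ω) (hΩc : Convex ℝ Ω)
    (hΩn : Ω.Nonempty) {γ : ℝ → Plane} {L : ℝ} (hγ : IsArclengthParam Ω γ L) {x : Plane}
    (hx : x ∉ closure Ω) :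
    boundaryParam Ω γ L x ∈ Ico 0 L ∧ γ (boundaryParam Ω γ L x) = nearest (closure Ω) x := by
  obtain ⟨t, ht, hte⟩ := hγ.bijOn.surjOn (nearest_mem_frontier hΩo hΩc hΩn hx)
  have : {t | t ∈ Ico 0 L ∧ dist x (γ t) = Metric.infDist x (frontier Ω)} = {t} := by
    ext r
    simp only [mem_ofPred_eq, mem_singleton_iff]
    rw [infDist_frontier hΩo hΩc hΩn hx]
    constructor
    · rintro ⟨h1, h2⟩
      refine hγ.bijOn.injOn h1 ht ?_
      have h3 := dist_nearest_sq_add_le isClosed_closure hΩc.closure x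
        (frontier_subset_closure (hγ.bijOn.mapsTo h1))
      rw [h2] at h3
      have h4 : dist (γ r) (nearest (closure Ω) x) = 0 := by
        have := sq_nonneg (dist (γ r) (nearest (closure Ω) x))
        exact pow_eq_zero_iff two_ne_zero |>.1 (le_antisymm (by linarith) this)
      rw [hte]
      exact dist_eq_zero.1 h4
    · rintro rfl
      exact ⟨ht, by rw [hte]⟩
  rw [boundaryParam, this, csInf_singleton]
  exact ⟨ht, hte⟩

theorem IsArclengthParam.isCompact_image {Ω : Set Plane} {γ : ℝ → Plane} {L : ℝ}
    (hγ : IsArclengthParam Ω γ L) {a b : ℝ} (ha : 0 ≤ a) (hb : b ≤ L) :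
    IsCompact (γ '' Icc a b) :=
  isCompact_Icc.image_of_continuousOn
    ((HasUnitSpeedOn.lipschitzOnWith hγ.unitSpeed).continuousOn.mono (Icc_subset_Icc ha hb))

theorem IsArclengthParam.measurableSet_image {Ω : Set Plane} {γ : ℝ → Plane} {L : ℝ}
    (hγ : IsArclengthParam Ω γ L) {b : ℝ} (hb : b ≤ L) :
    MeasurableSet (γ '' Ico 0 b) := by
  have : Ico 0 b = ⋃ n : ℕ, Icc 0 (b - ((n : ℝ) + 1)⁻¹) := by
    ext t
    simp only [mem_Ico, mem_iUnion, mem_Icc]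
    constructor
    · rintro ⟨h1, h2⟩
      obtain ⟨n, hn⟩ := (tendsto_natCast_add_one_inv.eventually
        (gt_mem_nhds (sub_pos.2 h2))).exists
      exact ⟨n, h1, by linarith⟩
    · rintro ⟨n, h1, h2⟩
      have : (0 : ℝ) < ((n : ℝ) + 1)⁻¹ := by positivity
      exact ⟨h1, by linarith⟩
  rw [this, image_iUnion]
  refine MeasurableSet.iUnion fun n => (hγ.isCompact_image le_rfl ?_).measurableSet
  have : (0 : ℝ) < ((n : ℝ) + 1)⁻¹ := by positivity
  linarith

/-- The projections of the points of the segment form a connected set covered by the closed arcs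
`γ([0, t])` and `γ([t, L])` and meeting both. So some projection lies in both arcs, hence is `γ t`
or, because the curve closes up, `γ 0`. The two ends project to different points, so they do not
both lie in that fiber. -/
theorem IsArclengthParam.mem_crossing {Ω : Set Plane} (hΩo : IsOpen Ω) (hΩc : Convex ℝ Ω)
    (hΩn : Ω.Nonempty) {γ : ℝ → Plane} {L : ℝ} (hγ : IsArclengthParam Ω γ L) {x e : Plane} {h : ℝ}
    (hh : 0 ≤ h) (hx : ∀ s ∈ Icc 0 h, x + s • e ∉ closure Ω) {t : ℝ} (ht : t ∈ Ico 0 L)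
    (hab : (boundaryParam Ω γ L x ≤ t ∧ t < boundaryParam Ω γ L (x + h • e)) ∨
      (boundaryParam Ω γ L (x + h • e) ≤ t ∧ t < boundaryParam Ω γ L x)) :
    x ∈ crossing (nearest (closure Ω) ⁻¹' {γ t}) e h ∨
      x ∈ crossing (nearest (closure Ω) ⁻¹' {γ 0}) e h := by
  set P := nearest (closure Ω)
  have hPc : Continuous P :=
    (lipschitzWith_nearest isClosed_closure hΩc.closure hΩn.closure).continuous
  have hx0 : x ∉ closure Ω := by simpa using hx 0 (left_mem_Icc.2 hh)
  have hy0 : x + h • e ∉ closure Ω := hx h (right_mem_Icc.2 hh)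
  obtain ⟨ha, hPa⟩ := hγ.boundaryParam_spec hΩo hΩc hΩn hx0
  obtain ⟨hb, hPb⟩ := hγ.boundaryParam_spec hΩo hΩc hΩn hy0
  set a := boundaryParam Ω γ L x
  set b := boundaryParam Ω γ L (x + h • e)
  have hconn : IsPreconnected ((fun s : ℝ => P (x + s • e)) '' Icc 0 h) :=
    isPreconnected_Icc.image _ (hPc.comp (by fun_prop)).continuousOn
  have hA := (hγ.isCompact_image le_rfl ht.2.le).isClosed
  have hB := (hγ.isCompact_image ht.1 le_rfl).isClosed
  have hcov : (fun s : ℝ => P (x + s • e)) '' Icc 0 h ⊆ γ '' Icc 0 t ∪ γ '' Icc t L := by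
    rintro _ ⟨s, hs, rfl⟩
    obtain ⟨r, hr, hre⟩ := hγ.bijOn.surjOn (nearest_mem_frontier hΩo hΩc hΩn (hx s hs))
    rcases le_total r t with h1 | h1
    · exact Or.inl ⟨r, ⟨hr.1, h1⟩, hre⟩
    · exact Or.inr ⟨r, ⟨h1, hr.2.le⟩, hre⟩
  have hmemx : P x ∈ (fun s : ℝ => P (x + s • e)) '' Icc 0 h :=
    ⟨0, left_mem_Icc.2 hh, by simp⟩
  have hmemy : P (x + h • e) ∈ (fun s : ℝ => P (x + s • e)) '' Icc 0 h :=
    ⟨h, right_mem_Icc.2 hh, rfl⟩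
  have hmeet := isPreconnected_closed_iff.1 hconn _ _ hA hB hcov
  have hz : ∃ s ∈ Icc 0 h, P (x + s • e) ∈ γ '' Icc 0 t ∩ γ '' Icc t L := by
    rcases hab with ⟨h1, h2⟩ | ⟨h1, h2⟩
    · obtain ⟨_, ⟨s, hs, rfl⟩, hz⟩ := hmeet ⟨_, hmemx, a, ⟨ha.1, h1⟩, hPa⟩
        ⟨_, hmemy, b, ⟨h2.le, hb.2.le⟩, hPb⟩
      exact ⟨s, hs, hz⟩
    · obtain ⟨_, ⟨s, hs, rfl⟩, hz⟩ := hmeet ⟨_, hmemy, b, ⟨hb.1, h1⟩, hPb⟩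
        ⟨_, hmemx, a, ⟨h2.le, ha.2.le⟩, hPa⟩
      exact ⟨s, hs, hz⟩
  obtain ⟨s, hs, ⟨r, hr, hre⟩, ⟨r', hr', hre'⟩⟩ := hz
  have hnot : ∀ z, ¬(P x = z ∧ P (x + h • e) = z) := fun z ⟨h1, h2⟩ => by
    have h3 : a = b := hγ.bijOn.injOn ha hb (by rw [hPa, hPb]; exact h1.trans h2.symm)
    rcases hab with ⟨h4, h5⟩ | ⟨h4, h5⟩ <;> linarith
  -- The parameter `L` lies outside the injectivity range of `γ`; it is the closing point `γ 0`.
  rcases hr'.2.eq_or_lt with h1 | h1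
  · right
    refine ⟨⟨s, hs, ?_⟩, hnot _⟩
    rw [h1, hγ.closed] at hre'
    exact hre'.symm
  · left
    refine ⟨⟨s, hs, ?_⟩, hnot _⟩
    have h2 : r = r' := hγ.bijOn.injOn ⟨hr.1, hr.2.trans_lt ht.2⟩ ⟨ht.1.trans hr'.1, h1⟩
      (hre.trans hre'.symm)
    have h3 : r = t := le_antisymm hr.2 (h2 ▸ hr'.1)
    rw [← h3]
    exact hre.symm

/-! ### Variation of the boundary image -/

theorem enorm_netMass_sub_le (γ : ℝ → Plane) (μp μm : Measure Plane) [IsFiniteMeasure μp]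
    [IsFiniteMeasure μm] {a b : ℝ} (hab : a ≤ b) :
    ‖netMass γ μp μm b - netMass γ μp μm a‖ₑ ≤ (μp + μm) (γ '' Ico a b) := by
  have key : ∀ μ : Measure Plane, IsFiniteMeasure μ →
      ‖μ.real (γ '' Ico 0 b) - μ.real (γ '' Ico 0 a)‖ₑ ≤ μ (γ '' Ico a b) := by
    intro μ _
    have h1 : γ '' Ico 0 a ⊆ γ '' Ico 0 b := image_mono (Ico_subset_Ico_right hab)
    have h2 : γ '' Ico 0 b \ γ '' Ico 0 a ⊆ γ '' Ico a b := by
      rintro _ ⟨⟨t, ht, rfl⟩, h3⟩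
      refine ⟨t, ⟨?_, ht.2⟩, rfl⟩
      by_contra! h4
      exact h3 ⟨t, ⟨ht.1, h4⟩, rfl⟩
    have h3 := (le_measure_sdiff (μ := μ) (s₁ := γ '' Ico 0 b) (s₂ := γ '' Ico 0 a)).trans
      (measure_mono h2)
    have h4 : 0 ≤ μ.real (γ '' Ico 0 b) - μ.real (γ '' Ico 0 a) :=
      sub_nonneg.2 (measureReal_mono h1)
    rw [Real.enorm_eq_ofReal h4, ENNReal.ofReal_sub _ measureReal_nonneg]
    simpa [Measure.real, ENNReal.ofReal_toReal (measure_ne_top _ _)] using h3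
  have e1 : netMass γ μp μm b - netMass γ μp μm a
      = (μp.real (γ '' Ico 0 b) - μp.real (γ '' Ico 0 a))
        - (μm.real (γ '' Ico 0 b) - μm.real (γ '' Ico 0 a)) := by
    unfold netMass; ring
  rw [e1]
  refine enorm_sub_le.trans ?_
  exact add_le_add (key μp inferInstance) (key μm inferInstance)

theorem measurable_netMass (γ : ℝ → Plane) (μp μm : Measure Plane) [IsFiniteMeasure μp]
    [IsFiniteMeasure μm] : Measurable (netMass γ μp μm) := by
  have key : ∀ μ : Measure Plane, IsFiniteMeasure μ →
      Measurable fun t => μ.real (γ '' Ico 0 t) := fun μ _ =>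
    Monotone.measurable fun a b hab => measureReal_mono (image_mono (Ico_subset_Ico_right hab))
  exact (key μp inferInstance).sub (key μm inferInstance)

/-- An upper bound for the jump of the boundary image along the segment from `x` to `x + h e`. -/
noncomputable def jumpBound (Ω : Set Plane) (γ : ℝ → Plane) (μ : Measure Plane) (e : Plane) (h : ℝ)
    (x : Plane) : ℝ≥0∞ :=
  μ {z | x ∈ crossing (nearest (closure Ω) ⁻¹' {z}) e h} +
    (crossing (nearest (closure Ω) ⁻¹' {γ 0}) e h).indicator (fun _ => μ univ) x

/-- The jump is bounded by the mass on the arc between the two parameters. Either every point of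
this arc has a fiber crossed by the segment, or the fiber over `γ 0` is crossed, and then the total
mass is used as bound. -/
theorem IsArclengthParam.enorm_boundaryImage_sub_le {Ω : Set Plane} (hΩo : IsOpen Ω)
    (hΩc : Convex ℝ Ω)
    (hΩn : Ω.Nonempty) {γ : ℝ → Plane} {L : ℝ} (hγ : IsArclengthParam Ω γ L) (μp μm : Measure Plane)
    [IsFiniteMeasure μp] [IsFiniteMeasure μm] {x e : Plane} {h : ℝ}
    (hh : 0 ≤ h) (hx : ∀ s ∈ Icc 0 h, x + s • e ∉ closure Ω) :
    ‖boundaryImage Ω γ L μp μm (x + h • e) - boundaryImage Ω γ L μp μm x‖ₑ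
      ≤ jumpBound Ω γ (μp + μm) e h x := by
  have hx0 : x ∉ closure Ω := by simpa using hx 0 (left_mem_Icc.2 hh)
  have hy0 : x + h • e ∉ closure Ω := hx h (right_mem_Icc.2 hh)
  obtain ⟨ha, -⟩ := hγ.boundaryParam_spec hΩo hΩc hΩn hx0
  obtain ⟨hb, -⟩ := hγ.boundaryParam_spec hΩo hΩc hΩn hy0
  have hcr := fun t ht => hγ.mem_crossing hΩo hΩc hΩn hh hx (t := t) ht
  unfold boundaryImage
  rw [sub_sub_sub_cancel_right]
  set a := boundaryParam Ω γ L x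
  set b := boundaryParam Ω γ L (x + h • e)
  have hfin : ∀ T : Set Plane, (∀ z ∈ T, x ∈ crossing (nearest (closure Ω) ⁻¹' {z}) e h ∨
      x ∈ crossing (nearest (closure Ω) ⁻¹' {γ 0}) e h) →
      (μp + μm) T ≤ jumpBound Ω γ (μp + μm) e h x := by
    intro T hT
    unfold jumpBound
    by_cases h0 : x ∈ crossing (nearest (closure Ω) ⁻¹' {γ 0}) e h
    · rw [indicator_of_mem h0]
      exact (measure_mono (subset_univ _)).trans le_add_self
    · exact (measure_mono fun z hz => (hT z hz).resolve_right h0).trans le_self_add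
  rcases le_total a b with hab | hab
  · refine (enorm_netMass_sub_le γ μp μm hab).trans (hfin _ ?_)
    rintro _ ⟨t, ht, rfl⟩
    exact hcr t ⟨ha.1.trans ht.1, ht.2.trans hb.2⟩ (Or.inl ht)
  · rw [← enorm_neg, neg_sub]
    refine (enorm_netMass_sub_le γ μp μm hab).trans (hfin _ ?_)
    rintro _ ⟨t, ht, rfl⟩
    exact hcr t ⟨hb.1.trans ht.1, ht.2.trans ha.2⟩ (Or.inr ht)

theorem measurableSet_crossing_fiber {P : Plane → Plane} (hP : Continuous P) (e : Plane) (h : ℝ) :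
    MeasurableSet {q : Plane × Plane | q.1 ∈ crossing (P ⁻¹' {q.2}) e h} := by
  have h1 : IsClosed {q : Plane × Plane | ∃ s ∈ Icc 0 h, P (q.1 + s • e) = q.2} :=
    isClosed_exists_mem_Icc (C := {r : (Plane × Plane) × ℝ | P (r.1.1 + r.2 • e) = r.1.2})
      (isClosed_eq (hP.comp (by fun_prop)) (by fun_prop)) 0 h
  have h2 : IsClosed {q : Plane × Plane | P q.1 = q.2 ∧ P (q.1 + h • e) = q.2} :=
    (isClosed_eq (hP.comp continuous_fst) continuous_snd).inter
      (isClosed_eq (hP.comp (by fun_prop)) continuous_snd)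
  exact h1.measurableSet.inter h2.measurableSet.compl

/-- By Tonelli the first term of `jumpBound` integrates the crossing volumes of the fibers against
`μ`; each is `O(h)` uniformly in the fiber. The term for `γ 0` satisfies the same bound, whence the
factor `2`. -/
theorem lintegral_jumpBound_le {Ω : Set Plane} (hΩc : Convex ℝ Ω)
    (hΩn : Ω.Nonempty) (γ : ℝ → Plane) (μ : Measure Plane)
    [IsFiniteMeasure μ] {e : Plane} (he : ‖e‖ ≤ 1) {h : ℝ} (hh : 0 ≤ h) (R : ℝ) :
    ∫⁻ x in Metric.ball 0 R, jumpBound Ω γ μ e h x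
      ≤ 2 * μ univ * (ENNReal.ofReal (2 * h) * volume (Metric.ball (0 : Plane) (R + 1))) := by
  set P := nearest (closure Ω) with hPdef
  have hPc : Continuous P :=
    (lipschitzWith_nearest isClosed_closure hΩc.closure hΩn.closure).continuous
  set V := ENNReal.ofReal (2 * h) * volume (Metric.ball (0 : Plane) (R + 1))
  have hcross : ∀ z, volume (crossing (P ⁻¹' {z}) e h ∩ Metric.ball 0 R) ≤ V := fun z => by
    have hcl : IsClosed (P ⁻¹' {z}) := isClosed_singleton.preimage hPc
    refine volume_crossing_le ?_ hcl he hh R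
    by_cases hz : z ∈ closure Ω
    · exact convex_nearest_fiber isClosed_closure hΩc.closure hz
    · have : P ⁻¹' {z} = ∅ := by
        rw [eq_empty_iff_forall_notMem]
        rintro x rfl
        exact hz (nearest_spec isClosed_closure hΩc.closure hΩn.closure x).1
      rw [this]
      exact convex_empty
  have hJ := measurableSet_crossing_fiber hPc e h
  have hm1 : Measurable fun x => μ {z | x ∈ crossing (P ⁻¹' {z}) e h} :=
    measurable_measure_prodMk_left hJ
  unfold jumpBound
  rw [← hPdef, lintegral_add_left hm1, two_mul, add_mul]
  refine add_le_add ?_ ?_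
  · have e1 : ∀ x, μ {z | x ∈ crossing (P ⁻¹' {z}) e h}
        = ∫⁻ z, {q : Plane × Plane | q.1 ∈ crossing (P ⁻¹' {q.2}) e h}.indicator
          (fun _ => (1 : ℝ≥0∞)) (x, z) ∂μ := fun x => by
      have : (fun z => {q : Plane × Plane | q.1 ∈ crossing (P ⁻¹' {q.2}) e h}.indicator
          (fun _ => (1 : ℝ≥0∞)) (x, z))
          = {z | x ∈ crossing (P ⁻¹' {z}) e h}.indicator fun _ => 1 := by
        funext z
        rfl
      have hmx : MeasurableSet {z | x ∈ crossing (P ⁻¹' {z}) e h} := measurable_prodMk_left hJ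
      rw [this, lintegral_indicator hmx, setLIntegral_const, one_mul]
    have hJm : Measurable ({q : Plane × Plane | q.1 ∈ crossing (P ⁻¹' {q.2}) e h}.indicator
        fun _ => (1 : ℝ≥0∞)) := measurable_const.indicator hJ
    simp_rw [e1]
    rw [lintegral_lintegral_swap (f := fun x z =>
      {q : Plane × Plane | q.1 ∈ crossing (P ⁻¹' {q.2}) e h}.indicator (fun _ => (1 : ℝ≥0∞)) (x, z))
      hJm.aemeasurable]
    refine (lintegral_mono (g := fun _ => V) fun z => ?_).trans_eq ?_
    · refine le_trans (le_of_eq ?_) (hcross z)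
      have : (fun x => {q : Plane × Plane | q.1 ∈ crossing (P ⁻¹' {q.2}) e h}.indicator
          (fun _ => (1 : ℝ≥0∞)) (x, z))
          = (crossing (P ⁻¹' {z}) e h).indicator fun _ => 1 := by
        funext x
        rfl
      have hmz := measurableSet_crossing (isClosed_singleton.preimage hPc : IsClosed (P ⁻¹' {z})) e h
      rw [this, lintegral_indicator hmz, setLIntegral_const, one_mul, Measure.restrict_apply hmz]
    · rw [lintegral_const, mul_comm]
  · have hmz := measurableSet_crossing
      (isClosed_singleton.preimage hPc : IsClosed (P ⁻¹' {γ 0})) e h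
    rw [lintegral_indicator hmz, setLIntegral_const, Measure.restrict_apply hmz]
    exact mul_le_mul_right (hcross _) _

/-- A measurable function that agrees with the boundary image outside the closure of `Ω`. -/
noncomputable def outerImage (Ω : Set Plane) (γ : ℝ → Plane) (L : ℝ) (μp μm : Measure Plane)
    (x : Plane) : ℝ :=
  open Classical in if x ∈ closure Ω then 0 else boundaryImage Ω γ L μp μm x

/-- Outside the closure, the sublevel sets of the boundary parameter are preimages under the
continuous projection of half-open arcs, which are countable unions of compact arcs. -/
theorem IsArclengthParam.measurable_outerImage {Ω : Set Plane} (hΩo : IsOpen Ω) (hΩc : Convex ℝ Ω)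
    (hΩn : Ω.Nonempty) {γ : ℝ → Plane} {L : ℝ} (hγ : IsArclengthParam Ω γ L) (μp μm : Measure Plane)
    [IsFiniteMeasure μp] [IsFiniteMeasure μm] : Measurable (outerImage Ω γ L μp μm) := by
  classical
  have hPc : Continuous (nearest (closure Ω)) :=
    (lipschitzWith_nearest isClosed_closure hΩc.closure hΩn.closure).continuous
  have hS : MeasurableSet (closure Ω) := isClosed_closure.measurableSet
  let β : Plane → ℝ := fun x => if x ∈ closure Ω then 0 else boundaryParam Ω γ L x
  have hβ : Measurable β := by
    refine measurable_of_Iio fun a => ?_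
    have : β ⁻¹' Iio a = {x | x ∈ closure Ω ∧ 0 < a} ∪
        ((closure Ω)ᶜ ∩ nearest (closure Ω) ⁻¹' (γ '' Ico 0 (min a L))) := by
      ext x
      by_cases hx : x ∈ closure Ω
      · simp [β, hx]
      · obtain ⟨h1, h2⟩ := hγ.boundaryParam_spec hΩo hΩc hΩn hx
        simp only [β, hx, mem_preimage, if_false, mem_Iio, mem_union, mem_ofPred_eq, false_and,
          false_or, mem_inter_iff, mem_compl_iff, not_false_eq_true, true_and]
        constructor
        · intro h3
          exact ⟨_, ⟨h1.1, lt_min h3 h1.2⟩, h2⟩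
        · rintro ⟨t, ht, hte⟩
          have : t = boundaryParam Ω γ L x := hγ.bijOn.injOn
            ⟨ht.1, ht.2.trans_le (min_le_right _ _)⟩ h1 (hte.trans h2.symm)
          rw [← this]
          exact ht.2.trans_le (min_le_left _ _)
    rw [this]
    refine MeasurableSet.union (hS.inter (MeasurableSet.const _)) (hS.compl.inter ?_)
    exact (hγ.measurableSet_image (min_le_right _ _)).preimage hPc.measurable
  have : outerImage Ω γ L μp μm = fun x => if x ∈ closure Ω then 0
      else netMass γ μp μm (β x) - sInf (netMass γ μp μm '' Ico 0 L) := by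
    funext x
    by_cases hx : x ∈ closure Ω <;> simp [outerImage, hx, β, boundaryImage]
  rw [this]
  exact Measurable.ite hS measurable_const (((measurable_netMass γ μp μm).comp hβ).sub_const _)

/-! ### The averaged function and its bounded variation -/

/-- The hypotheses on the average of the images `m x₁ + b + t c`. -/
structure RampSetting (Ω : Set Plane) (γ : ℝ → Plane) (L : ℝ) (μp μm : Measure Plane)
    (m b c : ℝ) : Prop where
  isOpen : IsOpen Ω
  convex : Convex ℝ Ω
  bounded : Bornology.IsBounded Ω
  nonempty : Ω.Nonempty
  param : IsArclengthParam Ω γ L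
  source : IsSourceSink Ω μp μm
  m_pos : 0 < m
  c_pos : 0 < c
  range : ∀ x ∈ Ω, 0 ≤ m * x 0 + b ∧ m * x 0 + b + c ≤ maxValue γ L μp μm

/-- The increasing piecewise linear function that is `0` on `(-∞, 0]` and `1` on `[1, ∞)`. -/
noncomputable def clamp (r : ℝ) : ℝ := max 0 (min 1 r)

theorem clamp_mem (r : ℝ) : clamp r ∈ Icc (0 : ℝ) 1 := by
  unfold clamp; simp

theorem clamp_mono : Monotone clamp := fun a b h => by
  unfold clamp; gcongr

theorem clamp_of_one_le {r : ℝ} (h : 1 ≤ r) : clamp r = 1 := by simp [clamp, h]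

theorem clamp_of_nonpos {r : ℝ} (h : r ≤ 0) : clamp r = 0 := by
  rw [clamp, max_eq_left]; exact (min_le_right _ _).trans h

theorem lipschitzWith_clamp : LipschitzWith 1 clamp :=
  (LipschitzWith.id.const_min 1).const_max 0

theorem abs_clamp_sub_le (r s : ℝ) : |clamp r - clamp s| ≤ |r - s| := by
  simpa [Real.dist_eq] using lipschitzWith_clamp.dist_le_mul r s

theorem measurable_clamp : Measurable clamp := lipschitzWith_clamp.continuous.measurable

theorem lt_clamp_iff {t r : ℝ} (ht : t ∈ Ioo (0 : ℝ) 1) : t < clamp r ↔ t < r := by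
  unfold clamp
  rw [lt_max_iff, lt_min_iff]
  exact ⟨fun h => (h.resolve_left ht.1.not_gt).2, fun h => Or.inr ⟨ht.2, h⟩⟩

/-- A representative of `averagedLift` that is defined without integrals and is measurable. -/
noncomputable def rampLift (Ω : Set Plane) (γ : ℝ → Plane) (L : ℝ) (μp μm : Measure Plane)
    (m b c : ℝ) (p : Lifted) : ℝ :=
  open Classical in
  if p.1 ∈ Ω then clamp ((m * p.1 0 + b + c - p.2) / c)
  else if p.2 < 0 then 1
  else if maxValue γ L μp μm < p.2 then 0
  else if p.2 < outerImage Ω γ L μp μm p.1 then 1 else 0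

theorem integral_subgraph_eq_clamp {u c s : ℝ} (hc : 0 < c) (x : Plane) :
    ∫ t in (0 : ℝ)..1, subgraph (fun _ => u + t * c) (x, s) = clamp ((u + c - s) / c) := by
  have h1 := intervalIntegral.integral_comp_sub_left (a := 0) (b := 1)
    (fun t => subgraph (fun _ => u + t * c) (x, s)) 1
  rw [sub_self, sub_zero] at h1
  rw [← h1, intervalIntegral.integral_of_le zero_le_one, integral_Ioc_eq_integral_Ioo,
    ← integral_ite_lt (clamp_mem _)]
  refine setIntegral_congr_fun measurableSet_Ioo fun t ht => ?_
  simp only [subgraph, lt_clamp_iff ht]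
  congr 1
  rw [lt_div_iff₀ hc]
  exact propext ⟨fun h => by linarith, fun h => by linarith⟩

section

variable {Ω : Set Plane} {γ : ℝ → Plane} {L : ℝ} {μp μm : Measure Plane} {m b c : ℝ}

theorem rampLift_of_mem {p : Lifted} (hp : p.1 ∈ Ω) :
    rampLift Ω γ L μp μm m b c p = clamp ((m * p.1 0 + b + c - p.2) / c) := by
  simp [rampLift, hp]

theorem rampLift_eq_averagedLift (hc : 0 < c) {p : Lifted} (hp : p.1 ∉ frontier Ω) :
    rampLift Ω γ L μp μm m b c p = averagedLift Ω γ L μp μm m b c p := by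
  by_cases hpΩ : p.1 ∈ Ω
  · rw [rampLift_of_mem hpΩ, averagedLift, if_pos hpΩ]
    exact (integral_subgraph_eq_clamp hc p.1).symm
  · have hcl : p.1 ∉ closure Ω := fun h => hp ⟨h, fun h' => hpΩ (interior_subset h')⟩
    simp [rampLift, averagedLift, hpΩ, boundaryLift, subgraph, outerImage, hcl]

theorem RampSetting.finite_measure (H : RampSetting Ω γ L μp μm m b c) :
     IsFiniteMeasure μp ∧ IsFiniteMeasure μm :=
  ⟨H.source.finite_source, H.source.finite_sink⟩

theorem RampSetting.c_le_maxValue (H : RampSetting Ω γ L μp μm m b c) : c ≤ maxValue γ L μp μm := by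
  obtain ⟨x, hx⟩ := H.nonempty
  linarith [H.range x hx]

theorem RampSetting.isNormalized (H : RampSetting Ω γ L μp μm m b c) :
    IsNormalized (maxValue γ L μp μm) (rampLift Ω γ L μp μm m b c) where
  measurable := by
    obtain ⟨h1, h2⟩ := H.finite_measure
    have h3 := H.param.measurable_outerImage H.isOpen H.convex H.nonempty μp μm
    have h4 : Measurable fun p : Lifted => p.1 0 :=
      (EuclideanSpace.proj (𝕜 := ℝ) (0 : Fin 2) : Plane →L[ℝ] ℝ).continuous.measurable.comp
        measurable_fst
    refine Measurable.ite (H.isOpen.measurableSet.preimage measurable_fst)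
      (measurable_clamp.comp (by fun_prop)) ?_
    refine Measurable.ite (measurableSet_lt measurable_snd measurable_const) measurable_const ?_
    refine Measurable.ite (measurableSet_lt measurable_const measurable_snd) measurable_const ?_
    exact Measurable.ite (measurableSet_lt measurable_snd (h3.comp measurable_fst))
      measurable_const measurable_const
  range p := by
    unfold rampLift
    split_ifs
    · exact clamp_mem _
    all_goals simp
  below p hp := by
    by_cases hpΩ : p.1 ∈ Ω
    · rw [rampLift_of_mem hpΩ]
      refine clamp_of_one_le ?_
      rw [le_div_iff₀ H.c_pos]
      linarith [(H.range _ hpΩ).1]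
    · simp [rampLift, hpΩ, hp]
  above p hp h0 := by
    by_cases hpΩ : p.1 ∈ Ω
    · rw [rampLift_of_mem hpΩ]
      refine clamp_of_nonpos (div_nonpos_of_nonpos_of_nonneg ?_ H.c_pos.le)
      linarith [(H.range _ hpΩ).2]
    · simp [rampLift, hpΩ, hp, h0.not_gt]

theorem RampSetting.antitone (H : RampSetting Ω γ L μp μm m b c) (x : Plane) :
    Antitone fun s => rampLift Ω γ L μp μm m b c (x, s) := by
  intro s s' hs
  by_cases hx : x ∈ Ω
  · simp only [rampLift_of_mem (p := (x, _)) hx]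
    refine clamp_mono ?_
    have := H.c_pos
    gcongr
  · simp only [rampLift, hx, if_false]
    split_ifs <;> linarith

end

/-- Monotonicity removes the absolute value, and the integral telescopes to `∫ f` over `[-h, 0]`
minus `∫ f` over `[M, M + h]`. -/
theorem lintegral_translate_sub_antitone_le {f : ℝ → ℝ} (hf : Antitone f) {M : ℝ} (hM : 0 ≤ M)
    (h01 : ∀ s, f s ∈ Icc (0 : ℝ) 1) (h1 : ∀ s < 0, f s = 1) (h0 : ∀ s, M < s → f s = 0) {h : ℝ}
    (hh : 0 ≤ h) : ∫⁻ s, ‖f (s + h) - f s‖ₑ ≤ ENNReal.ofReal h := by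
  have hint : ∀ a b : ℝ, IntervalIntegrable f volume a b := fun a b => hf.intervalIntegrable
  have hsupp : ∀ s ∉ Icc (-h) M, ‖f (s + h) - f s‖ₑ = 0 := fun s hs => by
    rw [mem_Icc, not_and_or, not_le, not_le] at hs
    rcases hs with hs | hs
    · rw [h1 s (by linarith), h1 _ (by linarith)]; simp
    · rw [h0 s hs, h0 _ (by linarith)]; simp
  have e1 : ∫⁻ s, ‖f (s + h) - f s‖ₑ = ∫⁻ s in Icc (-h) M, ‖f (s + h) - f s‖ₑ :=
    (setLIntegral_eq_of_support_subset fun s hs => by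
      by_contra hc; exact hs (hsupp s hc)).symm
  have hi1 : IntervalIntegrable (fun s => f (s + h)) volume (-h) M :=
    Antitone.intervalIntegrable fun a b hab => hf (by linarith)
  have hi : IntegrableOn (fun s => f (s + h) - f s) (Icc (-h) M) := by
    rw [integrableOn_Icc_iff_integrableOn_Ioc,
      ← intervalIntegrable_iff_integrableOn_Ioc_of_le (by linarith)]
    exact hi1.sub (hint _ _)
  rw [e1, ← ofReal_integral_norm_eq_lintegral_enorm hi]
  refine ENNReal.ofReal_le_ofReal ?_
  have e2 : ∀ s, ‖f (s + h) - f s‖ = f s - f (s + h) := fun s => by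
    rw [Real.norm_eq_abs, abs_sub_comm, abs_of_nonneg (sub_nonneg.2 (hf (by linarith)))]
  simp_rw [e2]
  rw [integral_Icc_eq_integral_Ioc, ← intervalIntegral.integral_of_le (by linarith),
    intervalIntegral.integral_sub (hint _ _) hi1,
    intervalIntegral.integral_comp_add_right (fun s => f s) h, neg_add_cancel,
    ← intervalIntegral.integral_add_adjacent_intervals (hint (-h) 0) (hint 0 M),
    ← intervalIntegral.integral_add_adjacent_intervals (hint 0 M) (hint M (M + h))]
  have h3 : ∫ s in (-h)..0, f s ≤ ∫ s in (-h)..0, (1 : ℝ) :=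
    intervalIntegral.integral_mono_on (by linarith) (hint _ _) (by simp) fun s _ => (h01 s).2
  have h4 : 0 ≤ ∫ s in M..(M + h), f s :=
    intervalIntegral.integral_nonneg (by linarith) fun s _ => (h01 s).1
  simp at h3
  linarith

theorem lintegral_enorm_ite_lt_sub_le (a b : ℝ) :
    ∫⁻ s : ℝ, ‖(if s < a then (1 : ℝ) else 0) - (if s < b then 1 else 0)‖ₑ ≤ ‖a - b‖ₑ := by
  wlog hab : b ≤ a generalizing a b
  · have := this b a (le_of_not_ge hab)
    rw [← enorm_neg, neg_sub]
    refine le_trans (le_of_eq (lintegral_congr fun t => ?_)) this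
    rw [← enorm_neg, neg_sub]
  have : ∀ t : ℝ, ‖(if t < a then (1 : ℝ) else 0) - (if t < b then 1 else 0)‖ₑ
      = (Ico b a).indicator (fun _ => 1) t := fun t => by
    by_cases h1 : t < b
    · simp [h1, h1.trans_le hab]
    · by_cases h2 : t < a
      · simp [h1, h2, not_lt.1 h1]
      · simp [h1, h2]
  simp_rw [this]
  rw [lintegral_indicator measurableSet_Ico, setLIntegral_const, one_mul,
    Real.enorm_eq_ofReal (sub_nonneg.2 hab), Real.volume_Ico]

theorem lintegral_enorm_le_of_support {f : ℝ → ℝ} {M : ℝ} (hf : ∀ s ∉ Icc 0 M, f s = 0)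
    {C : ℝ} (hC0 : 0 ≤ C) (hC : ∀ s, |f s| ≤ C) : ∫⁻ s, ‖f s‖ₑ ≤ ENNReal.ofReal (C * M) := by
  have h1 : ∀ s, ‖f s‖ₑ ≤ (Icc 0 M).indicator (fun _ => ENNReal.ofReal C) s := fun s => by
    by_cases hs : s ∈ Icc 0 M
    · rw [indicator_of_mem hs, Real.enorm_eq_ofReal_abs]
      exact ENNReal.ofReal_le_ofReal (hC s)
    · simp [hs, hf s hs]
  refine (lintegral_mono h1).trans_eq ?_
  rw [lintegral_indicator measurableSet_Icc, setLIntegral_const, Real.volume_Icc, sub_zero,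
    ENNReal.ofReal_mul hC0]

theorem abs_apply_le_norm (a : Plane) (i : Fin 2) : |a i| ≤ ‖a‖ := PiLp.norm_apply_le a i

section

variable {Ω : Set Plane} {γ : ℝ → Plane} {L : ℝ} {μp μm : Measure Plane} {m b c : ℝ}

theorem RampSetting.eq_of_notMem (H : RampSetting Ω γ L μp μm m b c) (x y : Plane) {s : ℝ}
    (hs : s ∉ Icc 0 (maxValue γ L μp μm)) :
    rampLift Ω γ L μp μm m b c (x, s) = rampLift Ω γ L μp μm m b c (y, s) := by
  have hN := H.isNormalized
  rw [mem_Icc, not_and_or, not_le, not_le] at hs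
  by_cases h0 : s < 0
  · rw [hN.below (x, s) h0, hN.below (y, s) h0]
  · have h1 := hs.resolve_left h0
    rw [hN.above (x, s) h1 (not_lt.1 h0), hN.above (y, s) h1 (not_lt.1 h0)]

theorem RampSetting.abs_sub_le (H : RampSetting Ω γ L μp μm m b c) {x y : Plane} (hx : x ∈ Ω)
    (hy : y ∈ Ω) (s : ℝ) :
    |rampLift Ω γ L μp μm m b c (y, s) - rampLift Ω γ L μp μm m b c (x, s)|
      ≤ m / c * |y 0 - x 0| := by
  rw [rampLift_of_mem (p := (y, s)) hy, rampLift_of_mem (p := (x, s)) hx]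
  refine (abs_clamp_sub_le _ _).trans (le_of_eq ?_)
  have hc := H.c_pos
  rw [← sub_div, abs_div, abs_of_pos hc]
  have : m * (y, s).1 0 + b + c - (y, s).2 - (m * (x, s).1 0 + b + c - (x, s).2)
      = m * (y 0 - x 0) := by
    simp only; ring
  rw [this, abs_mul, abs_of_pos H.m_pos]
  ring

theorem RampSetting.lintegral_fiber_le_of_mem (H : RampSetting Ω γ L μp μm m b c) {x a : Plane}
    (ha : ‖a‖ ≤ 1) {h : ℝ} (hh : 0 ≤ h) (hx : x ∈ Ω) (hy : x + h • a ∈ Ω) :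
    ∫⁻ s, ‖rampLift Ω γ L μp μm m b c (x + h • a, s) - rampLift Ω γ L μp μm m b c (x, s)‖ₑ
      ≤ ENNReal.ofReal h * ENNReal.ofReal (m / c * maxValue γ L μp μm) := by
  have hc := H.c_pos
  have hm := H.m_pos
  rw [← ENNReal.ofReal_mul hh]
  refine (lintegral_enorm_le_of_support (M := maxValue γ L μp μm) (C := m / c * h)
    (fun s hs => sub_eq_zero.2 (H.eq_of_notMem _ _ hs)) (by positivity) fun s => ?_).trans_eq ?_
  · refine (H.abs_sub_le hx hy s).trans ?_
    gcongr
    have : (x + h • a) 0 - x 0 = h * a 0 := by simp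
    rw [this, abs_mul, abs_of_nonneg hh]
    exact mul_le_of_le_one_right hh ((abs_apply_le_norm a 0).trans ha)
  · congr 1; ring

theorem RampSetting.abs_sub_le_one (H : RampSetting Ω γ L μp μm m b c) (p q : Lifted) :
    |rampLift Ω γ L μp μm m b c p - rampLift Ω γ L μp μm m b c q| ≤ 1 := by
  have h1 := H.isNormalized.range p
  have h2 := H.isNormalized.range q
  rw [abs_le]
  constructor <;> linarith [h1.1, h1.2, h2.1, h2.2]

theorem RampSetting.lintegral_fiber_le (H : RampSetting Ω γ L μp μm m b c) (x y : Plane) :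
    ∫⁻ s, ‖rampLift Ω γ L μp μm m b c (y, s) - rampLift Ω γ L μp μm m b c (x, s)‖ₑ
      ≤ ENNReal.ofReal (maxValue γ L μp μm) := by
  refine (lintegral_enorm_le_of_support (M := maxValue γ L μp μm) (C := 1)
    (fun s hs => sub_eq_zero.2 (H.eq_of_notMem _ _ hs)) zero_le_one fun s => ?_).trans_eq (by simp)
  exact H.abs_sub_le_one _ _

theorem RampSetting.lintegral_fiber_le_of_notMem (H : RampSetting Ω γ L μp μm m b c) {x a : Plane}
    {h : ℝ} (hh : 0 ≤ h) (hx : ∀ s ∈ Icc 0 h, x + s • a ∉ closure Ω) :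
    ∫⁻ s, ‖rampLift Ω γ L μp μm m b c (x + h • a, s) - rampLift Ω γ L μp μm m b c (x, s)‖ₑ
      ≤ jumpBound Ω γ (μp + μm) a h x := by
  obtain ⟨i1, i2⟩ := H.finite_measure
  have hx0 : x ∉ closure Ω := by simpa using hx 0 (left_mem_Icc.2 hh)
  have hy0 : x + h • a ∉ closure Ω := hx h (right_mem_Icc.2 hh)
  refine le_trans ?_ (H.param.enorm_boundaryImage_sub_le H.isOpen H.convex H.nonempty μp μm hh hx)
  refine le_trans (lintegral_mono fun s => ?_) (lintegral_enorm_ite_lt_sub_le _ _)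
  simp only [rampLift, outerImage, hx0, hy0, if_false, show x ∉ Ω from fun h => hx0 (subset_closure h),
    show x + h • a ∉ Ω from fun h => hy0 (subset_closure h)]
  split_ifs <;> simp

/-- Three cases for the segment: both ends in `Ω`, where the function is Lipschitz; crossing the
closure, where the fibers differ by at most `1` on `[0, M]`; avoiding it, where the fibers are
subgraphs of the boundary image. Ends on the frontier are excluded, being negligible. -/
theorem RampSetting.lintegral_fiber_le_sum (H : RampSetting Ω γ L μp μm m b c) {x a : Plane}
    (ha : ‖a‖ ≤ 1) {h : ℝ} (hh : 0 ≤ h) (hx : x ∉ frontier Ω) (hy : x + h • a ∉ frontier Ω) :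
    ∫⁻ s, ‖rampLift Ω γ L μp μm m b c (x + h • a, s) - rampLift Ω γ L μp μm m b c (x, s)‖ₑ
      ≤ ENNReal.ofReal h * ENNReal.ofReal (m / c * maxValue γ L μp μm)
        + (crossing (closure Ω) a h).indicator (fun _ => ENNReal.ofReal (maxValue γ L μp μm)) x
        + jumpBound Ω γ (μp + μm) a h x := by
  have hfr : ∀ z ∉ frontier Ω, z ∈ closure Ω → z ∈ Ω := fun z hz h1 => by
    by_contra h2
    exact hz ⟨h1, fun h3 => h2 (interior_subset h3)⟩
  by_cases h1 : ∃ s ∈ Icc 0 h, x + s • a ∈ closure Ω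
  · by_cases h2 : x ∈ closure Ω ∧ x + h • a ∈ closure Ω
    · exact (H.lintegral_fiber_le_of_mem ha hh (hfr _ hx h2.1) (hfr _ hy h2.2)).trans
        (le_self_add.trans le_self_add)
    · have h3 : x ∈ crossing (closure Ω) a h := ⟨h1, h2⟩
      rw [indicator_of_mem h3]
      exact (H.lintegral_fiber_le _ _).trans (le_add_self.trans le_self_add)
  · push Not at h1
    exact (H.lintegral_fiber_le_of_notMem hh h1).trans le_add_self

theorem volume_frontier_eq_zero (hΩc : Convex ℝ Ω) : volume (frontier Ω) = 0 :=
  hΩc.addHaar_frontier volume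

theorem ae_notMem_frontier (hΩc : Convex ℝ Ω) (y : Plane) :
    ∀ᵐ x : Plane, x ∉ frontier Ω ∧ x + y ∉ frontier Ω := by
  have h1 : ∀ᵐ x : Plane, x ∉ frontier Ω := measure_eq_zero_iff_ae_notMem.1 (volume_frontier_eq_zero hΩc)
  have h2 : ∀ᵐ x : Plane, x + y ∉ frontier Ω :=
    (measurePreserving_add_right volume y).quasiMeasurePreserving.ae h1
  exact h1.and h2

theorem measurable_enorm_translate_sub {w : Lifted → ℝ} (hw : Measurable w) (y : Lifted) :
    Measurable fun p => ‖w (p + y) - w p‖ₑ :=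
  ((hw.comp (measurable_add_const y)).sub hw).enorm

theorem lintegral_liftedDomain (f : Lifted → ℝ≥0∞) (hf : Measurable f) :
    ∫⁻ p in liftedDomain Ω, f p = ∫⁻ x in Metric.thickening 1 Ω, ∫⁻ s, f (x, s) := by
  have : (volume : Measure Lifted).restrict (liftedDomain Ω)
      = ((volume : Measure Plane).restrict (Metric.thickening 1 Ω)).prod (volume : Measure ℝ) := by
    rw [liftedDomain, Measure.volume_eq_prod, ← Measure.prod_restrict, Measure.restrict_univ]
  rw [this, lintegral_prod _ hf.aemeasurable]

/-- Each of the three contributions along the fibers is `O(h)` after integration: the first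
pointwise, the other two by the crossing estimate. -/
theorem RampSetting.exists_bound_horizontal (H : RampSetting Ω γ L μp μm m b c) :
    ∃ C : ℝ≥0∞, C < ⊤ ∧ ∀ a : Plane, ‖a‖ ≤ 1 → ∀ h : ℝ, 0 ≤ h →
      ∫⁻ p in liftedDomain Ω, ‖rampLift Ω γ L μp μm m b c (p + h • ((a, 0) : Lifted))
        - rampLift Ω γ L μp μm m b c p‖ₑ ≤ ENNReal.ofReal h * C := by
  obtain ⟨i1, i2⟩ := H.finite_measure
  have hb : Bornology.IsBounded (Metric.thickening 1 Ω) := H.bounded.thickening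
  obtain ⟨R, hR⟩ := hb.subset_ball (0 : Plane)
  set K₁ := ENNReal.ofReal (m / c * maxValue γ L μp μm)
  set B := volume (Metric.ball (0 : Plane) (R + 1))
  have hB : B < ⊤ := measure_ball_lt_top
  refine ⟨K₁ * volume (Metric.ball (0 : Plane) R) + ENNReal.ofReal (maxValue γ L μp μm) * (2 * B)
    + 2 * (μp + μm) univ * (2 * B), ?_, fun a ha h hh => ?_⟩
  · refine ENNReal.add_lt_top.2 ⟨ENNReal.add_lt_top.2 ⟨?_, ?_⟩, ?_⟩
    · exact ENNReal.mul_lt_top ENNReal.ofReal_lt_top measure_ball_lt_top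
    · exact ENNReal.mul_lt_top ENNReal.ofReal_lt_top (ENNReal.mul_lt_top (by simp) hB)
    · exact ENNReal.mul_lt_top (ENNReal.mul_lt_top (by simp) (measure_lt_top _ _))
        (ENNReal.mul_lt_top (by simp) hB)
  have hw := H.isNormalized.measurable
  rw [lintegral_liftedDomain _ (measurable_enorm_translate_sub hw _)]
  refine (lintegral_mono_set hR).trans ?_
  have hae : ∀ᵐ x ∂(volume.restrict (Metric.ball (0 : Plane) R)),
      ∫⁻ s, ‖rampLift Ω γ L μp μm m b c ((x, s) + h • ((a, 0) : Lifted))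
        - rampLift Ω γ L μp μm m b c (x, s)‖ₑ
      ≤ ENNReal.ofReal h * K₁
        + (crossing (closure Ω) a h).indicator (fun _ => ENNReal.ofReal (maxValue γ L μp μm)) x
        + jumpBound Ω γ (μp + μm) a h x := by
    refine ae_restrict_of_ae ?_
    filter_upwards [ae_notMem_frontier H.convex (h • a)] with x hx
    simpa using H.lintegral_fiber_le_sum ha hh hx.1 hx.2
  have hcm : MeasurableSet (crossing (closure Ω) a h) := measurableSet_crossing isClosed_closure a h
  refine (lintegral_mono_ae hae).trans ?_
  have hm1 : Measurable fun x => ENNReal.ofReal h * K₁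
      + (crossing (closure Ω) a h).indicator (fun _ => ENNReal.ofReal (maxValue γ L μp μm)) x :=
    (measurable_const.indicator hcm).const_add _
  rw [lintegral_add_left hm1, lintegral_add_left measurable_const, mul_add, mul_add]
  have h2h : ENNReal.ofReal (2 * h) = 2 * ENNReal.ofReal h := by
    rw [ENNReal.ofReal_mul zero_le_two]; simp
  refine add_le_add (add_le_add ?_ ?_) ?_
  · rw [setLIntegral_const, mul_assoc]
  · rw [lintegral_indicator hcm, setLIntegral_const, Measure.restrict_apply hcm]
    refine (mul_le_mul_right (volume_crossing_le H.convex.closure isClosed_closure ha hh R) _).trans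
      (le_of_eq ?_)
    rw [h2h]
    ring
  · refine (lintegral_jumpBound_le H.convex H.nonempty γ (μp + μm) ha hh R).trans (le_of_eq ?_)
    rw [h2h]
    ring

theorem RampSetting.lintegral_vertical_le (H : RampSetting Ω γ L μp μm m b c) {h : ℝ}
    (hh : 0 ≤ h) :
    ∫⁻ p in liftedDomain Ω, ‖rampLift Ω γ L μp μm m b c (p + h • es)
        - rampLift Ω γ L μp μm m b c p‖ₑ
      ≤ ENNReal.ofReal h * volume (Metric.thickening 1 Ω) := by
  have hw := H.isNormalized.measurable
  rw [lintegral_liftedDomain _ (measurable_enorm_translate_sub hw _)]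
  refine (lintegral_mono (g := fun _ => ENNReal.ofReal h) fun x => ?_).trans_eq
    (setLIntegral_const _ _)
  have := lintegral_translate_sub_antitone_le (H.antitone x)
    (H.c_pos.le.trans H.c_le_maxValue) (fun s => H.isNormalized.range _)
    (fun s hs => H.isNormalized.below (x, s) hs) (fun s hs => H.isNormalized.above (x, s) hs
      ((H.c_pos.le.trans H.c_le_maxValue).trans hs.le)) hh
  simpa [es] using this

theorem liminf_dq_lt_top {w : Lifted → ℝ} {W : Set Lifted} {e : Lifted} {C : ℝ≥0∞} (hC : C < ⊤)
    (h : ∀ h : ℝ, 0 ≤ h → ∫⁻ p in W, ‖w (p + h • e) - w p‖ₑ ≤ ENNReal.ofReal h * C) :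
    liminf (fun n => ∫⁻ p in W, ‖dq w e n p‖ₑ) atTop < ⊤ := by
  refine lt_of_le_of_lt (b := C) ?_ hC
  refine (liminf_le_liminf (v := fun _ => C) (Eventually.of_forall fun n => ?_)).trans (by simp)
  simp only [enorm_dq]
  rw [lintegral_const_mul' _ _ ENNReal.ofReal_ne_top]
  refine (mul_le_mul_right (h _ (by positivity)) _).trans (le_of_eq ?_)
  rw [← mul_assoc, ← ENNReal.ofReal_mul (by positivity), mul_inv_cancel₀ (by positivity)]
  simp

theorem RampSetting.exists_hasGrad (H : RampSetting Ω γ L μp μm m b c) :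
    ∃ lam F, HasGrad (liftedDomain Ω) (rampLift Ω γ L μp μm m b c) lam F := by
  obtain ⟨C, hC, hCb⟩ := H.exists_bound_horizontal
  refine H.isNormalized.exists_hasGrad H.bounded (W := fun _ => liftedDomain Ω)
    (fun _ => isOpen_liftedDomain Ω) (fun _ => subset_rfl)
    (fun K hK _ => Eventually.of_forall fun _ => hK) ?_
  have hx : ∀ i, ‖(EuclideanSpace.single i 1 : Plane)‖ ≤ 1 := fun i => by simp
  rintro e (rfl | rfl | rfl)
  · exact liminf_dq_lt_top hC fun h hh => hCb _ (hx 0) h hh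
  · exact liminf_dq_lt_top hC fun h hh => hCb _ (hx 1) h hh
  · exact liminf_dq_lt_top (C := volume (Metric.thickening 1 Ω))
      H.bounded.thickening.measure_lt_top fun h hh => H.lintegral_vertical_le hh

theorem RampSetting.ae_eq_averagedLift (H : RampSetting Ω γ L μp μm m b c) :
    rampLift Ω γ L μp μm m b c =ᵐ[volume.restrict (liftedDomain Ω)]
      averagedLift Ω γ L μp μm m b c := by
  refine ae_restrict_of_ae ?_
  have h1 : ∀ᵐ x : Plane, x ∉ frontier Ω :=
    measure_eq_zero_iff_ae_notMem.1 (volume_frontier_eq_zero H.convex)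
  have h2 : ∀ᵐ p : Lifted, p.1 ∉ frontier Ω := by
    have : (volume : Measure Lifted) = (volume : Measure Plane).prod (volume : Measure ℝ) := rfl
    rw [this]
    exact Measure.quasiMeasurePreserving_fst.ae h1
  filter_upwards [h2] with p hp using rampLift_eq_averagedLift H.c_pos hp

theorem RampSetting.memC (H : RampSetting Ω γ L μp μm m b c) :
    MemC Ω γ L μp μm (rampLift Ω γ L μp μm m b c) where
  range := Eventually.of_forall H.isNormalized.range
  boundedVariation := by
    obtain ⟨lam, F, hF⟩ := H.exists_hasGrad
    exact ⟨_, _, hF.isGradientMeasure (isOpen_liftedDomain Ω)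
      (H.isNormalized.locallyIntegrable.locallyIntegrableOn _)⟩
  boundary := by
    have hm := (isOpen_liftedDomain Ω).measurableSet.diff
      (measurableSet_cylinder Ω (maxValue γ L μp μm))
    filter_upwards [ae_restrict_mem hm] with p hp
    by_cases h0 : p.2 < 0
    · rw [H.isNormalized.below p h0, boundaryLift_of_neg _ _ _ _ _ h0]
    by_cases hM : maxValue γ L μp μm < p.2
    · rw [H.isNormalized.above p hM (not_lt.1 h0), boundaryLift_of_gt _ _ _ _ _ (not_lt.1 h0) hM]
    have hcl : p.1 ∉ closure Ω := fun h => hp.2 ⟨h, not_lt.1 h0, not_lt.1 hM⟩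
    simp [rampLift, boundaryLift, h0, hM, show p.1 ∉ Ω from fun h => hcl (subset_closure h),
      outerImage, hcl, subgraph]

end

/-! ### Finite cost of the averaged function -/

theorem integral_fderiv_eq_zero {ψ : Lifted → ℝ} {U : Set Lifted} (hψ : IsTest U ψ) (e : Lifted) :
    ∫ p, fderiv ℝ ψ p e = 0 := by
  have h := tendsto_integral_mul_dq (w := fun _ => 1) measurable_const (by simp) hψ.smooth
    hψ.compact e
  have h0 : ∀ n p, dq (fun _ => (1 : ℝ)) e n p = 0 := fun n p => by simp [dq]
  simp only [h0, mul_zero, integral_zero, one_mul] at h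
  have := tendsto_nhds_unique h tendsto_const_nhds
  linarith

theorem HasGrad.ae_pair_eq_zero_of_const {U W : Set Lifted} {w : Lifted → ℝ} {lam : Measure Lifted}
    {F : Lifted → Lifted} (h : HasGrad U w lam F) (hW : IsOpen W) (hWU : W ⊆ U) {k : ℝ}
    (hk : ∀ p ∈ W, w p = k) (e : Lifted) : ∀ᵐ p ∂lam, p ∈ W → pair e (F p) = 0 := by
  have hfin := h.finite
  have hP := integrable_pair_const h.integrable e
  have h1 := lintegral_enorm_le_of_forall_test hW hP.locallyIntegrable (A := 0) fun ψ hψ _ => by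
    have h2 := h.integral_mul_fderiv (hψ.mono hWU) e
    have h3 : ∀ p, w p * fderiv ℝ ψ p e = k * fderiv ℝ ψ p e := fun p => by
      by_cases hp : p ∈ W
      · rw [hk p hp]
      · simp [hψ.fderiv_eq_zero hp]
    simp only [h3, integral_const_mul, integral_fderiv_eq_zero hψ e] at h2
    linarith
  rw [ENNReal.ofReal_zero, nonpos_iff_eq_zero,
    lintegral_eq_zero_iff' hP.aestronglyMeasurable.restrict.enorm, EventuallyEq,
    ae_restrict_iff' hW.measurableSet] at h1
  filter_upwards [h1] with p hp hpW
  simpa using hp hpW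

theorem HasGrad.ae_pair_eq_zero {U : Set Lifted} (hU : IsOpen U) {w : Lifted → ℝ}
    {lam : Measure Lifted} {F : Lifted → Lifted} (h : HasGrad U w lam F) {M : ℝ} (hM : 0 ≤ M)
    (hw : IsNormalized M w) (e : Lifted) :
    ∀ᵐ p ∂lam, p ∈ U → p.2 ∉ Icc 0 M → pair e (F p) = 0 := by
  have h1 := h.ae_pair_eq_zero_of_const (W := U ∩ {p | p.2 < 0})
    (hU.inter (isOpen_lt continuous_snd continuous_const)) inter_subset_left (k := 1)
    (fun p hp => hw.below p hp.2) e
  have h2 := h.ae_pair_eq_zero_of_const (W := U ∩ {p | M < p.2})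
    (hU.inter (isOpen_lt continuous_const continuous_snd)) inter_subset_left (k := 0)
    (fun p hp => hw.above p hp.2 (hM.trans (le_of_lt hp.2))) e
  filter_upwards [h1, h2] with p h3 h4 hpU hp
  rw [mem_Icc, not_and_or, not_le, not_le] at hp
  exact hp.elim (fun h5 => h3 ⟨hpU, h5⟩) fun h5 => h4 ⟨hpU, h5⟩

theorem MemK.abs_integral_le {Ω : Set Plane} {M : ℝ} {τ : ℝ → ℝ} (hτ : IsTransportationCost τ)
    {φx : Lifted → Plane} {φs : Lifted → ℝ} (h : MemK Ω M τ φx φs) {x : Plane} (hx : x ∈ closure Ω)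
    (i : Fin 2) {s₁ s₂ : ℝ} (h1 : 0 ≤ s₁) (h12 : s₁ ≤ s₂) (h2 : s₂ ≤ M) :
    |∫ s in s₁..s₂, φx (x, s) i| ≤ τ (s₂ - s₁) := by
  rcases h12.eq_or_lt with rfl | h12
  · simp [hτ.zero]
  have hc : ContinuousOn (fun s => φx (x, s)) (uIcc s₁ s₂) := by
    rw [uIcc_of_le h12.le]
    exact h.continuous_x.comp (by fun_prop) fun s hs => ⟨hx, h1.trans hs.1, hs.2.trans h2⟩
  have h3 := (EuclideanSpace.proj (𝕜 := ℝ) i : Plane →L[ℝ] ℝ).intervalIntegral_comp_comm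
    (hc.intervalIntegrable (μ := volume))
  have h4 : ∫ s in s₁..s₂, φx (x, s) i = (∫ s in s₁..s₂, φx (x, s)) i := by simpa using! h3
  rw [h4]
  exact (abs_apply_le_norm _ i).trans (h.integral_bound x hx s₁ s₂ h1 h12 h2)

section

variable {q : ℝ → ℝ} {M T c : ℝ}

theorem setIntegral_mul_ite_lt (hM : 0 ≤ M) (α : ℝ) :
    ∫ s in Icc 0 M, q s * (if s < α then 1 else 0) = ∫ s in (0 : ℝ)..max 0 (min α M), q s := by
  have h1 : ∀ s, q s * (if s < α then (1 : ℝ) else 0) = (Iio α).indicator q s := fun s => by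
    by_cases hs : s < α <;> simp [hs]
  simp_rw [h1]
  rw [setIntegral_indicator measurableSet_Iio, intervalIntegral.integral_of_le (le_max_left _ _)]
  rcases le_total α 0 with h | h
  · have : Icc 0 M ∩ Iio α = ∅ := by
      ext s; simp only [mem_inter_iff, mem_Icc, mem_Iio, mem_empty_iff_false, iff_false]
      rintro ⟨⟨h2, -⟩, h3⟩; linarith
    rw [this, max_eq_left ((min_le_left _ _).trans h)]
    simp
  · rw [max_eq_right (le_min h hM), integral_Ioc_eq_integral_Ioo, ← integral_Ico_eq_integral_Ioo]
    refine setIntegral_congr_set ?_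
    rcases le_or_gt α M with h2 | h2
    · have : Icc 0 M ∩ Iio α = Ico 0 (min α M) := by
        rw [min_eq_left h2]
        ext s; simp only [mem_inter_iff, mem_Icc, mem_Iio, mem_Ico]
        exact ⟨fun h3 => ⟨h3.1.1, h3.2⟩, fun h3 => ⟨⟨h3.1, h3.2.le.trans h2⟩, h3.2⟩⟩
      rw [this]
      exact EventuallyEq.rfl
    · have : Icc 0 M ∩ Iio α = Icc 0 (min α M) := by
        rw [min_eq_right h2.le]
        exact inter_eq_left.2 fun s hs => lt_of_le_of_lt hs.2 h2
      rw [this]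
      exact Ico_ae_eq_Icc.symm

/-- The ramp is an average of step functions, so the integral is a mean of the primitive of `q` over
`[a - c, a]`. Bounds therefore involve only the primitive of `q`, which is controlled by `τ` even
when `q` itself is not. -/
theorem setIntegral_mul_clamp (hq : Continuous q) (hc : 0 < c) {a : ℝ} (ha : c ≤ a) (haM : a ≤ M) :
    ∫ s in Icc 0 M, q s * clamp ((a - s) / c)
      = c⁻¹ * ∫ r in (a - c)..a, ∫ s in (0 : ℝ)..r, q s := by
  have hM : 0 ≤ M := hc.le.trans (ha.trans haM)
  have h1 : ∀ s, q s * clamp ((a - s) / c)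
      = ∫ t in Ioo (0 : ℝ) 1, q s * (if s < a - c * t then 1 else 0) := fun s => by
    rw [integral_const_mul, ← integral_ite_lt (clamp_mem _)]
    congr 1
    refine setIntegral_congr_fun measurableSet_Ioo fun t ht => ?_
    simp only [lt_clamp_iff ht, lt_div_iff₀ hc]
    congr 1
    exact propext ⟨fun h => by linarith, fun h => by linarith⟩
  simp_rw [h1]
  rw [integral_integral_swap]
  · have h2 : ∀ t ∈ Ioo (0 : ℝ) 1, ∫ s in Icc 0 M, q s * (if s < a - c * t then 1 else 0)
        = ∫ s in (0 : ℝ)..(a - c * t), q s := fun t ht => by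
      have h3 : c * t ≤ c := mul_le_of_le_one_right hc.le ht.2.le
      have h4 : 0 ≤ c * t := mul_nonneg hc.le ht.1.le
      rw [setIntegral_mul_ite_lt hM, min_eq_left (by linarith), max_eq_right (by linarith)]
    rw [setIntegral_congr_fun measurableSet_Ioo h2, ← integral_Ioc_eq_integral_Ioo,
      ← intervalIntegral.integral_of_le zero_le_one,
      intervalIntegral.integral_comp_sub_mul (fun r => ∫ s in (0 : ℝ)..r, q s) hc.ne' a]
    simp
  · have h5 : Integrable (fun z : ℝ × ℝ => q z.1)
        ((volume.restrict (Icc 0 M)).prod (volume.restrict (Ioo (0 : ℝ) 1))) :=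
      (hq.integrableOn_Icc (a := 0) (b := M)).integrable.comp_fst _
    refine h5.mul_bdd (c := 1) (Measurable.aestronglyMeasurable ?_)
      (Eventually.of_forall fun z => ?_)
    · exact Measurable.ite (measurableSet_lt measurable_fst (by fun_prop)) measurable_const
        measurable_const
    · split_ifs <;> simp

theorem abs_setIntegral_mul_ite_lt_le (hM : 0 ≤ M)
    (hT : ∀ r ∈ Icc 0 M, |∫ s in (0 : ℝ)..r, q s| ≤ T) (α : ℝ) :
    |∫ s in Icc 0 M, q s * (if s < α then 1 else 0)| ≤ T := by
  rw [setIntegral_mul_ite_lt hM]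
  exact hT _ ⟨le_max_left _ _, max_le hM (min_le_right _ _)⟩

theorem abs_setIntegral_mul_clamp_le (hq : Continuous q) (hc : 0 < c)
    (hT : ∀ r ∈ Icc 0 M, |∫ s in (0 : ℝ)..r, q s| ≤ T) {a : ℝ} (ha : c ≤ a) (haM : a ≤ M) :
    |∫ s in Icc 0 M, q s * clamp ((a - s) / c)| ≤ T := by
  rw [setIntegral_mul_clamp hq hc ha haM, abs_mul, abs_of_pos (inv_pos.2 hc)]
  have := intervalIntegral.norm_integral_le_of_norm_le_const (a := a - c) (b := a) (C := T)
    (f := fun r => ∫ s in (0 : ℝ)..r, q s) fun r hr => by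
      rw [uIoc_of_le (by linarith)] at hr
      exact hT r ⟨by linarith [hr.1], hr.2.trans haM⟩
  rw [sub_sub_cancel, abs_of_pos hc] at this
  calc c⁻¹ * |∫ r in (a - c)..a, ∫ s in (0 : ℝ)..r, q s| ≤ c⁻¹ * (T * c) := by
        gcongr; exact this
    _ = T := by field_simp

/-- Moving the window `[a - c, a]` to `[a' - c, a']` changes the mean of the primitive by two pieces
of length `|a' - a|`. -/
theorem abs_setIntegral_mul_clamp_sub_le (hq : Continuous q) (hc : 0 < c)
    (hT : ∀ r ∈ Icc 0 M, |∫ s in (0 : ℝ)..r, q s| ≤ T) {a a' : ℝ} (ha : c ≤ a) (haM : a ≤ M)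
    (ha' : c ≤ a') (haM' : a' ≤ M) :
    |(∫ s in Icc 0 M, q s * clamp ((a' - s) / c)) - ∫ s in Icc 0 M, q s * clamp ((a - s) / c)|
      ≤ 2 * T / c * |a' - a| := by
  rw [setIntegral_mul_clamp hq hc ha haM, setIntegral_mul_clamp hq hc ha' haM', ← mul_sub, abs_mul,
    abs_of_pos (inv_pos.2 hc)]
  have hcont : Continuous fun r => ∫ s in (0 : ℝ)..r, q s :=
    intervalIntegral.continuous_primitive (fun _ _ => hq.intervalIntegrable _ _) 0
  have hi : ∀ u v, IntervalIntegrable (fun r => ∫ s in (0 : ℝ)..r, q s) volume u v := fun u v =>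
    hcont.intervalIntegrable u v
  have hb : ∀ u v, u ∈ Icc 0 M → v ∈ Icc 0 M →
      |∫ r in u..v, ∫ s in (0 : ℝ)..r, q s| ≤ T * |v - u| := fun u v hu hv =>
    intervalIntegral.norm_integral_le_of_norm_le_const (C := T)
      (f := fun r => ∫ s in (0 : ℝ)..r, q s) fun r hr => by
      refine hT r ?_
      have := uIoc_subset_uIcc hr
      exact (uIcc_subset_Icc hu hv) this
  have e1 : (∫ r in (a' - c)..a', ∫ s in (0 : ℝ)..r, q s) - ∫ r in (a - c)..a, ∫ s in (0 : ℝ)..r, q s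
      = (∫ r in a..a', ∫ s in (0 : ℝ)..r, q s) - ∫ r in (a - c)..(a' - c), ∫ s in (0 : ℝ)..r, q s := by
    have h1 := intervalIntegral.integral_add_adjacent_intervals (hi (a - c) a) (hi a a')
    have h2 := intervalIntegral.integral_add_adjacent_intervals (hi (a - c) (a' - c))
      (hi (a' - c) a')
    linarith
  rw [e1]
  have h1 := hb a a' ⟨by linarith, haM⟩ ⟨by linarith, haM'⟩
  have h2 := hb (a - c) (a' - c) ⟨by linarith, by linarith⟩ ⟨by linarith, by linarith⟩
  rw [sub_sub_sub_cancel_right] at h2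
  have h3 := abs_sub (∫ r in a..a', ∫ s in (0 : ℝ)..r, q s)
    (∫ r in (a - c)..(a' - c), ∫ s in (0 : ℝ)..r, q s)
  calc c⁻¹ * _ ≤ c⁻¹ * (T * |a' - a| + T * |a' - a|) := by
        gcongr; linarith
    _ = 2 * T / c * |a' - a| := by field_simp; ring

end

/-- The extension of a function on the cylinder that is constant along nearest point
projections. -/
noncomputable def extend (Ω : Set Plane) (M : ℝ) (φ : Lifted → ℝ) (p : Lifted) : ℝ :=
  φ (nearest (closure Ω) p.1, max 0 (min M p.2))

theorem extend_mapsTo {Ω : Set Plane} (hΩc : Convex ℝ Ω) (hΩn : Ω.Nonempty) {M : ℝ} (hM : 0 ≤ M)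
    (p : Lifted) : ((nearest (closure Ω) p.1, max 0 (min M p.2)) : Lifted) ∈ cylinder Ω M :=
  ⟨(nearest_spec isClosed_closure hΩc.closure hΩn.closure p.1).1, le_max_left _ _,
    max_le hM (min_le_left _ _)⟩

theorem continuous_extend {Ω : Set Plane} (hΩc : Convex ℝ Ω) (hΩn : Ω.Nonempty) {M : ℝ}
    (hM : 0 ≤ M) {φ : Lifted → ℝ} (hφ : ContinuousOn φ (cylinder Ω M)) :
    Continuous (extend Ω M φ) := by
  have hPc : Continuous (nearest (closure Ω)) :=
    (lipschitzWith_nearest isClosed_closure hΩc.closure hΩn.closure).continuous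
  exact hφ.comp_continuous (by fun_prop) (extend_mapsTo hΩc hΩn hM)

theorem extend_eq {Ω : Set Plane} (hΩc : Convex ℝ Ω) {M : ℝ} {φ : Lifted → ℝ} {p : Lifted}
    (hp : p ∈ cylinder Ω M) : extend Ω M φ p = φ p := by
  rw [extend, nearest_eq_self isClosed_closure hΩc.closure hp.1, min_eq_right hp.2.2,
    max_eq_right hp.2.1]

theorem extend_eq_of_mem_Icc (Ω : Set Plane) {M : ℝ} (φ : Lifted → ℝ) (x : Plane) {s : ℝ}
    (hs : s ∈ Icc 0 M) : extend Ω M φ (x, s) = φ (nearest (closure Ω) x, s) := by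
  rw [extend, min_eq_right hs.2, max_eq_right hs.1]

section

variable {Ω : Set Plane} {γ : ℝ → Plane} {L : ℝ} {μp μm : Measure Plane} {m b c : ℝ}

theorem RampSetting.abs_fiber_le (H : RampSetting Ω γ L μp μm m b c) {q : ℝ → ℝ}
    (hq : Continuous q) {T : ℝ}
    (hT : ∀ r ∈ Icc 0 (maxValue γ L μp μm), |∫ s in (0 : ℝ)..r, q s| ≤ T) (y : Plane) :
    |∫ s in Icc 0 (maxValue γ L μp μm), q s * rampLift Ω γ L μp μm m b c (y, s)| ≤ T := by
  have hM : 0 ≤ maxValue γ L μp μm := H.c_pos.le.trans H.c_le_maxValue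
  by_cases hy : y ∈ Ω
  · simp only [rampLift_of_mem (p := (y, _)) hy]
    exact abs_setIntegral_mul_clamp_le hq H.c_pos hT (by linarith [H.range y hy])
      (H.range y hy).2
  · rw [setIntegral_congr_fun (g := fun s => q s *
      (if s < outerImage Ω γ L μp μm y then 1 else 0)) measurableSet_Icc fun s hs => ?_]
    · exact abs_setIntegral_mul_ite_lt_le hM hT _
    · simp [rampLift, hy, hs.1.not_gt, hs.2.not_gt]

theorem RampSetting.integrableOn_fiber (H : RampSetting Ω γ L μp μm m b c) {q : ℝ → ℝ}
    (hq : Continuous q) (y : Plane) :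
    IntegrableOn (fun s => q s * rampLift Ω γ L μp μm m b c (y, s))
      (Icc 0 (maxValue γ L μp μm)) := by
  refine Integrable.mul_bdd (c := 1) (hq.integrableOn_Icc) ?_ (Eventually.of_forall fun s => ?_)
  · exact (H.isNormalized.measurable.comp (measurable_prodMk_left)).aestronglyMeasurable
  · exact H.isNormalized.abs_le _

theorem RampSetting.abs_fiber_sub_le (H : RampSetting Ω γ L μp μm m b c) {q : ℝ → ℝ}
    (hq : Continuous q) {T : ℝ}
    (hT : ∀ r ∈ Icc 0 (maxValue γ L μp μm), |∫ s in (0 : ℝ)..r, q s| ≤ T) {x y : Plane}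
    (hx : x ∈ Ω) (hy : y ∈ Ω) :
    |(∫ s in Icc 0 (maxValue γ L μp μm), q s * rampLift Ω γ L μp μm m b c (y, s))
      - ∫ s in Icc 0 (maxValue γ L μp μm), q s * rampLift Ω γ L μp μm m b c (x, s)|
      ≤ 2 * T / c * (m * |y 0 - x 0|) := by
  simp only [rampLift_of_mem (p := (y, _)) hy, rampLift_of_mem (p := (x, _)) hx]
  refine (abs_setIntegral_mul_clamp_sub_le hq H.c_pos hT (by linarith [H.range x hx])
      (H.range x hx).2 (by linarith [H.range y hy]) (H.range y hy).2).trans_eq ?_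
  rw [← abs_of_pos H.m_pos, ← abs_mul, abs_of_pos H.m_pos]
  congr 2; ring

/-- The points from which a segment in direction `a` of length `h` avoids `N`. -/
def avoiding (N : Set Plane) (a : Plane) (h : ℝ) : Set Plane := {x | ∀ s ∈ Icc 0 h, x + s • a ∉ N}

theorem isOpen_avoiding {N : Set Plane} (hN : IsClosed N) (a : Plane) (h : ℝ) :
    IsOpen (avoiding N a h) := by
  have : avoiding N a h = {x | ∃ s ∈ Icc 0 h, x + s • a ∈ N}ᶜ := by
    ext x; simp [avoiding]
  rw [this]
  exact (isClosed_hitting hN a h).isOpen_compl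

/-- Inside `Ω` and at crossings only the bound `T` on the primitive is used. For segments avoiding
the closure the crude bound `C` is accepted, since the region where it enters shrinks away later. -/
theorem RampSetting.enorm_fiber_dq_le (H : RampSetting Ω γ L μp μm m b c) {q : ℝ → ℝ}
    (hq : Continuous q) {T : ℝ}
    (hT : ∀ r ∈ Icc 0 (maxValue γ L μp μm), |∫ s in (0 : ℝ)..r, q s| ≤ T) {C : ℝ}
    (hC : ∀ s, |q s| ≤ C) {a : Plane} (ha : ‖a‖ ≤ 1) (n : ℕ) {x : Plane}
    (hx : x ∉ frontier Ω) (hy : x + ((n : ℝ) + 1)⁻¹ • a ∉ frontier Ω) :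
    ‖∫ s in Icc 0 (maxValue γ L μp μm),
        q s * dq (rampLift Ω γ L μp μm m b c) (a, 0) n (x, s)‖ₑ
      ≤ ENNReal.ofReal (2 * T / c * m)
        + (crossing (closure Ω) a ((n : ℝ) + 1)⁻¹).indicator
            (fun _ => ENNReal.ofReal (((n : ℝ) + 1) * (2 * T))) x
        + (avoiding (closure Ω) a ((n : ℝ) + 1)⁻¹).indicator (fun x => ENNReal.ofReal C *
            ∫⁻ s, ‖dq (rampLift Ω γ L μp μm m b c) (a, 0) n (x, s)‖ₑ) x := by
  set h : ℝ := ((n : ℝ) + 1)⁻¹ with hh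
  have hn : (0 : ℝ) < n + 1 := by positivity
  have hh0 : 0 < h := by positivity
  have hc := H.c_pos
  have hm := H.m_pos
  have hM : 0 ≤ maxValue γ L μp μm := H.c_pos.le.trans H.c_le_maxValue
  have hT0 : 0 ≤ T := (abs_nonneg _).trans (hT 0 ⟨le_rfl, hM⟩)
  set y := x + h • a with hydef
  have hfr : ∀ z ∉ frontier Ω, z ∈ closure Ω → z ∈ Ω := fun z hz h1 => by
    by_contra h2
    exact hz ⟨h1, fun h3 => h2 (interior_subset h3)⟩
  have e1 : ∫ s in Icc 0 (maxValue γ L μp μm),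
        q s * dq (rampLift Ω γ L μp μm m b c) (a, 0) n (x, s)
      = (n + 1) * ((∫ s in Icc 0 (maxValue γ L μp μm), q s * rampLift Ω γ L μp μm m b c (y, s))
        - ∫ s in Icc 0 (maxValue γ L μp μm), q s * rampLift Ω γ L μp μm m b c (x, s)) := by
    rw [← integral_sub (H.integrableOn_fiber hq y) (H.integrableOn_fiber hq x),
      ← integral_const_mul]
    refine integral_congr_ae (Eventually.of_forall fun s => ?_)
    simp only [dq, Prod.smul_mk, smul_zero, Prod.mk_add_mk, add_zero]
    ring
  by_cases h1 : x ∈ avoiding (closure Ω) a h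
  · rw [indicator_of_mem h1]
    refine le_trans ?_ le_add_self
    refine (enorm_integral_le_lintegral_enorm _).trans ?_
    rw [← lintegral_const_mul' _ _ ENNReal.ofReal_ne_top]
    refine (lintegral_mono fun s => ?_).trans (setLIntegral_le_lintegral _ _)
    rw [enorm_mul]
    gcongr
    rw [Real.enorm_eq_ofReal_abs]
    exact ENNReal.ofReal_le_ofReal (hC s)
  · refine le_trans ?_ le_self_add
    rw [e1, Real.enorm_eq_ofReal_abs, abs_mul, abs_of_pos hn]
    by_cases h2 : x ∈ crossing (closure Ω) a h
    · rw [indicator_of_mem h2]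
      refine le_trans (ENNReal.ofReal_le_ofReal ?_) le_add_self
      gcongr
      refine (abs_sub _ _).trans ?_
      linarith [H.abs_fiber_le hq hT x, H.abs_fiber_le hq hT y]
    · rw [indicator_of_notMem h2, add_zero]
      have h3 : x ∈ Ω ∧ y ∈ Ω := by
        simp only [avoiding, mem_ofPred_eq, not_forall, not_not] at h1
        obtain ⟨s, hs, hs'⟩ := h1
        have h4 : ¬ ¬ (x ∈ closure Ω ∧ y ∈ closure Ω) := fun h5 => h2 ⟨⟨s, hs, hs'⟩, h5⟩
        rw [not_not] at h4
        exact ⟨hfr x hx h4.1, hfr y hy h4.2⟩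
      refine ENNReal.ofReal_le_ofReal ?_
      have h5 := H.abs_fiber_sub_le hq hT h3.1 h3.2
      have h6 : |y 0 - x 0| ≤ h := by
        have : y 0 - x 0 = h * a 0 := by simp [hydef]
        rw [this, abs_mul, abs_of_pos hh0]
        exact mul_le_of_le_one_right hh0.le ((abs_apply_le_norm a 0).trans ha)
      calc (n + 1 : ℝ) * _ ≤ (n + 1) * (2 * T / c * (m * h)) := by
            gcongr
            exact h5.trans (by gcongr)
        _ = 2 * T / c * m := by rw [hh]; field_simp

/-- Integrating along vertical lines before taking absolute values preserves the cancellation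
encoded in the constraint on the fields; the cutoffs do not interfere, being functions of `x` alone
or equal to `1` on `[0, M]`. -/
theorem enorm_integral_mul_le_lintegral_fiber {w : Lifted → ℝ} (hw : Measurable w)
    (hw1 : ∀ p, |w p| ≤ 1) {M : ℝ} {a : Plane} {n : ℕ}
    (hs : ∀ p : Lifted, p.2 ∉ Icc 0 M → dq w (a, 0) n p = 0) {φ : Lifted → ℝ} (hφ : Continuous φ)
    {χ : Plane → ℝ} (hχ : Continuous χ) (hχc : HasCompactSupport χ) (hχ1 : ∀ x, χ x ∈ Icc (0 : ℝ) 1)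
    {θ : ℝ → ℝ} (hθ : Continuous θ) (hθc : HasCompactSupport θ) (hθ1 : ∀ s ∈ Icc 0 M, θ s = 1) :
    ‖∫ p : Lifted, (χ p.1 * (θ p.2 * φ p)) * dq w (a, 0) n p‖ₑ
      ≤ ∫⁻ x in tsupport χ, ‖∫ s in Icc 0 M, φ (x, s) * dq w (a, 0) n (x, s)‖ₑ := by
  have hΨ : Continuous fun p : Lifted => χ p.1 * (θ p.2 * φ p) := by fun_prop
  have hΨc : HasCompactSupport fun p : Lifted => χ p.1 * (θ p.2 * φ p) := by
    refine HasCompactSupport.intro (hχc.isCompact.prod hθc.isCompact) fun p hp => ?_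
    rw [mem_prod, not_and_or] at hp
    rcases hp with hp | hp
    · simp [image_eq_zero_of_notMem_tsupport hp]
    · simp [image_eq_zero_of_notMem_tsupport hp]
  have hint : Integrable fun p : Lifted => (χ p.1 * (θ p.2 * φ p)) * dq w (a, 0) n p :=
    (hΨ.integrable_of_hasCompactSupport hΨc).mul_bdd (c := ((n : ℝ) + 1) * 2)
      (measurable_dq hw _ n).aestronglyMeasurable (Eventually.of_forall fun p => abs_dq_le hw1 _ n p)
  rw [Measure.volume_eq_prod] at hint ⊢
  rw [integral_prod _ hint]
  refine (enorm_integral_le_lintegral_enorm _).trans ?_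
  rw [← lintegral_indicator (isClosed_tsupport χ).measurableSet]
  refine lintegral_mono fun x => ?_
  have e1 : ∫ s, (χ x * (θ s * φ (x, s))) * dq w (a, 0) n (x, s)
      = χ x * ∫ s in Icc 0 M, φ (x, s) * dq w (a, 0) n (x, s) := by
    rw [← integral_const_mul, ← integral_indicator measurableSet_Icc]
    refine integral_congr_ae (Eventually.of_forall fun s => ?_)
    by_cases h : s ∈ Icc 0 M
    · simp only [indicator_of_mem h, hθ1 s h]; ring
    · simp only [indicator_of_notMem h]
      rw [hs (x, s) h, mul_zero]
  simp only [e1]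
  by_cases hx : x ∈ tsupport χ
  · rw [indicator_of_mem hx, enorm_mul]
    refine mul_le_of_le_one_left zero_le ?_
    rw [Real.enorm_eq_ofReal_abs, abs_of_nonneg (hχ1 x).1]
    exact ENNReal.ofReal_le_one.2 (hχ1 x).2
  · simp [image_eq_zero_of_notMem_tsupport hx]

end

section

variable {Ω : Set Plane} {γ : ℝ → Plane} {L : ℝ} {μp μm : Measure Plane} {m b c : ℝ}

theorem RampSetting.dq_horizontal_eq_zero (H : RampSetting Ω γ L μp μm m b c) (a : Plane) (n : ℕ)
    (p : Lifted) (hp : p.2 ∉ Icc 0 (maxValue γ L μp μm)) :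
    dq (rampLift Ω γ L μp μm m b c) (a, 0) n p = 0 := by
  have e1 : p + ((n : ℝ) + 1)⁻¹ • ((a, 0) : Lifted) = (p.1 + ((n : ℝ) + 1)⁻¹ • a, p.2) := by
    ext <;> simp
  rw [dq, e1, H.eq_of_notMem (p.1 + ((n : ℝ) + 1)⁻¹ • a) p.1 hp, sub_self, mul_zero]

theorem RampSetting.abs_extend_integral_le (H : RampSetting Ω γ L μp μm m b c) {τ : ℝ → ℝ}
    (hτ : IsTransportationCost τ) {φx : Lifted → Plane} {φs : Lifted → ℝ}
    (h : MemK Ω (maxValue γ L μp μm) τ φx φs) (i : Fin 2) (x : Plane) :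
    ∀ r ∈ Icc 0 (maxValue γ L μp μm),
      |∫ s in (0 : ℝ)..r, extend Ω (maxValue γ L μp μm) (fun p => φx p i) (x, s)|
        ≤ τ (maxValue γ L μp μm) := by
  intro r hr
  have h1 : ∫ s in (0 : ℝ)..r, extend Ω (maxValue γ L μp μm) (fun p => φx p i) (x, s)
      = ∫ s in (0 : ℝ)..r, φx (nearest (closure Ω) x, s) i := by
    refine intervalIntegral.integral_congr fun s hs => ?_
    rw [uIcc_of_le hr.1] at hs
    exact extend_eq_of_mem_Icc Ω (fun p => φx p i) x ⟨hs.1, hs.2.trans hr.2⟩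
  rw [h1]
  refine (h.abs_integral_le hτ (nearest_spec isClosed_closure H.convex.closure
    H.nonempty.closure x).1 i le_rfl hr.1 hr.2).trans ?_
  rw [sub_zero]
  exact hτ.mono hr.1 (hr.1.trans hr.2) hr.2

theorem lintegral_prod_univ {S : Set Plane} {f : Lifted → ℝ≥0∞} (hf : Measurable f) :
    ∫⁻ p in S ×ˢ (univ : Set ℝ), f p = ∫⁻ x in S, ∫⁻ s, f (x, s) := by
  have : (volume : Measure Lifted).restrict (S ×ˢ (univ : Set ℝ))
      = ((volume : Measure Plane).restrict S).prod (volume : Measure ℝ) := by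
    rw [Measure.volume_eq_prod, ← Measure.prod_restrict, Measure.restrict_univ]
  rw [this, lintegral_prod _ hf.aemeasurable]

/-- The crossing set has volume of the order of the step, which cancels the factor `n + 1`. The
avoiding part is bounded by the variation in an outer collar, of width `2 δ` since a step is at most
`δ`. -/
theorem RampSetting.lintegral_fiber_dq_le (H : RampSetting Ω γ L μp μm m b c)
    {lam : Measure Lifted} {F : Lifted → Lifted}
    (h : HasGrad (liftedDomain Ω) (rampLift Ω γ L μp μm m b c) lam F) {φ : Lifted → ℝ}
    (hφ : Continuous φ) {T : ℝ}
    (hT : ∀ x, ∀ r ∈ Icc 0 (maxValue γ L μp μm), |∫ s in (0 : ℝ)..r, φ (x, s)| ≤ T) {C : ℝ}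
    (hC : ∀ p, |φ p| ≤ C) {a : Plane} (ha : ‖a‖ ≤ 1) {R : ℝ}
    (hR : Metric.thickening 1 Ω ⊆ Metric.ball 0 R) {n : ℕ} {δ : ℝ} (hδ : ((n : ℝ) + 1)⁻¹ ≤ δ)
    (hδ1 : 2 * δ ≤ 1) :
    ∫⁻ x in Metric.thickening δ Ω, ‖∫ s in Icc 0 (maxValue γ L μp μm),
        φ (x, s) * dq (rampLift Ω γ L μp μm m b c) (a, 0) n (x, s)‖ₑ
      ≤ ENNReal.ofReal (2 * T / c * m) * volume (Metric.ball (0 : Plane) R)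
        + ENNReal.ofReal (4 * T) * volume (Metric.ball (0 : Plane) (R + 1))
        + ENNReal.ofReal C * ∫⁻ p in (Metric.thickening (2 * δ) Ω \ closure Ω) ×ˢ univ,
            ‖pair (a, 0) (F p)‖ₑ ∂lam := by
  have hn : (0 : ℝ) < n + 1 := by positivity
  have hh0 : (0 : ℝ) ≤ ((n : ℝ) + 1)⁻¹ := by positivity
  have hM : 0 ≤ maxValue γ L μp μm := H.c_pos.le.trans H.c_le_maxValue
  have hT0 : 0 ≤ T := (abs_nonneg _).trans (hT 0 0 ⟨le_rfl, hM⟩)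
  have hδ0 : 0 ≤ δ := hh0.trans hδ
  have hO : Metric.thickening δ Ω ⊆ Metric.ball 0 R :=
    (Metric.thickening_mono (by linarith) _).trans hR
  have hOm : MeasurableSet (Metric.thickening δ Ω) := Metric.isOpen_thickening.measurableSet
  have hw := H.isNormalized
  set w := rampLift Ω γ L μp μm m b c
  have hcm := measurableSet_crossing (isClosed_closure (s := Ω)) a ((n : ℝ) + 1)⁻¹
  have ham := (isOpen_avoiding (isClosed_closure (s := Ω)) a ((n : ℝ) + 1)⁻¹)
  have hdm : Measurable fun p => ‖dq w (a, 0) n p‖ₑ := (measurable_dq hw.measurable _ n).enorm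
  have hae := ae_notMem_frontier H.convex (((n : ℝ) + 1)⁻¹ • a)
  refine (lintegral_mono_ae (ae_restrict_of_ae (hae.mono fun x hx => H.enorm_fiber_dq_le
    (hφ.comp (Continuous.prodMk_right x)) (hT x) (fun s => hC (x, s)) ha n hx.1 hx.2))).trans ?_
  have hcm' : Measurable fun x => ENNReal.ofReal (2 * T / c * m)
      + (crossing (closure Ω) a ((n : ℝ) + 1)⁻¹).indicator
        (fun _ => ENNReal.ofReal (((n : ℝ) + 1) * (2 * T))) x :=
    (measurable_const.indicator hcm).const_add _
  rw [lintegral_add_left hcm', lintegral_add_left measurable_const]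
  refine add_le_add (add_le_add ?_ ?_) ?_
  · rw [setLIntegral_const]
    gcongr
  · rw [lintegral_indicator hcm, Measure.restrict_restrict hcm, setLIntegral_const]
    calc ENNReal.ofReal (((n : ℝ) + 1) * (2 * T))
          * volume (crossing (closure Ω) a ((n : ℝ) + 1)⁻¹ ∩ Metric.thickening δ Ω)
        ≤ ENNReal.ofReal (((n : ℝ) + 1) * (2 * T)) * (ENNReal.ofReal (2 * ((n : ℝ) + 1)⁻¹)
          * volume (Metric.ball (0 : Plane) (R + 1))) := by
          gcongr
          exact (measure_mono (inter_subset_inter_right _ hO)).trans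
            (volume_crossing_le H.convex.closure isClosed_closure ha hh0 R)
      _ = _ := by
          rw [← mul_assoc, ← ENNReal.ofReal_mul (by positivity)]
          congr 2
          field_simp
          ring
  · rw [lintegral_indicator ham.measurableSet, Measure.restrict_restrict ham.measurableSet,
      lintegral_const_mul' _ _ ENNReal.ofReal_ne_top, ← lintegral_prod_univ hdm]
    refine mul_le_mul_right (h.lintegral_dq_le hw.measurable hw.abs_le
      ((ham.inter Metric.isOpen_thickening).prod isOpen_univ)
      ((Metric.isOpen_thickening.measurableSet.diff isClosed_closure.measurableSet).prod
        MeasurableSet.univ) ?_ ?_) _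
    · exact prod_mono (sdiff_subset.trans (Metric.thickening_mono hδ1 _)) subset_rfl
    · rintro p ⟨⟨hp1, hp2⟩, -⟩ s hs
      refine ⟨⟨?_, hp1 s hs⟩, mem_univ _⟩
      rw [Metric.mem_thickening_iff] at hp2 ⊢
      obtain ⟨z, hz, hpz⟩ := hp2
      refine ⟨z, hz, ?_⟩
      have h1 : dist (p.1 + s • a) p.1 ≤ s := by
        rw [dist_eq_norm, add_sub_cancel_left, norm_smul, Real.norm_eq_abs, abs_of_nonneg hs.1]
        exact mul_le_of_le_one_right hs.1 ha
      have h2 := dist_triangle (p.1 + s • a) p.1 z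
      have h3 := hs.2.trans hδ
      change dist (p.1 + s • a) z < 2 * δ
      linarith

theorem tendsto_lintegral_outer {Ω : Set Plane} (hΩn : Ω.Nonempty) {lam : Measure Lifted}
    {g : Lifted → ℝ} (hg : Integrable g lam) {δ : ℕ → ℝ} (hδ : Tendsto δ atTop (𝓝 0)) :
    Tendsto (fun k => ∫⁻ p in (Metric.thickening (δ k) Ω \ closure Ω) ×ˢ univ, ‖g p‖ₑ ∂lam) atTop
      (𝓝 0) := by
  have hm : ∀ k, MeasurableSet ((Metric.thickening (δ k) Ω \ closure Ω) ×ˢ (univ : Set ℝ)) :=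
    fun k => (Metric.isOpen_thickening.measurableSet.diff
      isClosed_closure.measurableSet).prod MeasurableSet.univ
  simp_rw [← lintegral_indicator (hm _)]
  have h0 : (0 : ℝ≥0∞) = ∫⁻ _, 0 ∂lam := by simp
  rw [h0]
  refine tendsto_lintegral_of_dominated_convergence' (fun p => ‖g p‖ₑ)
    (fun k => hg.aestronglyMeasurable.enorm.indicator (hm k))
    (fun k => Eventually.of_forall fun p => indicator_le_self _ _ p) hg.2.ne
    (Eventually.of_forall fun p => ?_)
  refine tendsto_const_nhds.congr' ?_
  by_cases hp : p.1 ∈ closure Ω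
  · exact Eventually.of_forall fun k => (indicator_of_notMem (fun h => h.1.2 hp) _).symm
  · have hpos : 0 < Metric.infDist p.1 Ω := (Metric.infDist_pos_iff_notMem_closure hΩn).1 hp
    filter_upwards [hδ.eventually_lt_const hpos] with k hk
    refine (indicator_of_notMem (fun h => ?_) _).symm
    have := (Metric.mem_thickening_iff_infDist_lt hΩn).1 h.1.1
    linarith

end

/-- Vertical difference quotients of a function decreasing in `s` are nonpositive, and nonnegative
tests preserve this in the limit. -/
theorem HasGrad.setIntegral_vertical_nonpos {U : Set Lifted} (hU : IsOpen U) {w : Lifted → ℝ}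
    {lam : Measure Lifted} {F : Lifted → Lifted} (h : HasGrad U w lam F) (hw : Measurable w)
    (hw1 : ∀ p, |w p| ≤ 1) (hanti : ∀ x, Antitone fun s => w (x, s)) {K : Set Lifted}
    (hK : IsCompact K) (hKU : K ⊆ U) {φ : Lifted → ℝ} (hφ : ContinuousOn φ K)
    (hφ0 : ∀ p ∈ K, 0 ≤ φ p) : ∫ p in K, φ p * pair es (F p) ∂lam ≤ 0 := by
  obtain ⟨ψ, hψ, ⟨C, hC⟩, hlim, hψ0⟩ := exists_test_tendsto_indicator hU hK hKU hφ
  refine le_of_tendsto (tendsto_integral_mul_pair h.integrable es hK.measurableSet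
    (fun n => (hψ n).smooth.continuous) hC hlim) (Eventually.of_forall fun n => ?_)
  refine le_of_tendsto (h.tendsto_integral_mul_dq_of_continuous hU hw hw1 (hψ n).smooth.continuous
    (hψ n).compact (hψ n).supp es) (Eventually.of_forall fun k => ?_)
  refine integral_nonpos fun p => mul_nonpos_of_nonneg_of_nonpos (hψ0 hφ0 n p) ?_
  refine mul_nonpos_of_nonneg_of_nonpos (by positivity) (sub_nonpos.2 ?_)
  have e1 : p + ((k : ℝ) + 1)⁻¹ • es = (p.1, p.2 + ((k : ℝ) + 1)⁻¹) := by
    ext <;> simp [es]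
  rw [e1]
  exact hanti p.1 (le_add_of_nonneg_right (by positivity))

section

variable {Ω : Set Plane} {γ : ℝ → Plane} {L : ℝ} {μp μm : Measure Plane} {m b c : ℝ}

/-- The bound involves the field only through `T`. The uniform bound `C` multiplies only the
variation in an outer collar, which vanishes as the cutoffs shrink to the closure of `Ω`. -/
theorem RampSetting.abs_integral_horizontal_le (H : RampSetting Ω γ L μp μm m b c)
    {lam : Measure Lifted} {F : Lifted → Lifted}
    (h : HasGrad (liftedDomain Ω) (rampLift Ω γ L μp μm m b c) lam F) {φ : Lifted → ℝ}
    (hφ : Continuous φ) {T : ℝ}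
    (hT : ∀ x, ∀ r ∈ Icc 0 (maxValue γ L μp μm), |∫ s in (0 : ℝ)..r, φ (x, s)| ≤ T) {C : ℝ}
    (hC : ∀ p, |φ p| ≤ C) {a : Plane} (ha : ‖a‖ ≤ 1) {R : ℝ}
    (hR : Metric.thickening 1 Ω ⊆ Metric.ball 0 R) :
    ‖∫ p in cylinder Ω (maxValue γ L μp μm), φ p * pair (a, 0) (F p) ∂lam‖ₑ
      ≤ ENNReal.ofReal (2 * T / c * m) * volume (Metric.ball (0 : Plane) R)
        + ENNReal.ofReal (4 * T) * volume (Metric.ball (0 : Plane) (R + 1)) := by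
  set M := maxValue γ L μp μm
  have hM : 0 ≤ M := H.c_pos.le.trans H.c_le_maxValue
  have hw := H.isNormalized
  have hU := isOpen_liftedDomain Ω
  have hcl : IsCompact (closure Ω) := H.bounded.isCompact_closure
  obtain ⟨θ, hθs, hθc, -, hθ01, hθ1⟩ := exists_contDiff_cutoff (isCompact_Icc (a := 0) (b := M))
    isOpen_univ (subset_univ _)
  -- With these radii a collar of twice the width still lies in the `1`-neighbourhood.
  have hδ0 : ∀ k : ℕ, (0 : ℝ) < 1 / (k + 2) := fun k => by positivity
  have hδ1 : ∀ k : ℕ, 2 * (1 / ((k : ℝ) + 2)) ≤ 1 := fun k => by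
    rw [mul_one_div, div_le_one (by positivity)]
    linarith [(Nat.cast_nonneg k : (0 : ℝ) ≤ k)]
  have hδl : Tendsto (fun k : ℕ => 1 / ((k : ℝ) + 2)) atTop (𝓝 0) := by
    have := (tendsto_const_div_atTop_nhds_zero_nat (1 : ℝ)).comp (tendsto_add_atTop_nat 2)
    refine this.congr fun k => ?_
    simp
  choose χ hχs hχc hχO hχ01 hχ1 using fun k : ℕ => exists_contDiff_cutoff hcl
    (Metric.isOpen_thickening (E := Ω) (δ := 1 / (k + 2)))
    (Metric.closure_subset_thickening (hδ0 k) Ω)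
  set Ψ : ℕ → Lifted → ℝ := fun k p => χ k p.1 * (θ p.2 * φ p) with hΨ
  have hχcont := fun k => (hχs k).continuous
  have hθcont := hθs.continuous
  have hΨc : ∀ k, Continuous (Ψ k) := fun k => by
    have := hχcont k
    simp only [hΨ]
    fun_prop
  have hΨsub : ∀ k p, p ∉ tsupport (χ k) ×ˢ tsupport θ → Ψ k p = 0 := fun k p hp => by
    rw [mem_prod, not_and_or] at hp
    rcases hp with hp | hp
    · simp [hΨ, image_eq_zero_of_notMem_tsupport hp]
    · simp [hΨ, image_eq_zero_of_notMem_tsupport hp]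
  have hcpt : ∀ k, IsCompact (tsupport (χ k) ×ˢ tsupport θ) := fun k =>
    (hχc k).isCompact.prod hθc.isCompact
  have hΨs : ∀ k, tsupport (Ψ k) ⊆ liftedDomain Ω := fun k => by
    refine (closure_minimal (fun p hp => ?_) (hcpt k).isClosed).trans
      (prod_mono ((hχO k).trans (Metric.thickening_mono (by linarith [hδ1 k, hδ0 k]) _))
        (subset_univ _))
    by_contra h1
    exact hp (hΨsub k p h1)
  -- the bound for fixed cutoff
  have key : ∀ k, ‖∫ p, Ψ k p * pair (a, 0) (F p) ∂lam‖ₑ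
      ≤ ENNReal.ofReal (2 * T / c * m) * volume (Metric.ball (0 : Plane) R)
        + ENNReal.ofReal (4 * T) * volume (Metric.ball (0 : Plane) (R + 1))
        + ENNReal.ofReal C * ∫⁻ p in (Metric.thickening (2 * (1 / ((k : ℝ) + 2))) Ω \ closure Ω) ×ˢ
            univ, ‖pair (a, 0) (F p)‖ₑ ∂lam := fun k => by
    have hlim := h.tendsto_integral_mul_dq_of_continuous hU hw.measurable hw.abs_le (hΨc k)
      (HasCompactSupport.intro (hcpt k) (hΨsub k)) (hΨs k) (a, 0)
    refine le_of_tendsto hlim.enorm ?_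
    filter_upwards [tendsto_natCast_add_one_inv.eventually_le_const (hδ0 k)] with n hn
    refine (enorm_integral_mul_le_lintegral_fiber hw.measurable hw.abs_le
      (H.dq_horizontal_eq_zero a n) hφ (hχcont k) (hχc k) (hχ01 k) hθcont hθc hθ1).trans ?_
    exact (lintegral_mono_set (hχO k)).trans
      (H.lintegral_fiber_dq_le h hφ hT hC ha hR hn (hδ1 k))
  have hP := integrable_pair_const h.integrable ((a, 0) : Lifted)
  have hout := tendsto_lintegral_outer H.nonempty hP (δ := fun k : ℕ => 2 * (1 / ((k : ℝ) + 2)))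
    (by simpa using hδl.const_mul 2)
  have hrhs := (ENNReal.Tendsto.const_mul hout (Or.inr ENNReal.ofReal_ne_top)
    (a := ENNReal.ofReal C)).const_add
      (ENNReal.ofReal (2 * T / c * m) * volume (Metric.ball (0 : Plane) R)
        + ENNReal.ofReal (4 * T) * volume (Metric.ball (0 : Plane) (R + 1)))
  rw [mul_zero, add_zero] at hrhs
  have hKm : MeasurableSet (closure Ω ×ˢ (univ : Set ℝ)) :=
    isClosed_closure.measurableSet.prod MeasurableSet.univ
  have hlhs := tendsto_integral_mul_pair h.integrable (a, 0) hKm (φ := fun p => θ p.2 * φ p)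
    hΨc (C := C) (fun k p => ?_) (fun p => ?_)
  -- The function is constant below `0` and above `M`, so heights outside `[0, M]` carry no
  -- gradient.
  · have heq : ∫ p in closure Ω ×ˢ (univ : Set ℝ), θ p.2 * φ p * pair (a, 0) (F p) ∂lam
        = ∫ p in cylinder Ω M, φ p * pair (a, 0) (F p) ∂lam := by
      rw [setIntegral_eq_of_subset_of_ae_sdiff_eq_zero (s := cylinder Ω M) hKm.nullMeasurableSet
        (prod_mono subset_rfl (subset_univ _))]
      · exact setIntegral_congr_fun (measurableSet_cylinder Ω M) fun p hp => by
          simp only [hθ1 p.2 hp.2, one_mul]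
      · filter_upwards [h.ae_pair_eq_zero hU hM hw (a, 0)] with p hp hpK
        rw [hp ⟨Metric.closure_subset_thickening one_pos Ω hpK.1.1, mem_univ _⟩
          fun h2 => hpK.2 ⟨hpK.1.1, h2⟩, mul_zero]
    rw [← heq]
    exact le_of_tendsto_of_tendsto' hlhs.enorm hrhs key
  · simp only [hΨ, abs_mul]
    have h1 := abs_of_nonneg (hχ01 k p.1).1
    have h2 := abs_of_nonneg (hθ01 p.2).1
    rw [h1, h2]
    calc χ k p.1 * (θ p.2 * |φ p|) ≤ 1 * (1 * C) := by
          gcongr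
          · exact mul_nonneg (hθ01 p.2).1 (abs_nonneg _)
          · exact (hχ01 k p.1).2
          · exact (hθ01 p.2).2
          · exact hC p
      _ = C := by ring
  · by_cases hp : p.1 ∈ closure Ω
    · rw [indicator_of_mem (show p ∈ closure Ω ×ˢ univ from ⟨hp, mem_univ _⟩)]
      refine tendsto_const_nhds.congr fun k => ?_
      simp [hΨ, hχ1 k p.1 hp]
    · rw [indicator_of_notMem fun h2 => hp h2.1]
      have hpos : 0 < Metric.infDist p.1 Ω :=
        (Metric.infDist_pos_iff_notMem_closure H.nonempty).1 hp
      refine tendsto_const_nhds.congr' ?_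
      filter_upwards [hδl.eventually_lt_const hpos] with k hk
      have : p.1 ∉ tsupport (χ k) := fun h2 => by
        have := (Metric.mem_thickening_iff_infDist_lt H.nonempty).1 (hχO k h2)
        linarith
      simp [hΨ, image_eq_zero_of_notMem_tsupport this]

/-- Uniform over all admissible fields even if `τ'(0) = ∞`: the horizontal components are bounded
through `T = τ(M)`, and the vertical part is nonpositive. -/
theorem RampSetting.exists_flux_le (H : RampSetting Ω γ L μp μm m b c)
    {lam : Measure Lifted} {F : Lifted → Lifted}
    (h : HasGrad (liftedDomain Ω) (rampLift Ω γ L μp μm m b c) lam F) {τ : ℝ → ℝ}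
    (hτ : IsTransportationCost τ) :
    ∃ A : ℝ, ∀ φx φs, MemK Ω (maxValue γ L μp μm) τ φx φs →
      flux (cylinder Ω (maxValue γ L μp μm)) lam F φx φs ≤ A := by
  obtain ⟨R, hR⟩ := (H.bounded.thickening (δ := 1)).subset_ball (0 : Plane)
  set M := maxValue γ L μp μm
  have hM : 0 ≤ M := H.c_pos.le.trans H.c_le_maxValue
  set B := ENNReal.ofReal (2 * τ M / c * m) * volume (Metric.ball (0 : Plane) R)
        + ENNReal.ofReal (4 * τ M) * volume (Metric.ball (0 : Plane) (R + 1)) with hB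
  have hBt : B < ⊤ := by
    rw [hB]
    exact ENNReal.add_lt_top.2 ⟨ENNReal.mul_lt_top ENNReal.ofReal_lt_top measure_ball_lt_top,
      ENNReal.mul_lt_top ENNReal.ofReal_lt_top measure_ball_lt_top⟩
  have hU := isOpen_liftedDomain Ω
  have hKU := cylinder_subset_liftedDomain Ω M
  have hK : IsCompact (cylinder Ω M) := isCompact_cylinder H.bounded M
  refine ⟨2 * B.toReal, fun φx φs hφ => ?_⟩
  have hxi : ∀ i : Fin 2, ContinuousOn (fun p => φx p i) (cylinder Ω M) := fun i =>
    (EuclideanSpace.proj (𝕜 := ℝ) i : Plane →L[ℝ] ℝ).continuous.comp_continuousOn hφ.continuous_x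
  have hi : ∀ i : Fin 2, ∫ p in cylinder Ω M, φx p i * pair (ex i) (F p) ∂lam ≤ B.toReal := by
    intro i
    have e1 : ∫ p in cylinder Ω M, φx p i * pair (ex i) (F p) ∂lam
        = ∫ p in cylinder Ω M, extend Ω M (fun p => φx p i) p * pair (ex i) (F p) ∂lam :=
      setIntegral_congr_fun (measurableSet_cylinder Ω M) fun p hp => by
        simp only [extend_eq H.convex hp]
    obtain ⟨C, hC⟩ := hK.exists_bound_of_continuousOn (hxi i)
    have h1 := H.abs_integral_horizontal_le h (continuous_extend H.convex H.nonempty hM (hxi i))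
      (H.abs_extend_integral_le hτ hφ i) (C := C)
      (fun p => hC _ (extend_mapsTo H.convex H.nonempty hM p))
      (a := EuclideanSpace.single i 1) (by simp) hR
    rw [e1]
    refine (le_abs_self _).trans ?_
    rw [← ENNReal.ofReal_le_ofReal_iff ENNReal.toReal_nonneg, ENNReal.ofReal_toReal hBt.ne,
      ← Real.enorm_eq_ofReal_abs]
    exact h1
  rw [flux_eq_sum h.integrable hK hφ.continuous_x hφ.continuous_s]
  have hv := h.setIntegral_vertical_nonpos hU H.isNormalized.measurable H.isNormalized.abs_le
    H.antitone hK hKU hφ.continuous_s hφ.nonneg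
  linarith [hi 0, hi 1]

end

/-! ### Gradients of the levels of the averaged function -/

theorem integral_mul_ite_lt_sub {q : ℝ → ℝ} (hq : Integrable q) (α β : ℝ) :
    ∫ s, q s * ((if s < α then 1 else 0) - if s < β then 1 else 0) = ∫ s in β..α, q s := by
  have h1 : ∀ α : ℝ, (fun s => q s * (if s < α then (1 : ℝ) else 0)) = (Iio α).indicator q :=
    fun α => by
      ext s
      by_cases hs : s < α <;> simp [hs]
  have h2 : ∀ α : ℝ, Integrable fun s => q s * (if s < α then (1 : ℝ) else 0) := fun α => by
    rw [h1]; exact hq.indicator measurableSet_Iio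
  have h3 : ∀ α : ℝ, ∫ s, q s * (if s < α then (1 : ℝ) else 0) = ∫ s in Iic α, q s := fun α => by
    rw [h1, integral_indicator measurableSet_Iio, integral_Iic_eq_integral_Iio]
  simp_rw [mul_sub]
  rw [integral_sub (h2 α) (h2 β), h3, h3,
    intervalIntegral.integral_Iic_sub_Iic hq.integrableOn hq.integrableOn]

theorem tendsto_mul_integral {q : ℝ → ℝ} (hq : Continuous q) (u k : ℝ) :
    Tendsto (fun n : ℕ => ((n : ℝ) + 1) * ∫ s in u..(u + ((n : ℝ) + 1)⁻¹ * k), q s) atTop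
      (𝓝 (k * q u)) := by
  have h1 : HasDerivAt (fun r : ℝ => ∫ s in u..r, q s) (q (u + 0 * k)) (u + 0 * k) :=
    intervalIntegral.integral_hasDerivAt_right (hq.intervalIntegrable _ _)
      hq.aestronglyMeasurable.stronglyMeasurableAtFilter hq.continuousAt
  have h2 : HasDerivAt (fun r : ℝ => u + r * k) k 0 := by
    simpa using ((hasDerivAt_id (0 : ℝ)).mul_const k).const_add u
  have h3 := (h1.comp (0 : ℝ) h2).tendsto_slope_zero.comp (f := fun n : ℕ => ((n : ℝ) + 1)⁻¹)
    (x := atTop) (tendsto_nhdsWithin_iff.2 ⟨tendsto_natCast_add_one_inv,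
      Eventually.of_forall fun n => by simp; positivity⟩)
  simp only [zero_mul, add_zero] at h3
  rw [mul_comm]
  refine h3.congr fun n => ?_
  simp [Function.comp]

section

variable {Ω : Set Plane} {γ : ℝ → Plane} {L : ℝ} {μp μm : Measure Plane} {m b c : ℝ}

theorem RampSetting.superlevel_eq (H : RampSetting Ω γ L μp μm m b c) {t : ℝ}
    (ht : t ∈ Ioo (0 : ℝ) 1) {x : Plane} (hx : x ∈ Ω) (s : ℝ) :
    superlevel (rampLift Ω γ L μp μm m b c) t (x, s)
      = if s < m * x 0 + b + (1 - t) * c then 1 else 0 := by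
  rw [superlevel_eq_ite, rampLift_of_mem (p := (x, s)) hx]
  simp only [lt_clamp_iff ht, lt_div_iff₀ H.c_pos]
  congr 1
  exact propext ⟨fun h => by linarith, fun h => by linarith⟩

theorem RampSetting.level_mem (H : RampSetting Ω γ L μp μm m b c) {t : ℝ}
    (ht : t ∈ Ioo (0 : ℝ) 1) {x : Plane} (hx : x ∈ Ω) :
    m * x 0 + b + (1 - t) * c ∈ Icc 0 (maxValue γ L μp μm) := by
  have h1 := H.range x hx
  have h2 : 0 ≤ (1 - t) * c := mul_nonneg (by linarith [ht.2]) H.c_pos.le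
  have h3 : (1 - t) * c ≤ c := mul_le_of_le_one_left H.c_pos.le (by linarith [ht.1])
  exact ⟨by linarith, by linarith⟩

theorem continuous_apply_zero : Continuous fun x : Plane => x 0 :=
  (EuclideanSpace.proj (𝕜 := ℝ) (0 : Fin 2) : Plane →L[ℝ] ℝ).continuous

/-- Over `Ω` the level is the subgraph of an affine function, and its gradient is carried by the
graph, with density `(m, 0, -1)` over the base plane. The factor `m * e.1 0 - e.2` is the rate at
which the graph rises relative to a point moving in direction `e`. -/
theorem RampSetting.integral_level (H : RampSetting Ω γ L μp μm m b c) {t : ℝ}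
    (ht : t ∈ Ioo (0 : ℝ) 1) {lam : Measure Lifted} {F : Lifted → Lifted}
    (h : HasGrad (liftedDomain Ω) (superlevel (rampLift Ω γ L μp μm m b c) t) lam F)
    {φ : Lifted → ℝ} (hφ : Continuous φ) {η : Plane → ℝ} (hη : Continuous η)
    (hηc : HasCompactSupport η) (hηΩ : tsupport η ⊆ Ω) (e : Lifted) :
    ∫ p in cylinder Ω (maxValue γ L μp μm), η p.1 * φ p * pair e (F p) ∂lam
      = (m * e.1 0 - e.2) * ∫ x, η x * φ (x, m * x 0 + b + (1 - t) * c) := by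
  set M := maxValue γ L μp μm
  set w := superlevel (rampLift Ω γ L μp μm m b c) t with hwdef
  set k := m * e.1 0 - e.2 with hk
  set u : Plane → ℝ := fun x => m * x 0 + b + (1 - t) * c with hu
  have hw : IsNormalized M w := H.isNormalized.superlevel ht
  have hM : 0 ≤ M := H.c_pos.le.trans H.c_le_maxValue
  have hU := isOpen_liftedDomain Ω
  obtain ⟨θ, hθs, hθc, -, hθ01, hθ1⟩ := exists_contDiff_cutoff (isCompact_Icc (a := 0) (b := M))
    isOpen_univ (subset_univ _)
  have hθcont := hθs.continuous
  set Ψ : Lifted → ℝ := fun p => η p.1 * (θ p.2 * φ p) with hΨ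
  have hΨc : Continuous Ψ := by simp only [hΨ]; fun_prop
  have hcpt : IsCompact (tsupport η ×ˢ tsupport θ) := hηc.isCompact.prod hθc.isCompact
  have hΨ0 : ∀ p, p ∉ tsupport η ×ˢ tsupport θ → Ψ p = 0 := fun p hp => by
    rw [mem_prod, not_and_or] at hp
    rcases hp with hp | hp
    · simp [hΨ, image_eq_zero_of_notMem_tsupport hp]
    · simp [hΨ, image_eq_zero_of_notMem_tsupport hp]
  have hΨs : HasCompactSupport Ψ := HasCompactSupport.intro hcpt hΨ0
  have hΨU : tsupport Ψ ⊆ liftedDomain Ω := by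
    refine (closure_minimal (fun p hp => ?_) hcpt.isClosed).trans
      (prod_mono (hηΩ.trans (Metric.self_subset_thickening one_pos Ω)) (subset_univ _))
    by_contra h1
    exact hp (hΨ0 p h1)
  have hlim := h.tendsto_integral_mul_dq_of_continuous hU hw.measurable hw.abs_le hΨc hΨs hΨU e
  -- the left-hand side
  have hleft : ∫ p, Ψ p * pair e (F p) ∂lam
      = ∫ p in cylinder Ω M, η p.1 * φ p * pair e (F p) ∂lam := by
    rw [← integral_indicator (measurableSet_cylinder Ω M)]
    refine integral_congr_ae ?_
    filter_upwards [h.ae_pair_eq_zero hU hM hw e] with p hp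
    by_cases h1 : p ∈ cylinder Ω M
    · rw [indicator_of_mem h1]
      simp only [hΨ, hθ1 p.2 h1.2, one_mul]
    · rw [indicator_of_notMem h1]
      by_cases h2 : p.1 ∈ tsupport η
      · have h3 : p.2 ∉ Icc 0 M := fun h3 => h1 ⟨subset_closure (hηΩ h2), h3⟩
        rw [hp ⟨Metric.self_subset_thickening one_pos Ω (hηΩ h2), mem_univ _⟩ h3, mul_zero]
      · simp [hΨ, image_eq_zero_of_notMem_tsupport h2]
  rw [← hleft]
  refine tendsto_nhds_unique hlim ?_
  -- the difference quotients
  have hint : ∀ n : ℕ, Integrable fun p : Lifted => Ψ p * dq w e n p := fun n =>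
    (hΨc.integrable_of_hasCompactSupport hΨs).mul_bdd (c := ((n : ℝ) + 1) * 2)
      (measurable_dq hw.measurable _ n).aestronglyMeasurable
      (Eventually.of_forall fun p => abs_dq_le hw.abs_le _ n p)
  have hprod : ∀ n, ∫ p, Ψ p * dq w e n p = ∫ x : Plane, ∫ s : ℝ, Ψ (x, s) * dq w e n (x, s) :=
    fun n => by
      have := hint n
      rw [Measure.volume_eq_prod] at this ⊢
      exact integral_prod _ this
  simp_rw [hprod]
  obtain ⟨δ, hδ, hδΩ⟩ := hηc.isCompact.exists_thickening_subset_open H.isOpen hηΩ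
  have hqc : ∀ x, Continuous fun s => θ s * φ (x, s) := fun x => by fun_prop
  have hqi : ∀ x, Integrable fun s => θ s * φ (x, s) := fun x =>
    (hqc x).integrable_of_hasCompactSupport hθc.mul_right
  have hsmall : ∀ᶠ n : ℕ in atTop, ((n : ℝ) + 1)⁻¹ * ‖e.1‖ < δ := by
    have := tendsto_natCast_add_one_inv.mul_const ‖e.1‖
    rw [zero_mul] at this
    exact this.eventually_lt_const hδ
  -- On each vertical line the difference quotient lives between `u x` and `u x + k / (n + 1)`, once
  -- the step is small enough for the translated point to stay over `Ω`.
  have hfib : ∀ᶠ n : ℕ in atTop, ∀ x, ∫ s, Ψ (x, s) * dq w e n (x, s)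
      = η x * (((n : ℝ) + 1) * ∫ s in (u x)..(u x + ((n : ℝ) + 1)⁻¹ * k), θ s * φ (x, s)) := by
    filter_upwards [hsmall] with n hn x
    by_cases hx : x ∈ tsupport η
    · have hxΩ := hηΩ hx
      have hyΩ : x + ((n : ℝ) + 1)⁻¹ • e.1 ∈ Ω := by
        refine hδΩ (Metric.mem_thickening_iff.2 ⟨x, hx, ?_⟩)
        rw [dist_eq_norm, add_sub_cancel_left, norm_smul, Real.norm_eq_abs,
          abs_of_pos (by positivity)]
        exact hn
      rw [← integral_mul_ite_lt_sub (hqi x), ← integral_const_mul, ← integral_const_mul]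
      refine integral_congr_ae (Eventually.of_forall fun s => ?_)
      simp only [hΨ, dq, hwdef]
      have e1 : ((x, s) : Lifted) + ((n : ℝ) + 1)⁻¹ • e
          = (x + ((n : ℝ) + 1)⁻¹ • e.1, s + ((n : ℝ) + 1)⁻¹ * e.2) := by
        ext <;> simp
      have e2 : (s + ((n : ℝ) + 1)⁻¹ * e.2
            < m * (x + ((n : ℝ) + 1)⁻¹ • e.1) 0 + b + (1 - t) * c)
          = (s < u x + ((n : ℝ) + 1)⁻¹ * k) := by
        simp only [hu, hk, PiLp.add_apply, PiLp.smul_apply, smul_eq_mul]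
        exact propext ⟨fun h => by nlinarith, fun h => by nlinarith⟩
      rw [e1, H.superlevel_eq ht hxΩ, H.superlevel_eq ht hyΩ]
      simp only [e2]
      ring
    · simp [hΨ, image_eq_zero_of_notMem_tsupport hx]
  obtain ⟨C, hC⟩ := hcpt.exists_bound_of_continuousOn hφ.continuousOn
  have hC1 : ∀ x ∈ tsupport η, ∀ s, |θ s * φ (x, s)| ≤ |C| := fun x hx s => by
    by_cases hs : s ∈ tsupport θ
    · rw [abs_mul, abs_of_nonneg (hθ01 s).1]
      exact (mul_le_of_le_one_left (abs_nonneg _) (hθ01 s).2).trans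
        ((hC (x, s) ⟨hx, hs⟩).trans (le_abs_self C))
    · simp [image_eq_zero_of_notMem_tsupport hs]
  rw [← integral_const_mul]
  refine tendsto_integral_filter_of_dominated_convergence (fun x => |η x| * (|C| * |k|))
    (Eventually.of_forall fun n => ?_) ?_ ?_ (Eventually.of_forall fun x => ?_)
  · have := hint n
    rw [Measure.volume_eq_prod] at this
    exact this.aestronglyMeasurable.integral_prod_right'
  · filter_upwards [hfib] with n hn
    refine Eventually.of_forall fun x => ?_
    rw [hn x, norm_mul, Real.norm_eq_abs]
    by_cases hx : x ∈ tsupport η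
    · refine mul_le_mul_of_nonneg_left ?_ (abs_nonneg _)
      rw [Real.norm_eq_abs, abs_mul, abs_of_pos (by positivity : (0 : ℝ) < n + 1)]
      have h1 := intervalIntegral.norm_integral_le_of_norm_le_const (a := u x)
        (b := u x + ((n : ℝ) + 1)⁻¹ * k) (C := |C|) (f := fun s => θ s * φ (x, s))
        fun s _ => hC1 x hx s
      rw [add_sub_cancel_left, abs_mul, abs_of_pos (by positivity : (0 : ℝ) < ((n : ℝ) + 1)⁻¹),
        Real.norm_eq_abs] at h1
      calc ((n : ℝ) + 1) * _ ≤ (n + 1) * (|C| * (((n : ℝ) + 1)⁻¹ * |k|)) := by gcongr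
        _ = |C| * |k| := by field_simp
    · simp [image_eq_zero_of_notMem_tsupport hx]
  · exact (hη.integrable_of_hasCompactSupport hηc).abs.mul_const _
  · have h1 := (tendsto_mul_integral (hqc x) (u x) k).const_mul (η x)
    have h2 : η x * (k * (θ (u x) * φ (x, u x))) = k * (η x * φ (x, u x)) := by
      by_cases hx : x ∈ tsupport η
      · rw [hθ1 _ (H.level_mem ht (hηΩ hx))]; ring
      · simp [image_eq_zero_of_notMem_tsupport hx]
    rw [h2] at h1
    exact h1.congr' (hfib.mono fun n hn => (hn x).symm)

end

/-! ### Fields concentrated near a graph -/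

theorem IsTransportationCost.mul_le_of_le {τ : ℝ → ℝ} (hτ : IsTransportationCost τ) {a h₀ h : ℝ}
    (h0 : 0 < h₀) (ha : a * h₀ ≤ τ h₀) (hh : h ∈ Icc 0 h₀) : a * h ≤ τ h := by
  have h1 := hτ.concave.2 (show (0 : ℝ) ∈ Ici 0 by simp) (show h₀ ∈ Ici (0 : ℝ) from h0.le)
    (sub_nonneg.2 ((div_le_one h0).2 hh.2)) (div_nonneg hh.1 h0.le) (by ring)
  simp only [smul_eq_mul, hτ.zero, mul_zero, zero_add, div_mul_cancel₀ h h0.ne'] at h1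
  refine le_trans ?_ h1
  calc a * h = h / h₀ * (a * h₀) := by field_simp
    _ ≤ h / h₀ * τ h₀ := by
      have := div_nonneg hh.1 h0.le
      gcongr

/-- A slope between the average slope of `τ` on `[0, c]` and the slope at `0`. -/
theorem IsTransportationCost.exists_slope {τ : ℝ → ℝ} (hτ : IsTransportationCost τ) {c : ℝ}
    (hc : 0 < c) (h : ENNReal.ofReal (τ c) < rightDerivZero τ * ENNReal.ofReal c) :
    ∃ a h₀ : ℝ, 0 ≤ a ∧ 0 < h₀ ∧ τ c / c < a ∧ ENNReal.ofReal a ≤ rightDerivZero τ ∧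
      ∀ h ∈ Icc 0 h₀, a * h ≤ τ h := by
  have h1 : ENNReal.ofReal (τ c / c) < rightDerivZero τ := by
    rw [ENNReal.ofReal_div_of_pos hc]
    exact ENNReal.div_lt_of_lt_mul h
  obtain ⟨a, ha0, ha1, ha2⟩ := ENNReal.lt_iff_exists_real_btwn.1 h1
  -- Some difference quotient of `τ` at `0` exceeds `a`; concavity extends this to all smaller
  -- arguments.
  have h2 := frequently_lt_of_lt_limsup (by isBoundedDefault) (show _ < rightDerivZero τ from ha2)
  obtain ⟨h₀, h3, h4⟩ := (h2.and_eventually self_mem_nhdsWithin).exists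
  have h4 : 0 < h₀ := h4
  refine ⟨a, h₀, ha0, h4, ?_, ha2.le, fun h hh => hτ.mul_le_of_le h4 ?_ hh⟩
  · exact (ENNReal.ofReal_lt_ofReal_iff_of_nonneg (div_nonneg (hτ.nonneg c hc.le) hc.le)).1 ha1
  · have h5 := (ENNReal.ofReal_lt_ofReal_iff_of_nonneg ha0).1 h3
    exact ((lt_div_iff₀ h4).1 h5).le

/-- The tent function with support `[-r, r]` and maximum `1`. -/
noncomputable def tent (r s : ℝ) : ℝ := max 0 (1 - |s| / r)

theorem continuous_tent (r : ℝ) : Continuous (tent r) := by unfold tent; fun_prop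

theorem tent_zero (r : ℝ) : tent r 0 = 1 := by simp [tent]

theorem tent_nonneg (r s : ℝ) : 0 ≤ tent r s := le_max_left _ _

theorem tent_le_one {r : ℝ} (hr : 0 < r) (s : ℝ) : tent r s ≤ 1 :=
  max_le zero_le_one (by have : 0 ≤ |s| / r := by positivity
                         linarith)

theorem tent_eq_zero {r s : ℝ} (hr : 0 < r) (hs : r ≤ |s|) : tent r s = 0 :=
  max_eq_left (by linarith [(one_le_div hr).2 hs])

theorem integral_tent_le {r : ℝ} (hr : 0 < r) (u s₁ s₂ : ℝ) (h : s₁ ≤ s₂) :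
    ∫ s in s₁..s₂, tent r (s - u) ≤ min (s₂ - s₁) (2 * r) := by
  have hc : Continuous fun s => tent r (s - u) := (continuous_tent r).comp (by fun_prop)
  refine le_min ?_ ?_
  · have := intervalIntegral.integral_mono_on (μ := volume) (g := fun _ => (1 : ℝ)) h
      (hc.intervalIntegrable _ _) intervalIntegrable_const fun s _ => tent_le_one hr (s - u)
    simpa using this
  · have hsupp : ∀ s ∉ Icc (u - r) (u + r), tent r (s - u) = 0 := fun s hs => by
      refine tent_eq_zero hr (not_lt.1 fun h1 => hs ?_)
      rw [abs_lt] at h1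
      exact ⟨by linarith [h1.1], by linarith [h1.2]⟩
    have hi : Integrable fun s => tent r (s - u) :=
      hc.integrable_of_hasCompactSupport (HasCompactSupport.intro isCompact_Icc hsupp)
    rw [intervalIntegral.integral_of_le h]
    calc ∫ s in Ioc s₁ s₂, tent r (s - u) ≤ ∫ s, tent r (s - u) :=
          setIntegral_le_integral hi (Eventually.of_forall fun s => tent_nonneg r _)
      _ = ∫ s in Icc (u - r) (u + r), tent r (s - u) :=
          (setIntegral_eq_integral_of_forall_compl_eq_zero hsupp).symm
      _ ≤ ∫ s in Icc (u - r) (u + r), (1 : ℝ) :=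
          setIntegral_mono_on hi.integrableOn (by simp) measurableSet_Icc
            fun s _ => tent_le_one hr _
      _ = 2 * r := by
          rw [setIntegral_const]
          simp only [Measure.real, Real.volume_Icc, smul_eq_mul, mul_one]
          rw [ENNReal.toReal_ofReal (by linarith)]
          ring

theorem norm_smul_single {r : ℝ} (hr : 0 ≤ r) :
    ‖r • (EuclideanSpace.single 0 1 : Plane)‖ = r := by
  rw [norm_smul]; simp [abs_of_nonneg hr]

/-- Mixing an admissible field with a horizontal field concentrated near a graph. -/
theorem MemK.mix {Ω : Set Plane} {M : ℝ} {τ : ℝ → ℝ} (hτ : IsTransportationCost τ)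
    {φx : Lifted → Plane} {φs : Lifted → ℝ} (h : MemK Ω M τ φx φs) {a h₀ : ℝ} (ha0 : 0 ≤ a)
    (hh : 0 < h₀) (ha : ENNReal.ofReal a ≤ rightDerivZero τ) (hah : ∀ h ∈ Icc 0 h₀, a * h ≤ τ h)
    {η : Plane → ℝ} (hη : Continuous η) (hη1 : ∀ x, η x ∈ Icc (0 : ℝ) 1) {u : Plane → ℝ}
    (hu : Continuous u) :
    MemK Ω M τ (fun p => (1 - η p.1) • φx p
        + (η p.1 * (a * tent (h₀ / 2) (p.2 - u p.1))) • (EuclideanSpace.single 0 1 : Plane))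
      (fun p => (1 - η p.1) * φs p) where
  continuous_x := by
    have h1 := continuous_tent (h₀ / 2)
    have h2 : Continuous fun p : Lifted => (η p.1 * (a * tent (h₀ / 2) (p.2 - u p.1))) •
      (EuclideanSpace.single 0 1 : Plane) := by fun_prop
    have h3 : Continuous fun p : Lifted => 1 - η p.1 := by fun_prop
    exact (h3.continuousOn.smul h.continuous_x).add h2.continuousOn
  continuous_s := by
    have h3 : Continuous fun p : Lifted => 1 - η p.1 := by fun_prop
    exact h3.continuousOn.mul h.continuous_s
  bound p hp := by
    have h1 := hη1 p.1
    have h2 : 0 ≤ 1 - η p.1 := by linarith [h1.2]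
    have h3 := tent_nonneg (h₀ / 2) (p.2 - u p.1)
    have h4 : tent (h₀ / 2) (p.2 - u p.1) ≤ 1 := tent_le_one (by positivity) _
    refine (enorm_add_le _ _).trans ?_
    rw [enorm_smul, ← ofReal_norm (_ • EuclideanSpace.single 0 1),
      norm_smul_single (mul_nonneg h1.1 (mul_nonneg ha0 h3)), Real.enorm_eq_ofReal h2,
      ENNReal.ofReal_mul h1.1]
    calc ENNReal.ofReal (1 - η p.1) * ‖φx p‖ₑ + ENNReal.ofReal (η p.1)
          * ENNReal.ofReal (a * tent (h₀ / 2) (p.2 - u p.1))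
        ≤ ENNReal.ofReal (1 - η p.1) * rightDerivZero τ
          + ENNReal.ofReal (η p.1) * rightDerivZero τ := by
          gcongr
          · exact h.bound p hp
          · exact (ENNReal.ofReal_le_ofReal (mul_le_of_le_one_right ha0 h4)).trans ha
      _ = rightDerivZero τ := by
          rw [← add_mul, ← ENNReal.ofReal_add h2 h1.1]
          simp
  nonneg p hp := mul_nonneg (by linarith [(hη1 p.1).2]) (h.nonneg p hp)
  integral_bound x hx s₁ s₂ h1 h2 h3 := by
    have g1 := hη1 x
    have hc : ContinuousOn (fun s => φx (x, s)) (uIcc s₁ s₂) := by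
      rw [uIcc_of_le h2.le]
      exact h.continuous_x.comp (by fun_prop) fun s hs => ⟨hx, h1.trans hs.1, hs.2.trans h3⟩
    have ht := continuous_tent (h₀ / 2)
    have i1 : IntervalIntegrable (fun s => (1 - η x) • φx (x, s)) volume s₁ s₂ :=
      hc.intervalIntegrable.smul (1 - η x)
    have hc2 : Continuous fun s => (η x * (a * tent (h₀ / 2) (s - u x))) •
        (EuclideanSpace.single 0 1 : Plane) := by fun_prop
    rw [intervalIntegral.integral_add i1 (hc2.intervalIntegrable _ _), intervalIntegral.integral_smul,
      intervalIntegral.integral_smul_const]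
    have e1 : ∫ s in s₁..s₂, η x * (a * tent (h₀ / 2) (s - u x))
        = η x * (a * ∫ s in s₁..s₂, tent (h₀ / 2) (s - u x)) := by
      rw [intervalIntegral.integral_const_mul, intervalIntegral.integral_const_mul]
    have g2 : 0 ≤ ∫ s in s₁..s₂, tent (h₀ / 2) (s - u x) :=
      intervalIntegral.integral_nonneg h2.le fun s _ => tent_nonneg _ _
    have g3 := integral_tent_le (half_pos hh) (u x) s₁ s₂ h2.le
    rw [mul_div_cancel₀ h₀ two_ne_zero] at g3
    -- A tent of half-width `h₀ / 2` and height at most `1` has integral at most the smaller of the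
    -- interval length and `h₀`. Short intervals use the slope `a`, long ones `a h₀ ≤ τ(h₀)` and
    -- monotonicity.
    have g4 : a * ∫ s in s₁..s₂, tent (h₀ / 2) (s - u x) ≤ τ (s₂ - s₁) := by
      refine (mul_le_mul_of_nonneg_left g3 ha0).trans ?_
      rcases le_total (s₂ - s₁) h₀ with h4 | h4
      · rw [min_eq_left h4]
        exact hah _ ⟨by linarith, h4⟩
      · rw [min_eq_right h4]
        exact (hah h₀ ⟨hh.le, le_rfl⟩).trans (hτ.mono hh.le (hh.le.trans h4) h4)
    refine (norm_add_le _ _).trans ?_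
    rw [e1, norm_smul_single (mul_nonneg g1.1 (mul_nonneg ha0 g2)), norm_smul, Real.norm_eq_abs,
      abs_of_nonneg (by linarith [g1.2] : 0 ≤ 1 - η x)]
    have g5 := h.integral_bound x hx s₁ s₂ h1 h2 h3
    calc (1 - η x) * ‖∫ s in s₁..s₂, φx (x, s)‖
          + η x * (a * ∫ s in s₁..s₂, tent (h₀ / 2) (s - u x))
        ≤ (1 - η x) * τ (s₂ - s₁) + η x * τ (s₂ - s₁) := by
          gcongr
          · linarith [g1.2]
          · exact g1.1
      _ = τ (s₂ - s₁) := by ring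

/-! ### The gain on each level and strict inequality -/

section

variable {Ω : Set Plane} {γ : ℝ → Plane} {L : ℝ} {μp μm : Measure Plane} {m b c : ℝ}

/-- Over the support of `η` only values on the graph count. There the tent equals `1`, so the first
component is replaced by `a` with weight `η`; the second does not contribute, and damping the
nonnegative vertical component can only increase the flux. -/
theorem RampSetting.flux_add_le_flux_mix (H : RampSetting Ω γ L μp μm m b c) {t : ℝ}
    (ht : t ∈ Ioo (0 : ℝ) 1) {lam : Measure Lifted} {F : Lifted → Lifted}
    (h : HasGrad (liftedDomain Ω) (superlevel (rampLift Ω γ L μp μm m b c) t) lam F) {τ : ℝ → ℝ}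
    {φx : Lifted → Plane} {φs : Lifted → ℝ} (hφ : MemK Ω (maxValue γ L μp μm) τ φx φs) (a r : ℝ)
    {η : Plane → ℝ} (hη : Continuous η) (hη0 : ∀ x, 0 ≤ η x)
    (hηc : HasCompactSupport η) (hηΩ : tsupport η ⊆ Ω) :
    flux (cylinder Ω (maxValue γ L μp μm)) lam F φx φs
      + m * ∫ x, η x * (a - extend Ω (maxValue γ L μp μm) (fun p => φx p 0)
          (x, m * x 0 + b + (1 - t) * c))
      ≤ flux (cylinder Ω (maxValue γ L μp μm)) lam F
        (fun p => (1 - η p.1) • φx p + (η p.1 * (a * tent r (p.2 - (m * p.1 0 + b + (1 - t) * c)))) •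
          (EuclideanSpace.single 0 1 : Plane)) fun p => (1 - η p.1) * φs p := by
  set M := maxValue γ L μp μm
  set u : Plane → ℝ := fun x => m * x 0 + b + (1 - t) * c with hu
  have hM : 0 ≤ M := H.c_pos.le.trans H.c_le_maxValue
  have hK := isCompact_cylinder H.bounded M
  have hKm := measurableSet_cylinder Ω M
  have huc : Continuous u := by
    have := continuous_apply_zero
    simp only [hu]; fun_prop
  have htc := continuous_tent r
  have hηp : Continuous fun p : Lifted => 1 - η p.1 := by fun_prop
  have hxi : ∀ i : Fin 2, ContinuousOn (fun p => φx p i) (cylinder Ω M) := fun i =>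
    (EuclideanSpace.proj (𝕜 := ℝ) i : Plane →L[ℝ] ℝ).continuous.comp_continuousOn hφ.continuous_x
  have hψc : Continuous fun p : Lifted => a * tent r (p.2 - u p.1) := by fun_prop
  have hψ : Continuous fun p : Lifted => η p.1 * (a * tent r (p.2 - u p.1)) := by fun_prop
  have J : ∀ φ : Lifted → ℝ, ContinuousOn φ (cylinder Ω M) → ∀ e : Lifted,
      ∫ p in cylinder Ω M, (1 - η p.1) * φ p * pair e (F p) ∂lam
        = (∫ p in cylinder Ω M, φ p * pair e (F p) ∂lam)
          - (m * e.1 0 - e.2) * ∫ x, η x * extend Ω M φ (x, u x) := fun φ hφc e => by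
    have hE := continuous_extend H.convex H.nonempty hM hφc
    rw [← H.integral_level ht h hE hη hηc hηΩ e]
    have hηE : Continuous fun p : Lifted => η p.1 * extend Ω M φ p := by fun_prop
    rw [← integral_sub (integrableOn_mul_pair h.integrable e hK hφc)
      (integrableOn_mul_pair h.integrable e hK hηE.continuousOn)]
    refine setIntegral_congr_fun hKm fun p hp => ?_
    simp only [extend_eq H.convex hp]
    ring
  have Jt := H.integral_level ht h hψc hη hηc hηΩ (ex 0)
  have hηi := hη.integrable_of_hasCompactSupport hηc (μ := volume)
  have hmix : ContinuousOn (fun p => (1 - η p.1) • φx p + (η p.1 * (a * tent r (p.2 - u p.1))) •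
          (EuclideanSpace.single 0 1 : Plane)) (cylinder Ω M) :=
    (hηp.continuousOn.smul hφ.continuous_x).add (hψ.smul continuous_const).continuousOn
  have hsx : ContinuousOn (fun p => (1 - η p.1) * φs p) (cylinder Ω M) :=
    hηp.continuousOn.mul hφ.continuous_s
  change _ + m * ∫ x, η x * (a - extend Ω M (fun p => φx p 0) (x, u x)) ≤
    flux (cylinder Ω M) lam F (fun p => (1 - η p.1) • φx p
      + (η p.1 * (a * tent r (p.2 - u p.1))) • (EuclideanSpace.single 0 1 : Plane))
      fun p => (1 - η p.1) * φs p
  rw [flux_eq_sum h.integrable hK hφ.continuous_x hφ.continuous_s,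
    flux_eq_sum h.integrable hK hmix hsx]
  have e0 : ∫ p in cylinder Ω M, ((1 - η p.1) • φx p + (η p.1 * (a * tent r (p.2 - u p.1))) •
          (EuclideanSpace.single 0 1 : Plane)) 0 * pair (ex 0) (F p) ∂lam
      = (∫ p in cylinder Ω M, (1 - η p.1) * φx p 0 * pair (ex 0) (F p) ∂lam)
        + ∫ p in cylinder Ω M, η p.1 * (a * tent r (p.2 - u p.1)) * pair (ex 0) (F p) ∂lam := by
    rw [← integral_add (integrableOn_mul_pair h.integrable _ hK
      (φ := fun p => (1 - η p.1) * φx p 0) (hηp.continuousOn.mul (hxi 0))) (integrableOn_mul_pair h.integrable _ hK hψ.continuousOn)]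
    refine integral_congr_ae (Eventually.of_forall fun p => ?_)
    simp
    ring
  have e1 : ∫ p in cylinder Ω M, ((1 - η p.1) • φx p + (η p.1 * (a * tent r (p.2 - u p.1))) •
          (EuclideanSpace.single 0 1 : Plane)) 1 * pair (ex 1) (F p) ∂lam
      = ∫ p in cylinder Ω M, (1 - η p.1) * φx p 1 * pair (ex 1) (F p) ∂lam := by
    refine integral_congr_ae (Eventually.of_forall fun p => ?_)
    simp
  rw [e0, e1, J _ (hxi 0), J _ (hxi 1), J _ hφ.continuous_s, Jt]
  have k0 : m * (ex 0).1 0 - (ex 0).2 = m := by simp [ex]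
  have k1 : m * (ex 1).1 0 - (ex 1).2 = 0 := by simp [ex]
  have k2 : m * es.1 0 - es.2 = -1 := by simp [es]
  rw [k0, k1, k2]
  have hs0 : 0 ≤ ∫ x, η x * extend Ω M φs (x, u x) := integral_nonneg fun x =>
    mul_nonneg (hη0 x) (hφ.nonneg _ (extend_mapsTo H.convex H.nonempty hM _))
  have hE0 := continuous_extend H.convex H.nonempty hM (hxi 0)
  have hEu : Continuous fun x => η x * extend Ω M (fun p => φx p 0) (x, u x) := by fun_prop
  have hsplit : ∫ x, η x * (a - extend Ω M (fun p => φx p 0) (x, u x))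
      = (∫ x, η x * a) - ∫ x, η x * extend Ω M (fun p => φx p 0) (x, u x) := by
    rw [← integral_sub (hηi.mul_const a)
      (hEu.integrable_of_hasCompactSupport hηc.mul_right)]
    refine integral_congr_ae (Eventually.of_forall fun x => ?_)
    simp only
    ring
  rw [hsplit]
  have ht1 : ∫ x, η x * (a * tent r (m * x 0 + b + (1 - t) * c - u x)) = ∫ x, η x * a := by
    simp [tent_zero, hu]
  simp only [ht1]
  linarith

/-- The average over the levels of a field on the graphs `m x₁ + b + (1 - t) c`. -/
theorem RampSetting.integral_level_le (H : RampSetting Ω γ L μp μm m b c) {τ : ℝ → ℝ}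
    (hτ : IsTransportationCost τ)
    {φx : Lifted → Plane} {φs : Lifted → ℝ} (hφ : MemK Ω (maxValue γ L μp μm) τ φx φs) {a : ℝ}
    {η : Plane → ℝ} (hη : Continuous η) (hη0 : ∀ x, 0 ≤ η x)
    (hηc : HasCompactSupport η) (hηΩ : tsupport η ⊆ Ω) :
    IntegrableOn (fun t => ∫ x, η x * (a - extend Ω (maxValue γ L μp μm) (fun p => φx p 0)
      (x, m * x 0 + b + (1 - t) * c))) (Ioo 0 1) ∧
    (a - τ c / c) * ∫ x, η x
      ≤ ∫ t in Ioo (0 : ℝ) 1, ∫ x, η x * (a - extend Ω (maxValue γ L μp μm) (fun p => φx p 0)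
      (x, m * x 0 + b + (1 - t) * c)) := by
  set M := maxValue γ L μp μm
  have hM : 0 ≤ M := H.c_pos.le.trans H.c_le_maxValue
  have hc := H.c_pos
  have hxi : ContinuousOn (fun p => φx p 0) (cylinder Ω M) :=
    (EuclideanSpace.proj (𝕜 := ℝ) (0 : Fin 2) : Plane →L[ℝ] ℝ).continuous.comp_continuousOn
      hφ.continuous_x
  have hE := continuous_extend H.convex H.nonempty hM hxi
  set E := extend Ω M fun p => φx p 0
  have h0 := continuous_apply_zero
  obtain ⟨C, hC⟩ := (isCompact_cylinder H.bounded M).exists_bound_of_continuousOn hxi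
  have hEC : ∀ p, |E p| ≤ C := fun p => hC _ (extend_mapsTo H.convex H.nonempty hM p)
  have hηi := hη.integrable_of_hasCompactSupport hηc (μ := volume)
  have hint : Integrable (fun z : ℝ × Plane =>
      η z.2 * (a - E (z.2, m * z.2 0 + b + (1 - z.1) * c)))
      ((volume.restrict (Ioo (0 : ℝ) 1)).prod volume) := by
    refine (hηi.comp_snd _).mul_bdd (c := |a| + C)
      (Continuous.aestronglyMeasurable (by fun_prop)) (Eventually.of_forall fun z => ?_)
    exact (abs_sub _ _).trans (add_le_add le_rfl (hEC _))
  refine ⟨hint.integral_prod_left, ?_⟩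
  rw [integral_integral_swap hint, ← integral_const_mul]
  refine integral_mono (hηi.const_mul _) hint.integral_prod_right fun x => ?_
  simp only
  rw [integral_const_mul, mul_comm]
  by_cases hx : x ∈ tsupport η
  swap
  · simp [image_eq_zero_of_notMem_tsupport hx]
  refine mul_le_mul_of_nonneg_left ?_ (hη0 x)
  have hEx : Continuous fun t : ℝ => E (x, m * x 0 + b + (1 - t) * c) := by fun_prop
  have hxΩ := hηΩ hx
  have hr := H.range x hxΩ
  -- As `t` varies the graph sweeps a vertical segment of length `c`, and the field has mean at most
  -- `τ c / c` on it.
  have e1 : ∫ t in Ioo (0 : ℝ) 1, E (x, m * x 0 + b + (1 - t) * c)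
      = c⁻¹ * ∫ s in (m * x 0 + b)..(m * x 0 + b + c), φx (x, s) 0 := by
    rw [← integral_Ioc_eq_integral_Ioo, ← intervalIntegral.integral_of_le zero_le_one]
    have h1 := intervalIntegral.integral_comp_sub_left (a := 0) (b := 1)
      (fun t => E (x, m * x 0 + b + t * c)) 1
    rw [sub_self, sub_zero] at h1
    rw [h1]
    have h2 := intervalIntegral.integral_comp_add_mul (a := 0) (b := 1) (fun s => E (x, s)) hc.ne'
      (m * x 0 + b)
    rw [mul_zero, mul_one, add_zero] at h2
    simp_rw [mul_comm _ c]
    rw [h2, smul_eq_mul]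
    congr 1
    refine intervalIntegral.integral_congr fun s hs => ?_
    rw [uIcc_of_le (by linarith)] at hs
    exact extend_eq H.convex ⟨subset_closure hxΩ, hr.1.trans hs.1, hs.2.trans hr.2⟩
  have h2 := hφ.abs_integral_le hτ (subset_closure hxΩ) 0 hr.1
    (show m * x 0 + b ≤ m * x 0 + b + c by linarith) hr.2
  rw [add_sub_cancel_left] at h2
  rw [integral_sub (by simp) ((hEx.integrableOn_Icc (a := 0) (b := 1)).mono_set
    Ioo_subset_Icc_self), e1]
  have h3 : c⁻¹ * ∫ s in (m * x 0 + b)..(m * x 0 + b + c), φx (x, s) 0 ≤ τ c / c := by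
    rw [div_eq_inv_mul]
    gcongr
    exact (le_abs_self _).trans h2
  simp
  linarith

/-- Every admissible field is improved separately on each level by mixing in a tent around its
graph. The averaged gain is bounded below independently of the field, so it survives the supremum.
-/
theorem RampSetting.convexCost_lt (H : RampSetting Ω γ L μp μm m b c) {τ : ℝ → ℝ}
    (hτ : IsTransportationCost τ)
    (hslope : ENNReal.ofReal (τ c) < rightDerivZero τ * ENNReal.ofReal c) :
    convexCost Ω (maxValue γ L μp μm) τ (rampLift Ω γ L μp μm m b c)
      < ∫⁻ t in Ioo (0 : ℝ) 1,
        convexCost Ω (maxValue γ L μp μm) τ (superlevel (rampLift Ω γ L μp μm m b c) t) := by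
  set M := maxValue γ L μp μm
  set w := rampLift Ω γ L μp μm m b c with hwdef
  have hw := H.isNormalized
  have hm := H.m_pos
  obtain ⟨a, h₀, ha0, hh₀, hac, haτ, hah⟩ := hτ.exists_slope H.c_pos hslope
  obtain ⟨lam, F, hF⟩ := H.exists_hasGrad
  obtain ⟨lam', F', hF'⟩ := hw.exists_hasLevelGrads H.bounded hF
  obtain ⟨A, hA⟩ := H.exists_flux_le hF hτ
  have hcyl := isCompact_cylinder H.bounded M
  have hcU := cylinder_subset_liftedDomain Ω M
  obtain ⟨x₀, hx₀⟩ := H.nonempty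
  obtain ⟨η, hηs, hηc, hηΩ, hη1, hηx⟩ := exists_contDiff_cutoff (isCompact_singleton (x := x₀))
    H.isOpen (singleton_subset_iff.2 hx₀)
  have hη := hηs.continuous
  have hη0 : ∀ x, 0 ≤ η x := fun x => (hη1 x).1
  have hηpos : 0 < ∫ x, η x :=
    hη.integral_pos_of_hasCompactSupport_nonneg_nonzero hηc hη0 (x := x₀)
      (by simp [hηx x₀ rfl])
  set g := m * ((a - τ c / c) * ∫ x, η x) with hg
  have hg0 : 0 < g := mul_pos hm (mul_pos (by linarith) hηpos)
  set I := ∫⁻ t in Ioo (0 : ℝ) 1, convexCost Ω M τ (superlevel w t) with hI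
  have hcost : ∀ᵐ t ∂(volume.restrict (Ioo (0 : ℝ) 1)), convexCost Ω M τ (superlevel w t)
      = ⨆ (φx : Lifted → Plane) (φs : Lifted → ℝ) (_ : MemK Ω M τ φx φs),
      ENNReal.ofReal (flux (cylinder Ω M) (lam' t) (F' t) φx φs) := by
    filter_upwards [hF'.hasGrad, ae_restrict_mem measurableSet_Ioo] with t ht ht1
    exact convexCost_eq H.bounded ht ((hw.superlevel ht1).locallyIntegrable.locallyIntegrableOn _)
  have hgain : ∀ φx φs, MemK Ω M τ φx φs →
      ENNReal.ofReal (flux (cylinder Ω M) lam F φx φs + g) ≤ I := by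
    intro φx φs hφ
    obtain ⟨hi, he⟩ := hF'.integral_flux hw hF hcyl hcU hφ.continuous_x hφ.continuous_s
    obtain ⟨hj, hje⟩ := H.integral_level_le hτ hφ (a := a) hη hη0 hηc hηΩ
    have hij : IntegrableOn (fun t => flux (cylinder Ω M) (lam' t) (F' t) φx φs
        + m * ∫ x, η x * (a - extend Ω M (fun p => φx p 0) (x, m * x 0 + b + (1 - t) * c)))
        (Ioo 0 1) := hi.add (hj.const_mul m)
    calc ENNReal.ofReal (flux (cylinder Ω M) lam F φx φs + g)
        ≤ ENNReal.ofReal (∫ t in Ioo (0 : ℝ) 1, (flux (cylinder Ω M) (lam' t) (F' t) φx φs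
          + m * ∫ x, η x * (a - extend Ω M (fun p => φx p 0)
            (x, m * x 0 + b + (1 - t) * c)))) := by
          refine ENNReal.ofReal_le_ofReal ?_
          rw [integral_add hi (hj.const_mul m), he, integral_const_mul]
          exact add_le_add le_rfl (mul_le_mul_of_nonneg_left hje hm.le)
      _ ≤ ∫⁻ t in Ioo (0 : ℝ) 1, ENNReal.ofReal (flux (cylinder Ω M) (lam' t) (F' t) φx φs
          + m * ∫ x, η x * (a - extend Ω M (fun p => φx p 0)
            (x, m * x 0 + b + (1 - t) * c))) := by
          rw [integral_eq_lintegral_pos_part_sub_lintegral_neg_part hij]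
          exact (ENNReal.ofReal_le_ofReal (sub_le_self _ ENNReal.toReal_nonneg)).trans
            ENNReal.ofReal_toReal_le
      _ ≤ I := by
          refine lintegral_mono_ae ?_
          filter_upwards [hcost, hF'.hasGrad, ae_restrict_mem measurableSet_Ioo] with t h1 h2 h3
          rw [h1]
          have huc : Continuous fun x : Plane => m * x 0 + b + (1 - t) * c := by
            have := continuous_apply_zero
            fun_prop
          exact le_iSup_of_le _ (le_iSup_of_le _ (le_iSup_of_le
            (hφ.mix hτ ha0 hh₀ haτ hah hη hη1 huc) (ENNReal.ofReal_le_ofReal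
              (H.flux_add_le_flux_mix h3 h2 hφ a (h₀ / 2) hη hη0 hηc hηΩ))))
  rw [convexCost_eq H.bounded hF (hw.locallyIntegrable.locallyIntegrableOn _)]
  -- A gain alone is void if both sides are infinite; this case is settled by the finite cost of the
  -- averaged function.
  by_cases hItop : I = ⊤
  · rw [hItop]
    refine lt_of_le_of_lt (b := ENNReal.ofReal A) ?_ ENNReal.ofReal_lt_top
    exact iSup_le fun φx => iSup_le fun φs => iSup_le fun hφ =>
      ENNReal.ofReal_le_ofReal (hA φx φs hφ)
  · have h1 : ∀ φx φs, MemK Ω M τ φx φs → flux (cylinder Ω M) lam F φx φs + g ≤ I.toReal :=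
      fun φx φs hφ => (ENNReal.ofReal_le_iff_le_toReal hItop).1 (hgain φx φs hφ)
    have h2 := h1 _ _ (memK_zero hτ)
    have h3 : flux (cylinder Ω M) lam F (fun _ => 0) (fun _ => 0) = 0 := by simp [flux, pair]
    rw [h3, zero_add] at h2
    refine lt_of_le_of_lt (b := ENNReal.ofReal (I.toReal - g)) ?_ ?_
    · exact iSup_le fun φx => iSup_le fun φs => iSup_le fun hφ =>
        ENNReal.ofReal_le_ofReal (by linarith [h1 φx φs hφ])
    · rw [ENNReal.ofReal_lt_iff_lt_toReal (by linarith) hItop]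
      linarith

theorem RampSetting.averagedLift_strict (H : RampSetting Ω γ L μp μm m b c) {τ : ℝ → ℝ}
    (hτ : IsTransportationCost τ)
    (hslope : ENNReal.ofReal (τ c) < rightDerivZero τ * ENNReal.ofReal c) :
    MemC Ω γ L μp μm (averagedLift Ω γ L μp μm m b c) ∧
      convexCost Ω (maxValue γ L μp μm) τ (averagedLift Ω γ L μp μm m b c)
        < ∫⁻ t in Ioo (0 : ℝ) 1, convexCost Ω (maxValue γ L μp μm) τ
            (superlevel (averagedLift Ω γ L μp μm m b c) t) := by
  have h := H.ae_eq_averagedLift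
  refine ⟨H.memC.congr h, ?_⟩
  rw [← convexCost_congr h]
  simp_rw [← convexCost_congr (superlevel_congr h _)]
  exact H.convexCost_lt hτ hslope

end

/-! ### Costs that are not linear -/

theorem IsTransportationCost.le_rightDerivZero {τ : ℝ → ℝ} (hτ : IsTransportationCost τ) {c : ℝ}
    (hc : 0 < c) : ENNReal.ofReal (τ c / c) ≤ rightDerivZero τ := by
  have h1 : ∀ᶠ h : ℝ in 𝓝[>] 0, ENNReal.ofReal (τ c / c) ≤ ENNReal.ofReal (τ h / h) := by
    filter_upwards [Ioc_mem_nhdsGT hc] with h hh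
    refine ENNReal.ofReal_le_ofReal ((le_div_iff₀ hh.1).2 ?_)
    exact hτ.mul_le_of_le hc (by rw [div_mul_cancel₀ _ hc.ne']) ⟨hh.1.le, hh.2⟩
  exact le_limsup_of_frequently_le h1.frequently

/-- Otherwise `τ(c) / c` equals `τ'(0)` for all `c` in `(0, M)`, which makes `τ` linear there. The
open interval leaves `c < M`, hence room for a positive slope `m`. -/
theorem IsTransportationCost.exists_lt_of_not_linear {τ : ℝ → ℝ} (hτ : IsTransportationCost τ)
    {M : ℝ} (h : ¬ ∃ α : ℝ, ∀ s ∈ Icc 0 M, τ s = α * s) :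
    ∃ c ∈ Ioo 0 M, ENNReal.ofReal (τ c) < rightDerivZero τ * ENNReal.ofReal c := by
  by_contra! hcon
  refine h ?_
  rcases le_or_gt M 0 with hM | hM
  · refine ⟨0, fun s hs => ?_⟩
    rw [le_antisymm (hs.2.trans hM) hs.1, hτ.zero, mul_zero]
  have h1 : ∀ c ∈ Ioo 0 M, rightDerivZero τ = ENNReal.ofReal (τ c / c) := fun c hc => by
    refine le_antisymm ?_ (hτ.le_rightDerivZero hc.1)
    rw [ENNReal.ofReal_div_of_pos hc.1,
      ENNReal.le_div_iff_mul_le (Or.inl (by simpa using hc.1)) (Or.inl ENNReal.ofReal_ne_top)]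
    exact hcon c hc
  set α := (rightDerivZero τ).toReal with hα
  have hα0 : 0 ≤ α := ENNReal.toReal_nonneg
  have h2 : ∀ c ∈ Ioo 0 M, τ c = α * c := fun c hc => by
    rw [hα, h1 c hc, ENNReal.toReal_ofReal (div_nonneg (hτ.nonneg c hc.1.le) hc.1.le),
      div_mul_cancel₀ _ hc.1.ne']
  refine ⟨α, fun s hs => ?_⟩
  rcases hs.1.eq_or_lt with rfl | hs0
  · rw [hτ.zero, mul_zero]
  rcases hs.2.lt_or_eq with hsM | rfl
  · exact h2 s ⟨hs0, hsM⟩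
  -- At the right end of the interval the upper bound comes from concavity and the lower bound from
  -- monotonicity.
  refine le_antisymm ?_ ?_
  · have h3 := hτ.mul_le_of_le hs0 (a := τ s / s) (by rw [div_mul_cancel₀ _ hs0.ne'])
      (h := s / 2) ⟨by linarith, by linarith⟩
    rw [h2 (s / 2) ⟨by linarith, by linarith⟩] at h3
    exact (div_le_iff₀ hs0).1 (le_of_mul_le_mul_right h3 (half_pos hs0))
  · by_contra! h3
    have h4 := hτ.nonneg s hs0.le
    have hαpos : 0 < α := hα0.lt_of_ne' fun h5 => by rw [h5, zero_mul] at h3; linarith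
    have h5 : τ s / α < s := (div_lt_iff₀ hαpos).2 (by linarith)
    have h6 : 0 ≤ τ s / α := div_nonneg h4 hα0
    have h7 : (τ s / α + s) / 2 ∈ Ioo 0 s := ⟨by linarith, by linarith⟩
    have h8 := hτ.mono h7.1.le hs0.le h7.2.le
    rw [h2 _ h7] at h8
    have h9 : α * (τ s / α) = τ s := mul_div_cancel₀ _ hαpos.ne'
    nlinarith

theorem exists_affine_between {Ω : Set Plane} (hΩb : Bornology.IsBounded Ω) {c M : ℝ}
    (hcM : c < M) : ∃ m b : ℝ, 0 < m ∧ ∀ x ∈ Ω, 0 ≤ m * x 0 + b ∧ m * x 0 + b + c ≤ M := by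
  obtain ⟨R, hR, hΩR⟩ := hΩb.exists_pos_norm_le
  have hd : 0 < M - c := by linarith
  -- With `|x₁| ≤ R` the linear part deviates by at most `(M - c) / 2`, so the image stays in `[0, M
  -- - c]`.
  refine ⟨(M - c) / (2 * R), (M - c) / 2, by positivity, fun x hx => ?_⟩
  have h2 : |(M - c) / (2 * R) * x 0| ≤ (M - c) / 2 := by
    rw [abs_mul, abs_of_pos (by positivity : 0 < (M - c) / (2 * R))]
    calc (M - c) / (2 * R) * |x 0| ≤ (M - c) / (2 * R) * R := by
          gcongr
          exact (abs_apply_le_norm x 0).trans (hΩR x hx)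
      _ = (M - c) / 2 := by field_simp
  have h3 := abs_le.1 h2
  constructor <;> linarith [h3.1, h3.2]

/-- Strict inequality for some function when `τ` is not linear up to the maximal value. -/
theorem exists_convexCost_lt {Ω : Set Plane} (hΩo : IsOpen Ω) (hΩc : Convex ℝ Ω)
    (hΩb : Bornology.IsBounded Ω) (hΩn : Ω.Nonempty) {γ : ℝ → Plane} {L : ℝ}
    (hγ : IsArclengthParam Ω γ L) {τ : ℝ → ℝ} (hτ : IsTransportationCost τ) {μp μm : Measure Plane}
    (hμ : IsSourceSink Ω μp μm)
    (h : ¬ ∃ α : ℝ, ∀ s ∈ Icc 0 (maxValue γ L μp μm), τ s = α * s) :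
    ∃ v : Lifted → ℝ, MemC Ω γ L μp μm v ∧
      convexCost Ω (maxValue γ L μp μm) τ v
        < ∫⁻ t in Ioo (0 : ℝ) 1, convexCost Ω (maxValue γ L μp μm) τ (superlevel v t) := by
  obtain ⟨c, hc, hlt⟩ := hτ.exists_lt_of_not_linear h
  obtain ⟨m, b, hm, hr⟩ := exists_affine_between hΩb hc.2
  have H : RampSetting Ω γ L μp μm m b c := ⟨hΩo, hΩc, hΩb, hΩn, hγ, hμ, hm, hc.1, hr⟩
  exact ⟨_, H.averagedLift_strict hτ hlt⟩

/-! ### Point masses with prescribed maximal value -/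

section

variable {Ω : Set Plane} {γ : ℝ → Plane} {L : ℝ}

theorem isSourceSink_dirac (hγ : IsArclengthParam Ω γ L) (R : ℝ) :
    IsSourceSink Ω (ENNReal.ofReal R • Measure.dirac (γ 0))
      (ENNReal.ofReal R • Measure.dirac (γ (L / 2))) := by
  have hL := hγ.pos
  have h1 := hγ.bijOn.mapsTo (show (0 : ℝ) ∈ Ico 0 L from ⟨le_rfl, hL⟩)
  have h2 := hγ.bijOn.mapsTo (show L / 2 ∈ Ico 0 L from ⟨by linarith, by linarith⟩)
  refine ⟨Measure.smul_finite _ ENNReal.ofReal_ne_top, Measure.smul_finite _ ENNReal.ofReal_ne_top,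
    ?_, ?_, by simp⟩
  · simp [h1]
  · simp [h2]

/-- The arcs are half-open, so the net mass is `0` at parameter `0`, is `R` on `(0, L / 2]`, and
returns to `0` afterwards; the maximum is attained at `L / 2`. -/
theorem maxValue_dirac (hγ : IsArclengthParam Ω γ L) {R : ℝ} (hR : 0 ≤ R) :
    maxValue γ L (ENNReal.ofReal R • Measure.dirac (γ 0))
      (ENNReal.ofReal R • Measure.dirac (γ (L / 2))) = R := by
  have hL := hγ.pos
  have hmem0 : (0 : ℝ) ∈ Ico 0 L := ⟨le_rfl, hL⟩
  have hmem2 : L / 2 ∈ Ico 0 L := ⟨by linarith, by linarith⟩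
  have hd : ∀ (x : Plane) (S : Set Plane),
      (ENNReal.ofReal R • Measure.dirac x).real S = R * S.indicator 1 x := fun x S => by
    rw [measureReal_ennreal_smul_apply, ENNReal.toReal_ofReal hR, Measure.real,
      Measure.dirac_apply]
    by_cases hx : x ∈ S <;> simp [hx]
  set N := netMass γ (ENNReal.ofReal R • Measure.dirac (γ 0))
    (ENNReal.ofReal R • Measure.dirac (γ (L / 2))) with hN
  have hNt : ∀ t, N t = R * (γ '' Ico 0 t).indicator 1 (γ 0)
      - R * (γ '' Ico 0 t).indicator 1 (γ (L / 2)) := fun t => by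
    rw [hN, netMass, hd, hd]
  have hb : ∀ t ∈ Ico 0 L, N t ∈ Icc 0 R := fun t ht => by
    rw [hNt]
    by_cases h2 : γ (L / 2) ∈ γ '' Ico 0 t
    · obtain ⟨s, hs, hs2⟩ := h2
      have h3 : γ 0 ∈ γ '' Ico 0 t := ⟨0, ⟨le_rfl, hs.1.trans_lt hs.2⟩, rfl⟩
      have h4 : γ (L / 2) ∈ γ '' Ico 0 t := ⟨s, hs, hs2⟩
      simp [h3, h4, hR]
    · by_cases h3 : γ 0 ∈ γ '' Ico 0 t <;> simp [h2, h3, hR]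
  have h0 : IsLeast (N '' Ico 0 L) 0 := by
    refine ⟨⟨0, hmem0, ?_⟩, ?_⟩
    · rw [hNt]; simp
    · rintro _ ⟨t, ht, rfl⟩
      exact (hb t ht).1
  have h1 : IsGreatest (N '' Ico 0 L) R := by
    refine ⟨⟨L / 2, hmem2, ?_⟩, ?_⟩
    · have e1 : γ 0 ∈ γ '' Ico 0 (L / 2) := ⟨0, ⟨le_rfl, by linarith⟩, rfl⟩
      have e2 : γ (L / 2) ∉ γ '' Ico 0 (L / 2) := by
        rintro ⟨s, hs, hs2⟩
        have := hγ.bijOn.injOn ⟨hs.1, by linarith [hs.2]⟩ hmem2 hs2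
        linarith [hs.2]
      rw [hNt]
      simp [e1, e2]
    · rintro _ ⟨t, ht, rfl⟩
      exact (hb t ht).2
  rw [maxValue, ← hN, h1.csSup_eq, h0.csInf_eq, sub_zero]

theorem exists_not_linear_Icc {τ : ℝ → ℝ} (h : ¬ ∃ α : ℝ, ∀ s, 0 ≤ s → τ s = α * s) :
    ∃ R : ℝ, 0 ≤ R ∧ ¬ ∃ α : ℝ, ∀ s ∈ Icc 0 R, τ s = α * s := by
  by_contra! hcon
  refine h ⟨τ 1, fun s hs => ?_⟩
  -- An interval containing both `s` and `1` identifies its slope as `τ 1`, independently of `s`.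
  obtain ⟨α, hα⟩ := hcon (max s 1) (by positivity)
  rw [hα s ⟨hs, le_max_left _ _⟩, hα 1 ⟨zero_le_one, le_max_right _ _⟩, mul_one]

end

end BranchedTransport

theorem mainTheorem7 (Ω : Set Plane) (hΩo : IsOpen Ω) (hΩc : Convex ℝ Ω)
    (hΩb : Bornology.IsBounded Ω) (hΩn : Ω.Nonempty)
    (γ : ℝ → Plane) (L : ℝ) (hγ : IsArclengthParam Ω γ L)
    (τ : ℝ → ℝ) (hτ : IsTransportationCost τ) :
    (∀ μp μm : Measure Plane, IsSourceSink Ω μp μm →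
      -- the inequality, the right-hand side being meaningful
      (∀ v : Lifted → ℝ, MemC Ω γ L μp μm v →
        (∀ᵐ t ∂(volume.restrict (Ioo (0 : ℝ) 1)), MemC Ω γ L μp μm (superlevel v t)) ∧
        AEMeasurable (fun t => convexCost Ω (maxValue γ L μp μm) τ (superlevel v t))
          (volume.restrict (Ioo (0 : ℝ) 1)) ∧
        convexCost Ω (maxValue γ L μp μm) τ v
          ≤ ∫⁻ t in Ioo (0 : ℝ) 1, convexCost Ω (maxValue γ L μp μm) τ (superlevel v t)) ∧
      -- equality in the one-homogeneous case
      (∀ α : ℝ, (∀ s, 0 ≤ s → τ s = α * s) → ∀ v : Lifted → ℝ, MemC Ω γ L μp μm v →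
        convexCost Ω (maxValue γ L μp μm) τ v
          = ∫⁻ t in Ioo (0 : ℝ) 1, convexCost Ω (maxValue γ L μp μm) τ (superlevel v t)) ∧
      -- strict inequality for averages of linear images
      (∀ m b c : ℝ, 0 < m → 0 < c →
        (∀ x ∈ Ω, 0 ≤ m * x 0 + b ∧ m * x 0 + b + c ≤ maxValue γ L μp μm) →
        ENNReal.ofReal (τ c) < rightDerivZero τ * ENNReal.ofReal c →
        MemC Ω γ L μp μm (averagedLift Ω γ L μp μm m b c) ∧
        convexCost Ω (maxValue γ L μp μm) τ (averagedLift Ω γ L μp μm m b c)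
          < ∫⁻ t in Ioo (0 : ℝ) 1, convexCost Ω (maxValue γ L μp μm) τ
              (superlevel (averagedLift Ω γ L μp μm m b c) t)) ∧
      -- hence the inequality is strict for some `v` as soon as `τ` is not linear on `[0, M]`
      ((¬ ∃ α : ℝ, ∀ s ∈ Icc 0 (maxValue γ L μp μm), τ s = α * s) →
        ∃ v : Lifted → ℝ, MemC Ω γ L μp μm v ∧
          convexCost Ω (maxValue γ L μp μm) τ v
            < ∫⁻ t in Ioo (0 : ℝ) 1, convexCost Ω (maxValue γ L μp μm) τ (superlevel v t))) ∧
    -- in particular, if `τ` is not linear, strict inequality occurs for some source and sink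
    ((¬ ∃ α : ℝ, ∀ s, 0 ≤ s → τ s = α * s) →
      ∃ μp μm : Measure Plane, IsSourceSink Ω μp μm ∧ ∃ v : Lifted → ℝ, MemC Ω γ L μp μm v ∧
        convexCost Ω (maxValue γ L μp μm) τ v
          < ∫⁻ t in Ioo (0 : ℝ) 1, convexCost Ω (maxValue γ L μp μm) τ (superlevel v t)) := by
  refine ⟨fun μp μm hμ => ⟨fun v hv => convexCost_le_lintegral_superlevel hΩb hτ hv,
    fun α hα v hv => le_antisymm (convexCost_le_lintegral_superlevel hΩb hτ hv).2.2
      (lintegral_superlevel_le_of_linear hΩb hτ hv hα), fun m b c hm hc hr hslope => ?_,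
    fun h => exists_convexCost_lt hΩo hΩc hΩb hΩn hγ hτ hμ h⟩, fun h => ?_⟩
  · have H : RampSetting Ω γ L μp μm m b c := ⟨hΩo, hΩc, hΩb, hΩn, hγ, hμ, hm, hc, hr⟩
    exact H.averagedLift_strict hτ hslope
  · obtain ⟨R, hR, hlin⟩ := exists_not_linear_Icc h
    rw [← maxValue_dirac hγ hR] at hlin
    have hμ := isSourceSink_dirac hγ R
    exact ⟨_, _, hμ, exists_convexCost_lt hΩo hΩc hΩb hΩn hγ hτ hμ hlin⟩
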